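/- \textbf{Theorem (KEM Separation Theorem).} Let $(M,g)$ be a $C^\infty$ pseudo-Riemannian manifold of dimension $n$, of arbitrary signature and of constant curvature, with Levi-Civita connection $\nabla$. \emph{(1) Coordinate form.} Let $(x_1,\dots,x_n)$ be orthogonal local coordinates that are separable, i.e. near each point the geodesic Hamilton--Jacobi equation $\tfrac12 g^{ij}\,\partial_iW\,\partial_jW=E$ has a complete integral of the form $W=\sum_i W_i(x_i,c)$, $c\in\mathbb R^n$, $\det(\partial^2W/\partial x_i\partial c_j)\neq 0$. Then on every product of open intervals $\prod_i J_i$ contained in the coordinate domain there are a subset $S\subseteq\{1,\dots,n\}$, a partition $P$ of its complement, smooth functions $\Phi_a(x_a)$ and smooth non-constant functions $\sigma_a(x_a)$ for $a\in S$, pairwise distinct constants $e_I$ for $I\in P$, and smooth symmetric tensors $g^I=\sum_{i,j\in I} f^I_{ij}(x_I)\,dx_i\,dx_j$ whose coefficients depend only on the coordinates $x_I=(x_k)_{k\in I}$, such that $$g=\sum_{a\in S}\Phi_a\prod_{b\in S,\,b\ne a}(\sigma_a-\sigma_b)\,dx_a^2+\sum_{I\in P}\Big(\prod_{a\in S}(e_I-\sigma_a)\Big)g^I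 .$$ If $n>1$, this can be done non-trivially: $S\neq\emptyset$ or $P$ has at least two elements. \emph{(2) Tensor form.} A Killing tensor is a smooth symmetric $2$-tensor $K$ with $\nabla_{(i}K_{jk)}=0$; it is characteristic if at each point (as a $(1,1)$-tensor) it has $n$ distinct real eigenvalues and near each point it is diagonal in some local coordinates. A concircular tensor is a smooth symmetric $2$-tensor $L$ with $\nabla_kL_{ij}=\alpha_{(i}g_{j)k}$ for some covector field $\alpha$. Let $K$ be a characteristic Killing tensor on $M$ and let $U\subseteq M$ be open and simply connected ($U=M$ if $M$ is simply connected; in general, $U$ may be a small neighbourhood of any given point). Then there is a concircular tensor $L$ on $U$ which, if $n>1$, is at no point of $U$ a multiple of the metric, such that each eigenspace of $K$ at each point of $U$ is $L$-invariant. Moreover, $L$ can be chosen so that its eigenspaces are uniquely determined by the web of eigenspaces of $K$: they are the finest possible, i.e. for every concircular tensor $L'$ on an open set $V\subseteq U$ that leaves the eigenspaces of $K$ invariant, and every $p\in V$, each eigenspace of $L$ at $p$ is contained in an eigenspace of $L'$ at $p$. -/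

import Mathlib

open Set Manifold
open scoped ContDiff

noncomputable section

namespace KEM

/-! ### Coordinate formulas

A symmetric 2-tensor in coordinates is a matrix-valued function on `ℝⁿ`. -/

/-- The partial derivative `∂ᵢ f` at `x`. -/
def pd {n : ℕ} (i : Fin n) (f : (Fin n → ℝ) → ℝ) (x : Fin n → ℝ) : ℝ :=
  fderiv ℝ f x (Pi.single i 1)

/-- Christoffel symbols of the Levi-Civita connection,
`Γᵏᵢⱼ = ½ ∑ₗ gᵏˡ (∂ᵢ gⱼₗ + ∂ⱼ gᵢₗ - ∂ₗ gᵢⱼ)`. -/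
def christoffel {n : ℕ} (g : (Fin n → ℝ) → Matrix (Fin n) (Fin n) ℝ) (k i j : Fin n)
    (x : Fin n → ℝ) : ℝ :=
  (1 / 2) * ∑ l, (g x)⁻¹ k l *
    (pd i (fun y => g y j l) x + pd j (fun y => g y i l) x - pd l (fun y => g y i j) x)

/-- Components of the Riemann tensor: `R(∂ᵢ, ∂ⱼ) ∂ₖ = ∑ₗ (riemann g l k i j) ∂ₗ`, where
`R(X, Y) Z = ∇_X ∇_Y Z - ∇_Y ∇_X Z - ∇_[X,Y] Z`. -/
def riemann {n : ℕ} (g : (Fin n → ℝ) → Matrix (Fin n) (Fin n) ℝ) (l k i j : Fin n)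
    (x : Fin n → ℝ) : ℝ :=
  pd i (christoffel g l j k) x - pd j (christoffel g l i k) x
    + ∑ m, (christoffel g l i m x * christoffel g m j k x
      - christoffel g l j m x * christoffel g m i k x)

/-- `∇ₖ Tᵢⱼ` for a covariant 2-tensor `T` and the Levi-Civita connection of `g`. -/
def covDeriv {n : ℕ} (g T : (Fin n → ℝ) → Matrix (Fin n) (Fin n) ℝ) (k i j : Fin n)
    (x : Fin n → ℝ) : ℝ :=
  pd k (fun y => T y i j) x
    - ∑ l, christoffel g l k i x * T x l j - ∑ l, christoffel g l k j x * T x i l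

/-! ### Tensors on manifolds -/

section Manifold

variable {n : ℕ} {M : Type*} [TopologicalSpace M] [ChartedSpace (Fin n → ℝ) M]

/-- `φ` is a (smooth) local coordinate system of `M`. -/
def IsCoord (φ : OpenPartialHomeomorph M (Fin n → ℝ)) : Prop :=
  φ ∈ IsManifold.maximalAtlas 𝓘(ℝ, Fin n → ℝ) ∞ M

variable (n M) in
/-- Fields of bilinear forms on the tangent spaces of `M` (covariant 2-tensors, no regularity). -/
abbrev Tensor2 : Type _ :=
  (p : M) → LinearMap.BilinForm ℝ (TangentSpace 𝓘(ℝ, Fin n → ℝ) p)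

/-- The coordinate vector `∂ᵢ` of `φ` at the point with coordinates `x`. -/
def coordVec (φ : OpenPartialHomeomorph M (Fin n → ℝ)) (x : Fin n → ℝ) (i : Fin n) :
    TangentSpace 𝓘(ℝ, Fin n → ℝ) (φ.symm x) :=
  mfderiv 𝓘(ℝ, Fin n → ℝ) 𝓘(ℝ, Fin n → ℝ) φ.symm x (Pi.single i 1 : Fin n → ℝ)

/-- The components `Tᵢⱼ = T(∂ᵢ, ∂ⱼ)` of `T` in the coordinates `φ`. -/
def comp (T : Tensor2 n M) (φ : OpenPartialHomeomorph M (Fin n → ℝ)) (x : Fin n → ℝ) :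
    Matrix (Fin n) (Fin n) ℝ :=
  Matrix.of fun i j => T (φ.symm x) (coordVec φ x i) (coordVec φ x j)

/-- `T` is a smooth symmetric 2-tensor on the open set `U`. -/
def IsSmoothSymmOn (T : Tensor2 n M) (U : Set M) : Prop :=
  (∀ p ∈ U, ∀ v w, T p v w = T p w v) ∧
  ∀ φ : OpenPartialHomeomorph M (Fin n → ℝ), IsCoord φ → ∀ i j,
    ContDiffOn ℝ ∞ (fun x => comp T φ x i j) (φ.target ∩ φ.symm ⁻¹' U)

/-- `g` is a pseudo-Riemannian metric on `M` (of any signature). -/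
def IsPseudoRiemannian (g : Tensor2 n M) : Prop :=
  IsSmoothSymmOn g univ ∧ ∀ p, (g p).Nondegenerate

/-- `R(X, Y) Z = κ (g(Y, Z) X - g(X, Z) Y)`, i.e. all sectional curvatures equal `κ`. -/
def HasConstantCurvature (g : Tensor2 n M) (κ : ℝ) : Prop :=
  ∀ φ : OpenPartialHomeomorph M (Fin n → ℝ), IsCoord φ → ∀ x ∈ φ.target, ∀ l k i j,
    riemann (comp g φ) l k i j x =
      κ * (comp g φ x j k * (1 : Matrix (Fin n) (Fin n) ℝ) l i
        - comp g φ x i k * (1 : Matrix (Fin n) (Fin n) ℝ) l j)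

/-- The eigenspace at `p`, for the eigenvalue `μ`, of the `(1,1)`-tensor obtained from `T` by
raising an index with `g`: all `v` with `T(v, ·) = μ g(v, ·)`. -/
def eigSpace (g T : Tensor2 n M) (p : M) (μ : ℝ) :
    Submodule ℝ (TangentSpace 𝓘(ℝ, Fin n → ℝ) p) :=
  LinearMap.ker (T p - μ • g p)

/-- `K` is a Killing tensor on `M`: `∇₍ᵢ Kⱼₖ₎ = 0`. -/
def IsKilling (g K : Tensor2 n M) : Prop :=
  IsSmoothSymmOn K univ ∧
  ∀ φ : OpenPartialHomeomorph M (Fin n → ℝ), IsCoord φ → ∀ x ∈ φ.target, ∀ i j k,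
    covDeriv (comp g φ) (comp K φ) i j k x + covDeriv (comp g φ) (comp K φ) j k i x
      + covDeriv (comp g φ) (comp K φ) k i j x = 0

/-- `K` is a characteristic Killing tensor: at every point it has `n` distinct real eigenvalues,
and near every point there are coordinates in which it is diagonal (as a `(1,1)`-tensor). -/
def IsCharacteristicKilling (g K : Tensor2 n M) : Prop :=
  IsKilling g K ∧
  (∀ p, ∃ μ : Fin n → ℝ, Function.Injective μ ∧ ∀ i, eigSpace g K p (μ i) ≠ ⊥) ∧
  ∀ p, ∃ φ : OpenPartialHomeomorph M (Fin n → ℝ), IsCoord φ ∧ p ∈ φ.source ∧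
    ∀ x ∈ φ.target, ∀ i, ∃ μ : ℝ, coordVec φ x i ∈ eigSpace g K (φ.symm x) μ

/-- `L` is a concircular tensor on the open set `U`: `∇ₖ Lᵢⱼ = α₍ᵢ gⱼ₎ₖ` for some covector `α`. -/
def IsConcircularOn (g L : Tensor2 n M) (U : Set M) : Prop :=
  IsSmoothSymmOn L U ∧
  ∀ φ : OpenPartialHomeomorph M (Fin n → ℝ), IsCoord φ → ∀ x ∈ φ.target, φ.symm x ∈ U →
    ∃ α : Fin n → ℝ, ∀ i j k, covDeriv (comp g φ) (comp L φ) k i j x =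
      (1 / 2) * (α i * comp g φ x j k + α j * comp g φ x i k)

/-- On `U` each eigenspace of `K` is `L`-invariant. The vector `u` below is the image of `v` under
the `(1,1)`-tensor of `L`. -/
def LeavesEigenspacesInvariantOn (g K L : Tensor2 n M) (U : Set M) : Prop :=
  ∀ p ∈ U, ∀ μ : ℝ, ∀ v ∈ eigSpace g K p μ, ∃ u ∈ eigSpace g K p μ, ∀ w, L p v w = g p u w

/-- `L` is non-trivial on `U`: if `n > 1`, it is (at no point of `U`) a multiple of the metric. -/
def IsNontrivialOn (g L : Tensor2 n M) (U : Set M) : Prop :=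
  1 < n → ∀ p ∈ U, ∀ c : ℝ, L p ≠ c • g p

/-- The coordinates `φ` are orthogonal. -/
def IsOrthogonal (g : Tensor2 n M) (φ : OpenPartialHomeomorph M (Fin n → ℝ)) : Prop :=
  ∀ x ∈ φ.target, ∀ i j, i ≠ j → comp g φ x i j = 0

/-- The coordinates `φ` are separable: near each point the geodesic Hamilton–Jacobi equation
`½ ∑ᵢⱼ gⁱʲ ∂ᵢW ∂ⱼW = E` has a complete integral `W = ∑ᵢ Wᵢ(xᵢ, c)` that depends on parameters
`c = (c₁, …, cₙ)` with `det (∂²W / ∂xᵢ ∂cⱼ) ≠ 0`. -/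
def IsSeparable (g : Tensor2 n M) (φ : OpenPartialHomeomorph M (Fin n → ℝ)) : Prop :=
  ∀ x₀ ∈ φ.target, ∃ (V C : Set (Fin n → ℝ)) (W : Fin n → ℝ → (Fin n → ℝ) → ℝ)
      (E : (Fin n → ℝ) → ℝ),
    IsOpen V ∧ x₀ ∈ V ∧ V ⊆ φ.target ∧ IsOpen C ∧ C.Nonempty ∧
    (∀ i, ContDiffOn ℝ ∞ (fun q : ℝ × (Fin n → ℝ) => W i q.1 q.2)
      (((fun x : Fin n → ℝ => x i) '' V) ×ˢ C)) ∧
    ∀ x ∈ V, ∀ c ∈ C,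
      (1 / 2) * ∑ i, ∑ j, (comp g φ x)⁻¹ i j *
        deriv (fun t => W i t c) (x i) * deriv (fun t => W j t c) (x j) = E c ∧
      (Matrix.of fun i j => pd j (fun c' => deriv (fun t => W i t c') (x i)) c).det ≠ 0

end Manifold

/-- On the box `∏ᵢ J i` the metric components `g` have the concircular form
`g = ∑_{a ∈ S} Φₐ ∏_{b ∈ S, b ≠ a} (σₐ - σ_b) dxₐ² + ∑_I (∏_{a ∈ S} (e_I - σₐ)) gᴵ`,
where `Φₐ`, `σₐ` are functions of `xₐ`, no `σₐ` is constant, and `gᴵ` is a metric in the coordinates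
of the block `I`. The blocks `I` form the partition of the complement of `S` into the level sets
of `e`, so the constants `e_I` are distinct. The last condition says that the associated tensor
`∑_{a ∈ S} σₐ ∂ₐ ⊗ dxₐ + ∑_I e_I ∑_{i ∈ I} ∂ᵢ ⊗ dxᵢ` is not a multiple of the identity if
`n > 1`. -/
def HasConcircularForm {n : ℕ} (g : (Fin n → ℝ) → Matrix (Fin n) (Fin n) ℝ)
    (J : Fin n → Set ℝ) : Prop :=
  ∃ (S : Finset (Fin n)) (e : Fin n → ℝ) (Φ σ : Fin n → ℝ → ℝ)
    (f : Fin n → Fin n → (Fin n → ℝ) → ℝ),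
    (∀ a ∈ S, ContDiffOn ℝ ∞ (Φ a) (J a) ∧ ContDiffOn ℝ ∞ (σ a) (J a) ∧
      ∃ s ∈ J a, ∃ t ∈ J a, σ a s ≠ σ a t) ∧
    (∀ i j, i ∉ S → j ∉ S → e i = e j → ContDiffOn ℝ ∞ (f i j) (univ.pi J) ∧
      ∀ x ∈ univ.pi J, ∀ y ∈ univ.pi J, (∀ k, k ∉ S → e k = e i → x k = y k) →
        f i j x = f i j y) ∧
    (∀ x ∈ univ.pi J,
      (∀ a ∈ S, g x a a = Φ a (x a) * ∏ b ∈ S.erase a, (σ a (x a) - σ b (x b))) ∧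
      (∀ i j, i ∉ S → j ∉ S → e i = e j →
        g x i j = (∏ a ∈ S, (e i - σ a (x a))) * f i j x) ∧
      (∀ i j, i ≠ j → (i ∈ S ∨ j ∈ S ∨ e i ≠ e j) → g x i j = 0)) ∧
    (1 < n → S.Nonempty ∨ ∃ i j, e i ≠ e j)

end KEM

end

/-! In orthogonal separable coordinates, differentiating the separated Hamilton–Jacobi equation
gives the Levi-Civita conditions on the metric components `hᵢ = gᵢᵢ`; the same conditions hold in
coordinates that diagonalize a characteristic Killing tensor. Together with constant curvature they
form a system (`SepSystem`) for the logarithmic derivatives `∂ⱼ log |hᵢ|`. A concircular tensor that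
is diagonal in such coordinates is the same thing as a solution of `λⱼ' = (λⱼ - λᵢ) ∂ⱼ log |hᵢ|`,
`i ≠ j`, with eigenvalues `λⱼ` depending on `xⱼ` only (`IsSol`), so both forms of the theorem come
down to this linear system.

*Local existence.* Shrink to a box on which each `∂ⱼ hᵢ`, `i ≠ j`, vanishes either everywhere or
nowhere. The relation `∂ⱼ hᵢ ≠ 0` then either has a root, from which a solution can be written down,
or splits the indices into two blocks that do not interact, on which `λ` may be two different
constants.

*Extension.* Without analyticity, a solution near a point extends to a box because along each
coordinate line the relevant functions generate a Noetherian algebra closed under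
differentiation: an element vanishing on a subinterval satisfies a linear ODE, hence vanishes.

*Coordinate form.* For a nontrivial solution, let `S` be the set of indices `a` for which
`σ_a = λ_a` is not constant, and group the others by the value of their constant `λᵢ`. By the
system, dividing `hᵢ` by `∏_{a ∈ S} (λᵢ - λ_a)` removes the dependence on the unwanted coordinates.

*Tensor form.* The germs of concircular tensors leaving the eigenspaces of `K` invariant form a
covering space, so they extend over a simply connected `U`. Their values at a point form a vector
space, and an element outside the finitely many proper subspaces on which two eigenvalues coincide
has the finest eigenspaces there, hence everywhere by connectedness.
-/

noncomputable section

namespace KEM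

/-! ### Partial derivatives and boxes -/

section PartialDerivatives

variable {n : ℕ} {f f₁ f₂ : (Fin n → ℝ) → ℝ} {x : Fin n → ℝ} {Ω : Set (Fin n → ℝ)}

lemma pd_congr (h : f₁ =ᶠ[nhds x] f₂) (i : Fin n) : pd i f₁ x = pd i f₂ x := by
  unfold pd; rw [h.fderiv_eq]

lemma pd_congr_on (hΩ : IsOpen Ω) (hx : x ∈ Ω) (h : ∀ y ∈ Ω, f₁ y = f₂ y) (i : Fin n) :
    pd i f₁ x = pd i f₂ x :=
  pd_congr (Filter.eventuallyEq_of_mem (hΩ.mem_nhds hx) h) i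

lemma pd_const (c : ℝ) (i : Fin n) : pd i (fun _ => c) x = 0 := by
  simp [pd]

lemma pd_eq_zero_of_eqOn (hΩ : IsOpen Ω) (hx : x ∈ Ω) (h : ∀ y ∈ Ω, f y = 0) (i : Fin n) :
    pd i f x = 0 := by
  rw [pd_congr_on hΩ hx h, pd_const]

lemma pd_add (h₁ : DifferentiableAt ℝ f₁ x) (h₂ : DifferentiableAt ℝ f₂ x) (i : Fin n) :
    pd i (fun y => f₁ y + f₂ y) x = pd i f₁ x + pd i f₂ x := by
  simp [pd, fderiv_fun_add h₁ h₂]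

lemma pd_sub (h₁ : DifferentiableAt ℝ f₁ x) (h₂ : DifferentiableAt ℝ f₂ x) (i : Fin n) :
    pd i (fun y => f₁ y - f₂ y) x = pd i f₁ x - pd i f₂ x := by
  simp [pd, fderiv_fun_sub h₁ h₂]

lemma pd_mul (h₁ : DifferentiableAt ℝ f₁ x) (h₂ : DifferentiableAt ℝ f₂ x) (i : Fin n) :
    pd i (fun y => f₁ y * f₂ y) x = pd i f₁ x * f₂ x + f₁ x * pd i f₂ x := by
  simp [pd, fderiv_fun_mul h₁ h₂]; ring

lemma pd_const_mul (c : ℝ) (h₁ : DifferentiableAt ℝ f x) (i : Fin n) :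
    pd i (fun y => c * f y) x = c * pd i f x := by
  rw [pd_mul (differentiableAt_const c) h₁, pd_const]; ring

lemma pd_sum {ι : Type*} {s : Finset ι} {F : ι → (Fin n → ℝ) → ℝ}
    (h : ∀ a ∈ s, DifferentiableAt ℝ (F a) x) (i : Fin n) :
    pd i (fun y => ∑ a ∈ s, F a y) x = ∑ a ∈ s, pd i (F a) x := by
  simp [pd, fderiv_fun_sum h]

lemma pd_log (h : DifferentiableAt ℝ f x) (h0 : f x ≠ 0) (i : Fin n) :
    pd i (fun y => Real.log (f y)) x = pd i f x / f x := by
  simp only [pd]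
  rw [fderiv.log h h0]
  simp [div_eq_inv_mul]

lemma pd_inv (h : DifferentiableAt ℝ f x) (h0 : f x ≠ 0) (i : Fin n) :
    pd i (fun y => (f y)⁻¹) x = -pd i f x / (f x) ^ 2 := by
  have := ((hasDerivAt_inv h0).comp_hasFDerivAt x h.hasFDerivAt).fderiv
  simp only [pd]
  rw [show (fun y => (f y)⁻¹) = (fun t : ℝ => t⁻¹) ∘ f from rfl, this]
  simp; ring

lemma differentiableAt_of_contDiffOn {E F : Type*} [NormedAddCommGroup E] [NormedSpace ℝ E]
    [NormedAddCommGroup F] [NormedSpace ℝ F] {f : E → F} {Ω : Set E} {x : E}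
    (hf : ContDiffOn ℝ ∞ f Ω) (hΩ : IsOpen Ω) (hx : x ∈ Ω) : DifferentiableAt ℝ f x :=
  (hf.contDiffAt (hΩ.mem_nhds hx)).differentiableAt (by simp)

lemma contDiffOn_pd (hf : ContDiffOn ℝ ∞ f Ω) (hΩ : IsOpen Ω) (i : Fin n) :
    ContDiffOn ℝ ∞ (pd i f) Ω := by
  have h1 : ContDiffOn ℝ ∞ (fderiv ℝ f) Ω := hf.fderiv_of_isOpen hΩ (by simp)
  exact h1.clm_apply contDiffOn_const

lemma pd_comm (hf : ContDiffOn ℝ ∞ f Ω) (hΩ : IsOpen Ω) (hx : x ∈ Ω) (i j : Fin n) :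
    pd i (pd j f) x = pd j (pd i f) x := by
  have hfx : ContDiffAt ℝ ∞ f x := hf.contDiffAt (hΩ.mem_nhds hx)
  have hsymm : IsSymmSndFDerivAt ℝ f x := hfx.isSymmSndFDerivAt (by
    rw [minSmoothness_of_isRCLikeNormedField]
    exact WithTop.coe_le_coe.2 (le_top (a := (2 : ℕ∞))))
  have hdiff : DifferentiableAt ℝ (fderiv ℝ f) x :=
    (hfx.fderiv_right (m := 1) (by norm_cast)).differentiableAt (by simp)
  have pd_pd (k l : Fin n) : pd k (pd l f) x =
      fderiv ℝ (fderiv ℝ f) x (Pi.single k 1) (Pi.single l 1) := by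
    unfold pd
    rw [fderiv_clm_apply hdiff (differentiableAt_const _)]
    simp
  rw [pd_pd, pd_pd]
  exact hsymm _ _

lemma hasDerivAt_comp_update {i : Fin n} {t : ℝ}
    (h : DifferentiableAt ℝ f (Function.update x i t)) :
    HasDerivAt (fun s => f (Function.update x i s)) (pd i f (Function.update x i t)) t :=
  h.hasFDerivAt.comp_hasDerivAt t (hasDerivAt_update x i t)

lemma hasDerivAt_comp_update_self (h : DifferentiableAt ℝ f x) (i : Fin n) :
    HasDerivAt (fun s => f (Function.update x i s)) (pd i f x) (x i) := by
  have hline := hasDerivAt_comp_update (f := f) (x := x) (i := i) (t := x i)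
    (by rwa [Function.update_eq_self])
  rwa [Function.update_eq_self] at hline

end PartialDerivatives

section Boxes

variable {n : ℕ}

/-- The sets `J i` are nonempty open intervals, so that `univ.pi J` is a box. -/
def IsBox (J : Fin n → Set ℝ) : Prop := ∀ i, IsOpen (J i) ∧ (J i).OrdConnected ∧ (J i).Nonempty

variable {J : Fin n → Set ℝ} {x y : Fin n → ℝ}

lemma IsBox.isOpen (hJ : IsBox J) : IsOpen (univ.pi J) :=
  isOpen_set_pi finite_univ fun i _ => (hJ i).1

lemma IsBox.nonempty (hJ : IsBox J) : (univ.pi J).Nonempty :=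
  univ_pi_nonempty_iff.2 fun i => (hJ i).2.2

lemma IsBox.subset_of_pi_subset {J' : Fin n → Set ℝ} (hJ : IsBox J) (h : univ.pi J ⊆ univ.pi J')
    (i : Fin n) : J i ⊆ J' i :=
  (univ_pi_subset_univ_pi_iff.1 h).resolve_right (fun ⟨i, hi⟩ => (hJ i).2.2.ne_empty hi) i

lemma update_mem_box (hx : x ∈ univ.pi J) {i : Fin n} {t : ℝ} (ht : t ∈ J i) :
    Function.update x i t ∈ univ.pi J := by
  intro j _
  by_cases h : j = i
  · subst h; simpa
  · simpa [Function.update_of_ne h] using hx j (mem_univ _)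

lemma exists_box_subset {Ω : Set (Fin n → ℝ)} (hΩ : IsOpen Ω) (hx : x ∈ Ω) :
    ∃ J, IsBox J ∧ x ∈ univ.pi J ∧ univ.pi J ⊆ Ω := by
  obtain ⟨r, hr, hb⟩ := Metric.isOpen_iff.1 hΩ x hx
  refine ⟨fun i => Metric.ball (x i) r, fun i => ⟨Metric.isOpen_ball, ?_, ?_⟩, ?_, ?_⟩
  · simp only [Real.ball_eq_Ioo]; exact ordConnected_Ioo
  · exact ⟨x i, Metric.mem_ball_self hr⟩
  · intro i _; exact Metric.mem_ball_self hr
  · rw [← ball_pi x hr]; exact hb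

lemma eq_of_hasDerivAt_zero {I : Set ℝ} (hI : IsOpen I) (hc : I.OrdConnected) {f : ℝ → ℝ}
    (h : ∀ t ∈ I, HasDerivAt f 0 t) {s t : ℝ} (hs : s ∈ I) (ht : t ∈ I) : f s = f t :=
  hI.is_const_of_deriv_eq_zero hc.isPreconnected
    (fun t ht => (h t ht).differentiableAt.differentiableWithinAt)
    (fun t ht => (h t ht).deriv) hs ht

lemma eq_of_update_eq {β : Type*} {f : (Fin n → ℝ) → β} (s : Finset (Fin n))
    (h : ∀ i ∈ s, ∀ x ∈ univ.pi J, ∀ t ∈ J i, f (Function.update x i t) = f x)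
    (hx : x ∈ univ.pi J) (hy : y ∈ univ.pi J) (hxy : ∀ i ∉ s, x i = y i) : f x = f y := by
  induction s using Finset.induction_on generalizing x with
  | empty => exact congrArg f (funext fun i => hxy i (Finset.notMem_empty i))
  | insert a s _ ih =>
    have hya := hy a (mem_univ a)
    rw [← h a (Finset.mem_insert_self a s) x hx _ hya]
    refine ih (fun i hi => h i (Finset.mem_insert_of_mem hi)) (update_mem_box hx hya)
      fun i hi => ?_
    by_cases hia : i = a
    · rw [hia, Function.update_self]
    · rw [Function.update_of_ne hia]
      exact hxy i (by simp [hia, hi])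

lemma eq_of_pd_eq_zero (hJ : IsBox J) {f : (Fin n → ℝ) → ℝ}
    (hf : ∀ x ∈ univ.pi J, DifferentiableAt ℝ f x) (s : Finset (Fin n))
    (h : ∀ i ∈ s, ∀ x ∈ univ.pi J, pd i f x = 0) (hx : x ∈ univ.pi J) (hy : y ∈ univ.pi J)
    (hxy : ∀ i ∉ s, x i = y i) : f x = f y := by
  refine eq_of_update_eq s (fun i hi x hx t ht => ?_) hx hy hxy
  have hderiv : ∀ t ∈ J i, HasDerivAt (fun s => f (Function.update x i s)) 0 t := fun t ht => by
    have hxt := update_mem_box hx ht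
    simpa only [h i hi _ hxt] using hasDerivAt_comp_update (hf _ hxt)
  simpa only [Function.update_eq_self] using
    eq_of_hasDerivAt_zero (hJ i).1 (hJ i).2.1 hderiv ht (hx i (mem_univ i))

end Boxes

/-! ### Unique continuation in differential algebras of functions -/

section UniqueContinuation

variable {J : Set ℝ}

lemma eq_zero_of_hasDerivAt_clm {E : Type*} [NormedAddCommGroup E] [NormedSpace ℝ E]
    (hc : J.OrdConnected) {v : ℝ → E} {N : ℝ → E →L[ℝ] E} (hN : ContinuousOn N J)
    (hv : ∀ t ∈ J, HasDerivAt v (N t (v t)) t) {t₀ : ℝ} (ht₀ : t₀ ∈ J) (h0 : v t₀ = 0)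
    {t : ℝ} (ht : t ∈ J) : v t = 0 := by
  have hsub : uIcc t₀ t ⊆ J := hc.uIcc_subset ht₀ ht
  obtain ⟨C, hC⟩ := isCompact_uIcc.exists_bound_of_continuousOn (hN.mono hsub)
  have hlip : ∀ s ∈ uIcc t₀ t, LipschitzOnWith C.toNNReal (fun w => N s w) univ := fun s hs =>
    ((N s).lipschitz.weaken (by
      rw [← NNReal.coe_le_coe, coe_nnnorm]
      exact (hC s hs).trans (Real.le_coe_toNNReal C))).lipschitzOnWith
  have hcont : ContinuousOn v (uIcc t₀ t) := HasDerivAt.continuousOn fun s hs => hv s (hsub hs)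
  have hzero (s : ℝ) : HasDerivAt (fun _ : ℝ => (0 : E)) (N s 0) s := by
    simpa using hasDerivAt_const s (0 : E)
  rcases le_total t₀ t with h | h
  · rw [uIcc_of_le h] at *
    exact ODE_solution_unique_of_mem_Icc_right (v := fun s w => N s w) (s := fun _ => univ)
      (fun s hs => hlip s (Ico_subset_Icc_self hs)) hcont
      (fun s hs => (hv s (hsub (Ico_subset_Icc_self hs))).hasDerivWithinAt) (fun _ _ => mem_univ _)
      continuousOn_const (fun s _ => (hzero s).hasDerivWithinAt) (fun _ _ => mem_univ _) h0
      ⟨h, le_rfl⟩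
  · rw [uIcc_of_ge h] at *
    exact ODE_solution_unique_of_mem_Icc_left (v := fun s w => N s w) (s := fun _ => univ)
      (fun s hs => hlip s (Ioc_subset_Icc_self hs)) hcont
      (fun s hs => (hv s (hsub (Ioc_subset_Icc_self hs))).hasDerivWithinAt) (fun _ _ => mem_univ _)
      continuousOn_const (fun s _ => (hzero s).hasDerivWithinAt) (fun _ _ => mem_univ _) h0
      ⟨le_rfl, h⟩

lemma eq_zero_of_linear_recurrence (hc : J.OrdConnected) {ρ : ℝ → ℝ} (hρ : ContinuousOn ρ J)
    {s : ℕ → ℝ → ℝ} (hs : ∀ k, ∀ t ∈ J, HasDerivAt (s k) (ρ t * s (k + 1) t) t) {m : ℕ}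
    {c : Fin m → ℝ → ℝ} (hcont : ∀ l, ContinuousOn (c l) J)
    (hrec : ∀ t ∈ J, s m t = ∑ l, c l t * s l t) {t₀ : ℝ} (ht₀ : t₀ ∈ J)
    (h0 : ∀ k, s k t₀ = 0) {t : ℝ} (ht : t ∈ J) : s 0 t = 0 := by
  rcases m.eq_zero_or_pos with rfl | hm
  · simpa using hrec t ht
  let companion (t : ℝ) : Matrix (Fin m) (Fin m) ℝ := Matrix.of fun k l =>
    if (k : ℕ) + 1 < m then (if (l : ℕ) = k + 1 then 1 else 0) else c l t
  have hcompanion : ContinuousOn companion J := by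
    refine continuousOn_pi.2 fun k => continuousOn_pi.2 fun l => ?_
    by_cases hk : (k : ℕ) + 1 < m <;> simp only [companion, hk, if_true, if_false, Matrix.of_apply]
    exacts [continuousOn_const, hcont l]
  have hmulVec (t : ℝ) (ht : t ∈ J) (k : Fin m) :
      (companion t).mulVec (fun l => s l t) k = s (k + 1) t := by
    by_cases hk : (k : ℕ) + 1 < m
    · rw [Matrix.mulVec, dotProduct, Finset.sum_eq_single (⟨k + 1, hk⟩ : Fin m)]
      · simp [companion, hk]
      · intro l _ hl
        have hlk : (l : ℕ) ≠ k + 1 := fun h => hl (Fin.ext h)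
        simp [companion, hk, hlk]
      · simp
    · have hkm : (k : ℕ) + 1 = m := by lia
      simp [Matrix.mulVec, dotProduct, companion, hkm, hrec t ht]
  let toCLM : Matrix (Fin m) (Fin m) ℝ →ₗ[ℝ] ((Fin m → ℝ) →L[ℝ] (Fin m → ℝ)) :=
    LinearMap.toContinuousLinearMap.toLinearMap ∘ₗ Matrix.toLin'.toLinearMap
  have hv := eq_zero_of_hasDerivAt_clm hc (v := fun t (l : Fin m) => s l t)
    (N := fun t => ρ t • toCLM (companion t))
    (hρ.smul (toCLM.continuous_of_finiteDimensional.comp_continuousOn hcompanion))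
    (fun t ht => hasDerivAt_pi.2 fun k => by
      simpa [toCLM, hmulVec t ht] using hs k t ht) ht₀ (funext fun k => h0 k) ht
  exact congrFun hv ⟨0, hm⟩

lemma exists_eq_sum_mul_of_isNoetherianRing {A : Type*} [CommRing A] [IsNoetherianRing A]
    (s : ℕ → A) : ∃ (m : ℕ) (c : Fin m → A), s m = ∑ l, c l * s l := by
  let I : ℕ →o Ideal A :=
    { toFun := fun m => Ideal.span (range fun k : Fin m => s k)
      monotone' := fun m m' h => Ideal.span_mono (by
        rintro _ ⟨k, rfl⟩
        exact ⟨⟨k, k.2.trans_le h⟩, rfl⟩) }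
  obtain ⟨m, hm⟩ := monotone_stabilizes_iff_noetherian.2 inferInstance I
  have hsm : s m ∈ I m := by
    rw [hm (m + 1) m.le_succ]
    exact Ideal.subset_span ⟨⟨m, m.lt_succ_self⟩, rfl⟩
  obtain ⟨c, hc⟩ := Ideal.mem_span_range_iff_exists_fun.1 hsm
  exact ⟨m, c, hc.symm⟩

variable {ι : Type*} {G : ι → ℝ → ℝ} {ρ : ℝ → ℝ}

lemma exists_deriv_mem_adjoin
    (hD : ∀ i, ∃ X ∈ Algebra.adjoin ℝ (range G), ∀ t ∈ J, HasDerivAt (G i) (ρ t * X t) t)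
    {f : ℝ → ℝ} (hf : f ∈ Algebra.adjoin ℝ (range G)) :
    ∃ f' ∈ Algebra.adjoin ℝ (range G), ∀ t ∈ J, HasDerivAt f (ρ t * f' t) t := by
  induction hf using Algebra.adjoin_induction with
  | mem f hf => obtain ⟨i, rfl⟩ := hf; exact hD i
  | algebraMap r =>
    refine ⟨0, zero_mem _, fun t _ => ?_⟩
    simpa using! hasDerivAt_const t r
  | add f₁ f₂ _ _ h₁ h₂ =>
    obtain ⟨f₁', m₁, h₁⟩ := h₁
    obtain ⟨f₂', m₂, h₂⟩ := h₂
    refine ⟨f₁' + f₂', add_mem m₁ m₂, fun t ht => ?_⟩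
    convert! (h₁ t ht).add (h₂ t ht) using 1
    simp only [Pi.add_apply, mul_add]
  | mul f₁ f₂ hf₁ hf₂ h₁ h₂ =>
    obtain ⟨f₁', m₁, h₁⟩ := h₁
    obtain ⟨f₂', m₂, h₂⟩ := h₂
    refine ⟨f₁' * f₂ + f₁ * f₂', add_mem (mul_mem m₁ hf₂) (mul_mem hf₁ m₂), fun t ht => ?_⟩
    convert! (h₁ t ht).mul (h₂ t ht) using 1
    simp only [Pi.add_apply, Pi.mul_apply]
    ring

/-- A substitute for the identity theorem for analytic functions: the algebra is Noetherian, so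
finitely many of the iterated derivatives of `f` satisfy a linear homogeneous system. -/
theorem eq_zero_of_mem_adjoin [Finite ι] (hc : J.OrdConnected) (hJ : IsOpen J)
    (hρ : ContinuousOn ρ J) (hρ0 : ∀ t ∈ J, ρ t ≠ 0)
    (hD : ∀ i, ∃ X ∈ Algebra.adjoin ℝ (range G), ∀ t ∈ J, HasDerivAt (G i) (ρ t * X t) t)
    {f : ℝ → ℝ} (hf : f ∈ Algebra.adjoin ℝ (range G)) {t₀ : ℝ} (ht₀ : t₀ ∈ J)
    (h0 : f =ᶠ[nhds t₀] 0) {t : ℝ} (ht : t ∈ J) : f t = 0 := by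
  let A := Algebra.adjoin ℝ (range G)
  have : IsNoetherianRing A :=
    isNoetherianRing_of_fg (Subalgebra.fg_def.2 ⟨range G, finite_range G, rfl⟩)
  have exists_deriv (a : A) :
      ∃ a' : A, ∀ t ∈ J, HasDerivAt (a : ℝ → ℝ) (ρ t * (a' : ℝ → ℝ) t) t := by
    obtain ⟨a', ha', h⟩ := exists_deriv_mem_adjoin hD a.2
    exact ⟨⟨a', ha'⟩, h⟩
  choose D hD using exists_deriv
  let s : ℕ → A := fun k => D^[k] ⟨f, hf⟩
  have hs (k : ℕ) : ∀ t ∈ J, HasDerivAt (s k : ℝ → ℝ) (ρ t * (s (k + 1) : ℝ → ℝ) t) t := by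
    simpa only [s, Function.iterate_succ_apply'] using hD (s k)
  have hev (k : ℕ) : (s k : ℝ → ℝ) =ᶠ[nhds t₀] 0 := by
    induction k with
    | zero => exact h0
    | succ k ih =>
      filter_upwards [ih.eventuallyEq_nhds, hJ.mem_nhds ht₀] with r hr hrJ
      have hzero : HasDerivAt (s k : ℝ → ℝ) 0 r :=
        (hasDerivAt_const r (0 : ℝ)).congr_of_eventuallyEq hr
      exact (mul_eq_zero.1 ((hs k r hrJ).unique hzero)).resolve_left (hρ0 r hrJ)
  obtain ⟨m, c, hrec⟩ := exists_eq_sum_mul_of_isNoetherianRing s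
  refine eq_zero_of_linear_recurrence hc hρ (s := fun k => (s k : ℝ → ℝ))
    (c := fun l => (c l : ℝ → ℝ)) hs (fun l => HasDerivAt.continuousOn (hD (c l)))
    (fun t _ => ?_) ht₀ (fun k => (hev k).eq_of_nhds) ht
  have hrec_t := congrArg (fun a : A => (a : ℝ → ℝ) t) hrec
  simpa using hrec_t

end UniqueContinuation

/-! ### Separable orthogonal metrics of constant curvature -/

section SepSystem

variable {n : ℕ}

/-- The logarithmic derivative `∂ⱼ log |hᵢ|` (the absolute value is built into `Real.log`). -/
def logPd (h : Fin n → (Fin n → ℝ) → ℝ) (i j : Fin n) : (Fin n → ℝ) → ℝ :=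
  pd j (fun y => Real.log (h i y))

/-- The equations for the diagonal components `hᵢ` of a metric of constant curvature `κ` in
separable orthogonal coordinates: `pd_mixed`, `quad` and `pd_self` combine Levi-Civita's
separability conditions with the vanishing of the components `R_{ijik}` of the curvature, and
`gauss` says that the sectional curvature of the plane of `∂ᵢ` and `∂ⱼ` is `κ`. -/
structure SepSystem (κ : ℝ) (h : Fin n → (Fin n → ℝ) → ℝ) (Ω : Set (Fin n → ℝ)) : Prop where
  isOpen : IsOpen Ω
  smooth : ∀ i, ContDiffOn ℝ ∞ (h i) Ω
  ne_zero : ∀ i, ∀ x ∈ Ω, h i x ≠ 0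
  pd_mixed : ∀ i j k, i ≠ j → i ≠ k → j ≠ k → ∀ x ∈ Ω, pd k (logPd h i j) x = 0
  quad : ∀ i j k, i ≠ j → i ≠ k → j ≠ k → ∀ x ∈ Ω, logPd h k i x * logPd h k j x =
    logPd h k i x * logPd h i j x + logPd h k j x * logPd h j i x
  pd_self : ∀ i j, i ≠ j → ∀ x ∈ Ω, pd i (logPd h i j) x = -(logPd h i j x * logPd h j i x)
  gauss : ∀ i j, i ≠ j → ∀ x ∈ Ω,
    (h j x)⁻¹ * (2 * pd j (logPd h i j) x + logPd h i j x ^ 2 - logPd h i j x * logPd h j j x)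
    + (h i x)⁻¹ * (2 * pd i (logPd h j i) x + logPd h j i x ^ 2 - logPd h j i x * logPd h i i x)
    + ∑ k ∈ {k | k ≠ i ∧ k ≠ j}, (h k x)⁻¹ * (logPd h i k x * logPd h j k x) = -4 * κ

namespace SepSystem

variable {κ : ℝ} {h : Fin n → (Fin n → ℝ) → ℝ} {Ω Ω' : Set (Fin n → ℝ)} {x : Fin n → ℝ}

lemma mono (H : SepSystem κ h Ω) (hΩ' : IsOpen Ω') (hs : Ω' ⊆ Ω) : SepSystem κ h Ω' where
  isOpen := hΩ'
  smooth i := (H.smooth i).mono hs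
  ne_zero i x hx := H.ne_zero i x (hs hx)
  pd_mixed i j k h1 h2 h3 x hx := H.pd_mixed i j k h1 h2 h3 x (hs hx)
  quad i j k h1 h2 h3 x hx := H.quad i j k h1 h2 h3 x (hs hx)
  pd_self i j h1 x hx := H.pd_self i j h1 x (hs hx)
  gauss i j h1 x hx := H.gauss i j h1 x (hs hx)

variable (H : SepSystem κ h Ω)
include H

lemma smooth_log (i : Fin n) : ContDiffOn ℝ ∞ (fun y => Real.log (h i y)) Ω :=
  (H.smooth i).log fun x hx => H.ne_zero i x hx

lemma smooth_logPd (i j : Fin n) : ContDiffOn ℝ ∞ (logPd h i j) Ω :=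
  contDiffOn_pd (H.smooth_log i) H.isOpen j

lemma smooth_pd_logPd (i j k : Fin n) : ContDiffOn ℝ ∞ (pd k (logPd h i j)) Ω :=
  contDiffOn_pd (H.smooth_logPd i j) H.isOpen k

lemma diff_log (i : Fin n) (hx : x ∈ Ω) : DifferentiableAt ℝ (fun y => Real.log (h i y)) x :=
  differentiableAt_of_contDiffOn (H.smooth_log i) H.isOpen hx

lemma diff_logPd (i j : Fin n) (hx : x ∈ Ω) : DifferentiableAt ℝ (logPd h i j) x :=
  differentiableAt_of_contDiffOn (H.smooth_logPd i j) H.isOpen hx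

lemma diff_pd_logPd (i j k : Fin n) (hx : x ∈ Ω) :
    DifferentiableAt ℝ (pd k (logPd h i j)) x :=
  differentiableAt_of_contDiffOn (H.smooth_pd_logPd i j k) H.isOpen hx

lemma pd_logPd_comm (i j k : Fin n) (hx : x ∈ Ω) :
    pd k (logPd h i j) x = pd j (logPd h i k) x :=
  pd_comm (H.smooth_log i) H.isOpen hx k j

lemma pd_logPd_diag {i j : Fin n} (hij : i ≠ j) (hx : x ∈ Ω) :
    pd j (logPd h i i) x = -(logPd h i j x * logPd h j i x) := by
  rw [H.pd_logPd_comm i i j hx, H.pd_self i j hij x hx]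

end SepSystem

/-- The system `∂ⱼ λⱼ = (λⱼ - λᵢ) ∂ⱼ log |hᵢ|` for functions `λⱼ` of the single variables `xⱼ`. Its
solutions on a box are the eigenvalues of the concircular tensors diagonal in the coordinates. -/
def IsSol (h : Fin n → (Fin n → ℝ) → ℝ) (J : Fin n → Set ℝ) (lam : Fin n → ℝ → ℝ) : Prop :=
  ∀ x ∈ univ.pi J, ∀ i j, i ≠ j →
    HasDerivAt (lam j) ((lam j (x j) - lam i (x i)) * logPd h i j x) (x j)

section Solutions

variable {κ : ℝ} {h : Fin n → (Fin n → ℝ) → ℝ} {J : Fin n → Set ℝ} {x y : Fin n → ℝ}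
  {lam mu : Fin n → ℝ → ℝ}

lemma IsSol.const (c : ℝ) : IsSol h J fun _ _ => c := by
  intro x _ i j _
  simpa using hasDerivAt_const (x j) c

lemma IsSol.sub (h₁ : IsSol h J lam) (h₂ : IsSol h J mu) :
    IsSol h J fun i t => lam i t - mu i t := by
  intro x hx i j hij
  convert! (h₁ x hx i j hij).sub (h₂ x hx i j hij) using 1
  ring

lemma IsSol.add (h₁ : IsSol h J lam) (h₂ : IsSol h J mu) :
    IsSol h J fun i t => lam i t + mu i t := by
  intro x hx i j hij
  convert! (h₁ x hx i j hij).add (h₂ x hx i j hij) using 1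
  ring

lemma IsSol.smul (c : ℝ) (h₁ : IsSol h J lam) : IsSol h J fun i t => c * lam i t := by
  intro x hx i j hij
  convert! (h₁ x hx i j hij).const_mul c using 1
  ring

lemma IsSol.eq_exp (hJ : IsBox J) (H : SepSystem κ h (univ.pi J)) (hl : IsSol h J lam)
    (hx : x ∈ univ.pi J) {i j : Fin n} (hij : i ≠ j) {t : ℝ} (ht : t ∈ J j) :
    lam j t = lam i (x i) + (lam j (x j) - lam i (x i)) *
      Real.exp (Real.log (h i (Function.update x j t)) - Real.log (h i x)) := by
  have deriv_eq_zero : ∀ s ∈ J j, HasDerivAt (fun s => (lam j s - lam i (x i)) *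
      Real.exp (-Real.log (h i (Function.update x j s)))) 0 s := by
    intro s hs
    have hm := update_mem_box hx hs
    have h1 := hl _ hm i j hij
    rw [Function.update_self, Function.update_of_ne hij] at h1
    have h2 := (hasDerivAt_comp_update (H.diff_log i hm)).neg.exp
    convert! (h1.sub_const (lam i (x i))).mul h2 using 1
    simp only [logPd, Pi.neg_apply]
    ring
  have h1 := eq_of_hasDerivAt_zero (hJ j).1 (hJ j).2.1 deriv_eq_zero ht (hx j (mem_univ j))
  simp only [Function.update_eq_self] at h1
  have h2 : ∀ a b : ℝ, Real.exp (a - b) = Real.exp (-b) * (Real.exp (-a))⁻¹ := by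
    intro a b
    rw [← Real.exp_neg, ← Real.exp_add]
    congr 1
    ring
  rw [h2, ← mul_assoc, ← h1]
  field_simp
  ring

lemma IsSol.contDiffOn (hJ : IsBox J) (H : SepSystem κ h (univ.pi J)) (hl : IsSol h J lam)
    (hn : 1 < n) (j : Fin n) : ContDiffOn ℝ ∞ (lam j) (J j) := by
  have : Nontrivial (Fin n) := Fin.nontrivial_iff_two_le.2 hn
  obtain ⟨i, hij⟩ := exists_ne j
  obtain ⟨x, hx⟩ := hJ.nonempty
  have h1 : ContDiffOn ℝ ∞ (fun t => Real.log (h i (Function.update x j t))) (J j) :=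
    (H.smooth_log i).comp (contDiff_update ∞ x j).contDiffOn fun t ht => update_mem_box hx ht
  refine ContDiffOn.congr (f := fun t => lam i (x i) + (lam j (x j) - lam i (x i)) *
      Real.exp (Real.log (h i (Function.update x j t)) - Real.log (h i x))) ?_
    fun t ht => hl.eq_exp hJ H hx hij ht
  exact contDiffOn_const.add (contDiffOn_const.mul (h1.sub contDiffOn_const).exp)

lemma IsSol.const_of_eq (hJ : IsBox J) (H : SepSystem κ h (univ.pi J)) (hl : IsSol h J lam)
    (hx : x ∈ univ.pi J) {i j : Fin n} (hij : i ≠ j) (he : lam i (x i) = lam j (x j)) :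
    (∀ t ∈ J i, lam i t = lam i (x i)) ∧ ∀ t ∈ J j, lam j t = lam j (x j) := by
  constructor
  · intro t ht
    rw [hl.eq_exp hJ H hx hij.symm ht, he]; ring
  · intro t ht
    rw [hl.eq_exp hJ H hx hij ht, he]; ring

lemma IsSol.eq_of_eq (hJ : IsBox J) (H : SepSystem κ h (univ.pi J)) (hl : IsSol h J lam)
    (hx : x ∈ univ.pi J) {i j : Fin n} (he : lam i (x i) = lam j (x j)) (hy : y ∈ univ.pi J) :
    lam i (y i) = lam j (y j) := by
  by_cases hij : i = j
  · rw [hij]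
  · obtain ⟨h1, h2⟩ := hl.const_of_eq hJ H hx hij he
    rw [h1 _ (hy i (mem_univ i)), h2 _ (hy j (mem_univ j)), he]

lemma IsSol.eq_zero (hJ : IsBox J) (H : SepSystem κ h (univ.pi J)) (hl : IsSol h J lam)
    (hn : 1 < n) (hx : x ∈ univ.pi J) (h0 : ∀ i, lam i (x i) = 0) (i : Fin n) {t : ℝ}
    (ht : t ∈ J i) : lam i t = 0 := by
  have : Nontrivial (Fin n) := Fin.nontrivial_iff_two_le.2 hn
  obtain ⟨j, hij⟩ := exists_ne i
  rw [(hl.const_of_eq hJ H hx hij (by rw [h0, h0])).2 t ht, h0]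

end Solutions

end SepSystem

/-! ### Local existence of nontrivial solutions -/

section Dichotomy

lemma exists_isOpen_forall_eq_zero_or_forall_ne_zero {X ι : Type*} [TopologicalSpace X]
    {f : ι → X → ℝ} {Ω : Set X} (hΩ : IsOpen Ω) (hne : Ω.Nonempty)
    (hf : ∀ i, ContinuousOn (f i) Ω) (s : Finset ι) :
    ∃ Ω' ⊆ Ω, IsOpen Ω' ∧ Ω'.Nonempty ∧
      ∀ i ∈ s, (∀ x ∈ Ω', f i x = 0) ∨ ∀ x ∈ Ω', f i x ≠ 0 := by
  classical
  induction s using Finset.induction_on with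
  | empty => exact ⟨Ω, Subset.rfl, hΩ, hne, by simp⟩
  | insert i s _ ih =>
    obtain ⟨Ω', hsub, hopen, hne', hs⟩ := ih
    by_cases h0 : ∀ x ∈ Ω', f i x = 0
    · exact ⟨Ω', hsub, hopen, hne', (Finset.forall_mem_insert ..).2 ⟨Or.inl h0, hs⟩⟩
    push Not at h0
    obtain ⟨x, hx, hx0⟩ := h0
    refine ⟨Ω' ∩ f i ⁻¹' {0}ᶜ, inter_subset_left.trans hsub,
      ((hf i).mono hsub).isOpen_inter_preimage hopen isOpen_compl_singleton, ⟨x, hx, hx0⟩,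
      (Finset.forall_mem_insert ..).2 ⟨Or.inr fun y hy => hy.2, fun j hj => ?_⟩⟩
    exact (hs j hj).imp (fun h y hy => h y hy.1) fun h y hy => h y hy.1

variable {α : Type*} [Finite α] [Nonempty α] {r : α → α → Prop}

lemma exists_forall_not_rel
    (htrans : ∀ i j k, i ≠ j → i ≠ k → j ≠ k → r i j → r j k → r i k) :
    ∃ p, ∀ j, j ≠ p → ¬ r j p → ¬ r p j := by
  classical
  let below : α → Set α := fun p => {i | i ≠ p ∧ r i p}
  obtain ⟨p, hp⟩ := Finite.exists_max fun p => (below p).ncard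
  refine ⟨p, fun j hj hjp hpj => ?_⟩
  have hsub : insert p (below p) ⊆ below j := by
    rintro i (rfl | ⟨hip, hri⟩)
    · exact ⟨hj.symm, hpj⟩
    · have hij : i ≠ j := by
        rintro rfl
        exact hjp hri
      exact ⟨hij, htrans i p j hip hij hj.symm hri hpj⟩
  have hcard := Set.ncard_le_ncard hsub
  rw [Set.ncard_insert_of_notMem (by simp [below])] at hcard
  exact absurd (hp j) (by lia)

lemma exists_forall_rel_or_exists_split
    (htrans : ∀ i j k, i ≠ j → i ≠ k → j ≠ k → r i j → r j k → r i k)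
    (hcomp : ∀ i j k, i ≠ j → i ≠ k → j ≠ k → r k i → r k j → r i j ∨ r j i) :
    (∃ p, ∀ i, i ≠ p → r i p) ∨
      ∃ T : Set α, T.Nonempty ∧ Tᶜ.Nonempty ∧ ∀ i ∈ T, ∀ j ∉ T, ¬ r i j ∧ ¬ r j i := by
  obtain ⟨p, hp⟩ := exists_forall_not_rel htrans
  refine or_iff_not_imp_left.2 fun hroot => ?_
  push Not at hroot
  obtain ⟨o, hop, hor⟩ := hroot p
  refine ⟨{i | i = p ∨ r i p}, ⟨p, Or.inl rfl⟩, ⟨o, by simp [hop, hor]⟩, ?_⟩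
  intro i hi j hj
  simp only [mem_ofPred_eq, not_or] at hi hj
  obtain ⟨hjp, hrj⟩ := hj
  rcases eq_or_ne i p with rfl | hip
  · exact ⟨hp j hjp hrj, hrj⟩
  have hri : r i p := hi.resolve_left hip
  have hij : i ≠ j := by
    rintro rfl
    exact hrj hri
  exact ⟨fun h => (hcomp j p i hjp hij.symm hip.symm h hri).elim hrj (hp j hjp hrj),
    fun h => hrj (htrans j i p hij.symm hjp hip h hri)⟩

end Dichotomy

section LocalExistence

variable {n : ℕ} {κ : ℝ} {h : Fin n → (Fin n → ℝ) → ℝ} {Ω : Set (Fin n → ℝ)}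
  {J : Fin n → Set ℝ} {x y : Fin n → ℝ} {i j p : Fin n}

lemma SepSystem.exists_box_pattern (H : SepSystem κ h Ω) (hne : Ω.Nonempty) :
    ∃ J, IsBox J ∧ univ.pi J ⊆ Ω ∧ ∀ i j, (∀ x ∈ univ.pi J, logPd h i j x = 0) ∨
      ∀ x ∈ univ.pi J, logPd h i j x ≠ 0 := by
  obtain ⟨Ω', hsub, hopen, ⟨x, hx⟩, hpat⟩ := exists_isOpen_forall_eq_zero_or_forall_ne_zero
    (f := fun q : Fin n × Fin n => logPd h q.1 q.2) H.isOpen hne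
    (fun q => (H.smooth_logPd q.1 q.2).continuousOn) Finset.univ
  obtain ⟨J, hJ, -, hJs⟩ := exists_box_subset hopen hx
  exact ⟨J, hJ, hJs.trans hsub, fun i j => (hpat (i, j) (Finset.mem_univ _)).imp
    (fun h y hy => h y (hJs hy)) fun h y hy => h y (hJs hy)⟩

/-- The function `∂ₚ log |∂ₚ hᵢ|` where `∂ₚ hᵢ ≠ 0`, expressed through `logPd`. If no `∂ₚ hᵢ`,
`i ≠ p`, vanishes, it depends neither on `i` nor on the variables other than `xₚ`. -/
def rootPot (h : Fin n → (Fin n → ℝ) → ℝ) (p i : Fin n) (x : Fin n → ℝ) : ℝ :=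
  logPd h i p x + pd p (logPd h i p) x / logPd h i p x

lemma SepSystem.rootPot_eq_of_ne (H : SepSystem κ h Ω) (hi : i ≠ p) (hj : j ≠ p) (hij : i ≠ j)
    (hx : x ∈ Ω) (hip : logPd h i p x ≠ 0) (hjp : logPd h j p x ≠ 0) (h0 : logPd h i j x ≠ 0) :
    rootPot h p i x = rootPot h p j x := by
  have hquad := H.quad j p i hj hij.symm hi.symm
  have hpd := pd_congr_on H.isOpen hx hquad p
  rw [pd_mul (H.diff_logPd _ _ hx) (H.diff_logPd _ _ hx),
    pd_add ((H.diff_logPd _ _ hx).fun_mul (H.diff_logPd _ _ hx))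
      ((H.diff_logPd _ _ hx).fun_mul (H.diff_logPd _ _ hx)),
    pd_mul (H.diff_logPd _ _ hx) (H.diff_logPd _ _ hx),
    pd_mul (H.diff_logPd _ _ hx) (H.diff_logPd _ _ hx),
    H.pd_mixed i j p hij hi hj x hx, H.pd_self p j hj.symm x hx] at hpd
  have hcross : (logPd h i p x ^ 2 + pd p (logPd h i p) x) * logPd h j p x
      = (logPd h j p x ^ 2 + pd p (logPd h j p) x) * logPd h i p x := by
    apply mul_left_cancel₀ h0
    linear_combination logPd h i p x * hpd
      + (logPd h i p x * logPd h j p x - pd p (logPd h i p) x) * hquad x hx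
  unfold rootPot
  field_simp
  linear_combination hcross

lemma SepSystem.logPd_root_eq_zero (H : SepSystem κ h Ω) (hi : i ≠ p) (hj : j ≠ p) (hij : i ≠ j)
    (hx : x ∈ Ω) (hip : logPd h i p x ≠ 0) (h0 : logPd h i j x = 0) : logPd h p j x = 0 := by
  have hquad := H.quad j p i hj hij.symm hi.symm x hx
  simpa [h0, hip] using hquad

lemma SepSystem.gauss_of_root (H : SepSystem κ h Ω) (hi : i ≠ p) (hx : x ∈ Ω)
    (hpi : ∀ y ∈ Ω, logPd h p i y = 0) (hpk : ∀ k, k ≠ p → logPd h p k x = 0) :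
    (h p x)⁻¹ * (2 * pd p (logPd h i p) x + logPd h i p x ^ 2 - logPd h i p x * logPd h p p x)
      = -4 * κ := by
  have hgauss := H.gauss i p hi x hx
  rw [pd_eq_zero_of_eqOn H.isOpen hx hpi, hpi x hx, Finset.sum_eq_zero fun k hk => by
    rw [hpk k (Finset.mem_filter.1 hk).2.2, mul_zero, mul_zero]] at hgauss
  linear_combination hgauss

lemma SepSystem.gauss_of_unrelated (H : SepSystem κ h Ω) (hi : i ≠ p) (hj : j ≠ p) (hij : i ≠ j)
    (hx : x ∈ Ω) (h1 : ∀ y ∈ Ω, logPd h i j y = 0) (h2 : ∀ y ∈ Ω, logPd h j i y = 0)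
    (hk : ∀ k, k ≠ i → k ≠ j → k ≠ p → logPd h i k x * logPd h j k x = 0) :
    (h p x)⁻¹ * (logPd h i p x * logPd h j p x) = -4 * κ := by
  have hgauss := H.gauss i j hij x hx
  rw [pd_eq_zero_of_eqOn H.isOpen hx h1, pd_eq_zero_of_eqOn H.isOpen hx h2, h1 x hx, h2 x hx,
    Finset.sum_eq_single_of_mem p (by simp [hi.symm, hj.symm]) fun k hkij hkp => by
      simp only [Finset.mem_filter, Finset.mem_univ, true_and] at hkij
      rw [hk k hkij.1 hkij.2 hkp, mul_zero]] at hgauss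
  linear_combination hgauss

lemma SepSystem.rootPot_eq_of_unrelated (H : SepSystem κ h Ω) (hi : i ≠ p) (hj : j ≠ p)
    (hij : i ≠ j) (hp : ∀ i, i ≠ p → ∀ x ∈ Ω, logPd h i p x ≠ 0) (hx : x ∈ Ω)
    (h1 : ∀ y ∈ Ω, logPd h i j y = 0) (h2 : ∀ y ∈ Ω, logPd h j i y = 0)
    (hk : ∀ k, k ≠ i → k ≠ j → k ≠ p → logPd h i k x * logPd h j k x = 0) :
    rootPot h p i x = rootPot h p j x := by
  have hpj : ∀ y ∈ Ω, logPd h p j y = 0 := fun y hy =>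
    H.logPd_root_eq_zero hi hj hij hy (hp i hi y hy) (h1 y hy)
  have hpi : ∀ y ∈ Ω, logPd h p i y = 0 := fun y hy =>
    H.logPd_root_eq_zero hj hi hij.symm hy (hp j hj y hy) (h2 y hy)
  have hpk : ∀ k, k ≠ p → logPd h p k x = 0 := by
    intro k hkp
    rcases eq_or_ne k i with rfl | hki
    · exact hpi x hx
    rcases eq_or_ne k j with rfl | hkj
    · exact hpj x hx
    rcases mul_eq_zero.1 (hk k hki hkj hkp) with h0 | h0
    · exact H.logPd_root_eq_zero hi hkp hki.symm hx (hp i hi x hx) h0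
    · exact H.logPd_root_eq_zero hj hkp hkj.symm hx (hp j hj x hx) h0
  have gauss_ij := H.gauss_of_unrelated hi hj hij hx h1 h2 hk
  have hinv := inv_ne_zero (H.ne_zero p x hx)
  have eq_i : 2 * pd p (logPd h i p) x + logPd h i p x ^ 2 - logPd h i p x * logPd h p p x
      = logPd h i p x * logPd h j p x :=
    mul_left_cancel₀ hinv ((H.gauss_of_root hi hx hpi hpk).trans gauss_ij.symm)
  have eq_j : 2 * pd p (logPd h j p) x + logPd h j p x ^ 2 - logPd h j p x * logPd h p p x
      = logPd h i p x * logPd h j p x :=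
    mul_left_cancel₀ hinv ((H.gauss_of_root hj hx hpj hpk).trans gauss_ij.symm)
  have hip := hp i hi x hx
  have hjp := hp j hj x hx
  unfold rootPot
  field_simp
  linear_combination (logPd h j p x / 2) * eq_i - (logPd h i p x / 2) * eq_j

lemma SepSystem.rootPot_eq (H : SepSystem κ h Ω)
    (hpat : ∀ i j, (∀ x ∈ Ω, logPd h i j x = 0) ∨ ∀ x ∈ Ω, logPd h i j x ≠ 0)
    (hp : ∀ i, i ≠ p → ∀ x ∈ Ω, logPd h i p x ≠ 0) (hi : i ≠ p) (hj : j ≠ p) (hx : x ∈ Ω) :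
    rootPot h p i x = rootPot h p j x := by
  have eq_of_ne : ∀ i j, i ≠ p → j ≠ p → i ≠ j → logPd h i j x ≠ 0 →
      rootPot h p i x = rootPot h p j x := fun i j hi hj hij h0 =>
    H.rootPot_eq_of_ne hi hj hij hx (hp i hi x hx) (hp j hj x hx) h0
  rcases eq_or_ne i j with rfl | hij
  · rfl
  rcases hpat i j with h1 | h1
  swap
  · exact eq_of_ne i j hi hj hij (h1 x hx)
  rcases hpat j i with h2 | h2
  swap
  · exact (eq_of_ne j i hj hi hij.symm (h2 x hx)).symm
  by_cases hk : ∃ k, k ≠ i ∧ k ≠ j ∧ k ≠ p ∧ logPd h i k x * logPd h j k x ≠ 0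
  · obtain ⟨k, hki, hkj, hkp, h0⟩ := hk
    exact (eq_of_ne i k hi hkp hki.symm (left_ne_zero_of_mul h0)).trans
      (eq_of_ne j k hj hkp hkj.symm (right_ne_zero_of_mul h0)).symm
  push Not at hk
  exact H.rootPot_eq_of_unrelated hi hj hij hp hx h1 h2 hk

lemma SepSystem.pd_rootPot_eq_zero (H : SepSystem κ h Ω)
    (hp : ∀ x ∈ Ω, logPd h i p x ≠ 0) (hi : i ≠ p) {k : Fin n} (hkp : k ≠ p) (hx : x ∈ Ω) :
    pd k (rootPot h p i) x = 0 := by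
  have hne := hp x hx
  have hfun : rootPot h p i = fun x => logPd h i p x
      + pd p (logPd h i p) x * (logPd h i p x)⁻¹ := by
    ext x
    rw [rootPot, div_eq_mul_inv]
  have dinv : DifferentiableAt ℝ (fun x => (logPd h i p x)⁻¹) x := (H.diff_logPd i p hx).inv hne
  rw [hfun, pd_add (H.diff_logPd i p hx) ((H.diff_pd_logPd i p p hx).fun_mul dinv),
    pd_mul (H.diff_pd_logPd i p p hx) dinv, pd_inv (H.diff_logPd i p hx) hne,
    pd_comm (H.smooth_logPd i p) H.isOpen hx k p]
  rcases eq_or_ne k i with rfl | hki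
  · have hpd := pd_congr_on H.isOpen hx (H.pd_self k p hkp) p
    have hneg : (fun y => -(logPd h k p y * logPd h p k y))
        = fun y => (-1) * (logPd h k p y * logPd h p k y) := by
      ext y
      ring
    rw [hneg, pd_const_mul _ ((H.diff_logPd _ _ hx).fun_mul (H.diff_logPd _ _ hx)),
      pd_mul (H.diff_logPd _ _ hx) (H.diff_logPd _ _ hx), H.pd_self p k hkp.symm x hx] at hpd
    rw [hpd, H.pd_self k p hkp x hx]
    field_simp
    ring
  · have h0 := H.pd_mixed i p k hi hki.symm hkp.symm
    rw [pd_eq_zero_of_eqOn H.isOpen hx h0, h0 x hx]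
    simp

lemma SepSystem.rootPot_indep (H : SepSystem κ h (univ.pi J)) (hJ : IsBox J)
    (hp : ∀ x ∈ univ.pi J, logPd h i p x ≠ 0) (hi : i ≠ p)
    (hx : x ∈ univ.pi J) (hy : y ∈ univ.pi J) (hxy : x p = y p) :
    rootPot h p i x = rootPot h p i y := by
  refine eq_of_pd_eq_zero hJ (fun x hx => ?_) (Finset.univ.erase p)
    (fun k hk x hx => H.pd_rootPot_eq_zero hp hi (Finset.ne_of_mem_erase hk) hx) hx hy
    fun k hk => ?_
  · exact (H.diff_logPd i p hx).fun_add ((H.diff_pd_logPd i p p hx).fun_mul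
      ((H.diff_logPd i p hx).fun_inv (hp x hx)))
  · obtain rfl : k = p := by simpa using hk
    exact hxy

lemma SepSystem.logPd_eq_of_eq (H : SepSystem κ h (univ.pi J)) (hJ : IsBox J) (hij : i ≠ j)
    (hx : x ∈ univ.pi J) (hy : y ∈ univ.pi J) (hxi : x i = y i) (hxj : x j = y j) :
    logPd h i j x = logPd h i j y := by
  refine eq_of_pd_eq_zero hJ (fun x hx => H.diff_logPd i j hx)
    ((Finset.univ.erase j).erase i) (fun k hk x hx => ?_) hx hy fun k hk => ?_
  · simp only [Finset.mem_erase, Finset.mem_univ, and_true] at hk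
    exact H.pd_mixed i j k hij hk.1.symm hk.2.symm x hx
  · simp only [Finset.mem_erase, Finset.mem_univ, and_true, not_and_or, not_not] at hk
    rcases hk with rfl | rfl
    · exact hxi
    · exact hxj

lemma SepSystem.exists_root_eigenvalue (H : SepSystem κ h (univ.pi J)) (hJ : IsBox J)
    (hn : 1 < n)
    (hpat : ∀ i j, (∀ x ∈ univ.pi J, logPd h i j x = 0) ∨ ∀ x ∈ univ.pi J, logPd h i j x ≠ 0)
    (hp : ∀ i, i ≠ p → ∀ x ∈ univ.pi J, logPd h i p x ≠ 0) :
    ∃ l θ : ℝ → ℝ, (∀ t ∈ J p, HasDerivAt l (θ t) t ∧ θ t ≠ 0) ∧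
      ∀ i, i ≠ p → ∀ x ∈ univ.pi J, HasDerivAt θ (θ (x p) * rootPot h p i x) (x p) := by
  have : Nontrivial (Fin n) := Fin.nontrivial_iff_two_le.2 hn
  obtain ⟨q, hq⟩ := exists_ne p
  obtain ⟨y, hy⟩ := hJ.nonempty
  let l : ℝ → ℝ := fun t => Real.exp (Real.log (h q (Function.update y p t)))
  let θ : ℝ → ℝ := fun t => l t * logPd h q p (Function.update y p t)
  have hl : ∀ t ∈ J p, HasDerivAt l (θ t) t := fun t ht =>
    (hasDerivAt_comp_update (H.diff_log q (update_mem_box hy ht))).exp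
  refine ⟨l, θ, fun t ht => ⟨hl t ht, mul_ne_zero (Real.exp_ne_zero _)
    (hp q hq _ (update_mem_box hy ht))⟩, fun i hi x hx => ?_⟩
  have hxp := hx p (mem_univ p)
  have hmem := update_mem_box hy hxp
  have hpot : rootPot h p i x = rootPot h p q (Function.update y p (x p)) := by
    rw [H.rootPot_eq hpat hp hi hq hx]
    exact H.rootPot_indep hJ (hp q hq) hq hx hmem (by simp)
  convert! (hl _ hxp).mul (hasDerivAt_comp_update (H.diff_logPd q p hmem)) using 1
  have hne := hp q hq _ hmem
  rw [hpot, rootPot]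
  simp only [θ]
  field_simp

variable {l θ : ℝ → ℝ}

lemma SepSystem.sub_div_logPd_eq_of_eq (H : SepSystem κ h (univ.pi J)) (hJ : IsBox J)
    (hi : i ≠ p) (hp : ∀ x ∈ univ.pi J, logPd h i p x ≠ 0)
    (hl : ∀ t ∈ J p, HasDerivAt l (θ t) t)
    (hθ : ∀ x ∈ univ.pi J, HasDerivAt θ (θ (x p) * rootPot h p i x) (x p))
    (hx : x ∈ univ.pi J) (hy : y ∈ univ.pi J) (hxy : x i = y i) :
    l (x p) - θ (x p) / logPd h i p x = l (y p) - θ (y p) / logPd h i p y := by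
  have deriv_eq_zero : ∀ t ∈ J p, HasDerivAt
      (fun t => l t - θ t / logPd h i p (Function.update x p t)) 0 t := by
    intro t ht
    have hm := update_mem_box hx ht
    have hne := hp _ hm
    have hθt := hθ _ hm
    rw [Function.update_self] at hθt
    convert! (hl t ht).sub (hθt.div (hasDerivAt_comp_update (H.diff_logPd i p hm)) hne) using 1
    rw [rootPot]
    field_simp
    ring
  have hconst := eq_of_hasDerivAt_zero (hJ p).1 (hJ p).2.1 deriv_eq_zero (hx p (mem_univ p))
    (hy p (mem_univ p))
  simp only [Function.update_eq_self] at hconst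
  rw [hconst, H.logPd_eq_of_eq hJ hi (update_mem_box hx (hy p (mem_univ p))) hy
    (by rw [Function.update_of_ne hi, hxy]) (by rw [Function.update_self])]

lemma SepSystem.isSol_of_root (H : SepSystem κ h (univ.pi J)) (hJ : IsBox J)
    (hp : ∀ i, i ≠ p → ∀ x ∈ univ.pi J, logPd h i p x ≠ 0) {lam : Fin n → ℝ → ℝ}
    (hlam_p : ∀ t ∈ J p, HasDerivAt (lam p) (θ t) t)
    (hlam : ∀ i, i ≠ p → ∀ x ∈ univ.pi J, lam i (x i) = lam p (x p) - θ (x p) / logPd h i p x) :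
    IsSol h J lam := by
  intro x hx i j hij
  rcases eq_or_ne j p with rfl | hjp
  · rw [hlam i hij x hx]
    convert! hlam_p (x j) (hx j (mem_univ j)) using 1
    have hne := hp i hij x hx
    field_simp
    ring
  have hne_j := hp j hjp x hx
  have hderiv : HasDerivAt (lam j) (θ (x p) * pd j (logPd h j p) x / logPd h j p x ^ 2) (x j) := by
    have hinv := (hasDerivAt_comp_update_self (H.diff_logPd j p hx) j).inv (by simpa using hne_j)
    have hline : HasDerivAt (lam j) _ (x j) :=
      ((hinv.const_mul (θ (x p))).const_sub (lam p (x p))).congr_of_eventuallyEq (by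
        filter_upwards [(hJ j).1.mem_nhds (hx j (mem_univ j))] with t ht
        simpa [Function.update_of_ne hjp.symm, div_eq_mul_inv] using
          hlam j hjp _ (update_mem_box hx ht))
    convert! hline using 1
    simp only [Function.update_eq_self]
    ring
  convert! hderiv using 1
  rw [H.pd_self j p hjp x hx, hlam j hjp x hx]
  rcases eq_or_ne i p with rfl | hip
  · field_simp
    ring
  · rw [hlam i hip x hx]
    have hne_i := hp i hip x hx
    have hquad := H.quad j p i hjp hij.symm hip.symm x hx
    field_simp
    linear_combination -θ (x p) * hquad

lemma SepSystem.exists_sol_of_root (H : SepSystem κ h (univ.pi J)) (hJ : IsBox J) (hn : 1 < n)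
    (hpat : ∀ i j, (∀ x ∈ univ.pi J, logPd h i j x = 0) ∨ ∀ x ∈ univ.pi J, logPd h i j x ≠ 0)
    (hp : ∀ i, i ≠ p → ∀ x ∈ univ.pi J, logPd h i p x ≠ 0) :
    ∃ lam, IsSol h J lam ∧ ∃ x ∈ univ.pi J, ∃ i j, lam i (x i) ≠ lam j (x j) := by
  have : Nontrivial (Fin n) := Fin.nontrivial_iff_two_le.2 hn
  obtain ⟨q, hq⟩ := exists_ne p
  obtain ⟨y, hy⟩ := hJ.nonempty
  obtain ⟨l, θ, hl, hθ⟩ := H.exists_root_eigenvalue hJ hn hpat hp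
  let lam : Fin n → ℝ → ℝ := fun i t =>
    if i = p then l t else l (y p) - θ (y p) / logPd h i p (Function.update y i t)
  have hlam_p : lam p = l := by
    ext t
    simp [lam]
  have hlam : ∀ i, i ≠ p → ∀ x ∈ univ.pi J,
      lam i (x i) = lam p (x p) - θ (x p) / logPd h i p x := by
    intro i hi x hx
    rw [hlam_p, H.sub_div_logPd_eq_of_eq hJ hi (hp i hi) (fun t ht => (hl t ht).1) (hθ i hi) hx
      (update_mem_box hy (hx i (mem_univ i))) (by simp)]
    simp [lam, hi, Function.update_of_ne hi.symm]
  refine ⟨lam, H.isSol_of_root hJ hp (hlam_p ▸ fun t ht => (hl t ht).1) hlam, y, hy, p, q, ?_⟩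
  rw [hlam q hq y hy, ne_eq, eq_comm, sub_eq_self]
  exact div_ne_zero (hl _ (hy p (mem_univ p))).2 (hp q hq y hy)

lemma isSol_ite_of_logPd_eq_zero {T : Set (Fin n)} [DecidablePred (· ∈ T)]
    (hT : ∀ i ∈ T, ∀ j ∉ T, ∀ x ∈ univ.pi J, logPd h i j x = 0 ∧ logPd h j i x = 0) :
    IsSol h J fun i _ => if i ∈ T then 1 else 0 := by
  intro x hx i j _
  convert! hasDerivAt_const (x j) (if j ∈ T then (1 : ℝ) else 0) using 1
  by_cases hi : i ∈ T <;> by_cases hj : j ∈ T <;> simp only [hi, hj, if_true, if_false]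
  · simp
  · simp [(hT i hi j hj x hx).1]
  · simp [(hT j hj i hi x hx).2]
  · simp

/-- By `quad`, the relation `∂ⱼ hᵢ ≠ 0` is transitive, and the indices to which a given one is
related are comparable. -/
theorem SepSystem.exists_sol_local (H : SepSystem κ h Ω) (hne : Ω.Nonempty) (hn : 1 < n) :
    ∃ J, IsBox J ∧ univ.pi J ⊆ Ω ∧ ∃ lam, IsSol h J lam ∧
      ∃ x ∈ univ.pi J, ∃ i j, lam i (x i) ≠ lam j (x j) := by
  classical
  have : Nonempty (Fin n) := ⟨⟨0, by lia⟩⟩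
  obtain ⟨J, hJ, hJs, hpat⟩ := H.exists_box_pattern hne
  have HJ := H.mono hJ.isOpen hJs
  refine ⟨J, hJ, hJs, ?_⟩
  obtain ⟨y, hy⟩ := hJ.nonempty
  have htrans : ∀ i j k, i ≠ j → i ≠ k → j ≠ k → logPd h i j y ≠ 0 → logPd h j k y ≠ 0 →
      logPd h i k y ≠ 0 := fun i j k hij hik hjk h1 h2 h0 => by
    simpa [h0, h1, h2] using HJ.quad j k i hjk hij.symm hik.symm y hy
  have hcomp : ∀ i j k, i ≠ j → i ≠ k → j ≠ k → logPd h k i y ≠ 0 → logPd h k j y ≠ 0 →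
      logPd h i j y ≠ 0 ∨ logPd h j i y ≠ 0 := fun i j k hij hik hjk h1 h2 => by
    by_contra! hcon
    simpa [hcon.1, hcon.2, h1, h2] using HJ.quad i j k hij hik hjk y hy
  rcases exists_forall_rel_or_exists_split htrans hcomp with ⟨p, hp⟩ | ⟨T, ⟨i, hi⟩, ⟨j, hj⟩, hT⟩
  · exact HJ.exists_sol_of_root hJ hn hpat fun i hi =>
      (hpat i p).resolve_left fun h0 => hp i hi (h0 y hy)
  · have eq_zero : ∀ a b, ¬ logPd h a b y ≠ 0 → ∀ x ∈ univ.pi J, logPd h a b x = 0 :=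
      fun a b h0 => (hpat a b).resolve_right fun hne => h0 (hne y hy)
    refine ⟨_, isSol_ite_of_logPd_eq_zero (T := T) fun a ha b hb x hx =>
      ⟨eq_zero a b (hT a ha b hb).1 x hx, eq_zero b a (hT a ha b hb).2 x hx⟩, y, hy, i, j, ?_⟩
    have hj' : j ∉ T := hj
    simp [hi, hj']

end LocalExistence

/-! ### Unique continuation along coordinate lines -/

namespace SepSystem

variable {n : ℕ} {κ : ℝ} {h : Fin n → (Fin n → ℝ) → ℝ} {Ω : Set (Fin n → ℝ)}
  {J : Fin n → Set ℝ} {x z : Fin n → ℝ} {i j k : Fin n} {s t : ℝ}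

lemma pd_eq_logPd_mul (H : SepSystem κ h Ω) (hx : x ∈ Ω) (i j : Fin n) :
    pd j (h i) x = logPd h i j x * h i x := by
  have h0 := H.ne_zero i x hx
  rw [logPd, pd_log (differentiableAt_of_contDiffOn (H.smooth i) H.isOpen hx) h0]
  field_simp

lemma pd_inv_eq_neg_mul_logPd (H : SepSystem κ h Ω) (hx : x ∈ Ω) (i j : Fin n) :
    pd j (fun y => (h i y)⁻¹) x = -((h i x)⁻¹ * logPd h i j x) := by
  have h0 := H.ne_zero i x hx
  rw [pd_inv (differentiableAt_of_contDiffOn (H.smooth i) H.isOpen hx) h0, H.pd_eq_logPd_mul hx]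
  field_simp

lemma pd_pd_logPd (H : SepSystem κ h Ω) (hij : i ≠ j) (hx : x ∈ Ω) :
    pd i (pd j (logPd h i j)) x =
      logPd h i j x ^ 2 * logPd h j i x - pd j (logPd h i j) x * logPd h j i x := by
  have hneg : (fun y => -(logPd h i j y * logPd h j i y))
      = fun y => (-1) * (logPd h i j y * logPd h j i y) := by
    ext y
    ring
  rw [pd_comm (H.smooth_logPd i j) H.isOpen hx i j, pd_congr_on H.isOpen hx (H.pd_self i j hij) j,
    hneg, pd_const_mul _ ((H.diff_logPd _ _ hx).fun_mul (H.diff_logPd _ _ hx)),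
    pd_mul (H.diff_logPd _ _ hx) (H.diff_logPd _ _ hx), H.pd_self j i hij.symm _ hx]
  ring

lemma logPd_update (H : SepSystem κ h (univ.pi J)) (hJ : IsBox J) (hx : x ∈ univ.pi J)
    (hij : i ≠ j) (hik : i ≠ k) (hjk : j ≠ k) (ht : t ∈ J k) :
    logPd h i j (Function.update x k t) = logPd h i j x :=
  H.logPd_eq_of_eq hJ hij (update_mem_box hx ht) hx (Function.update_of_ne hik _ _)
    (Function.update_of_ne hjk _ _)

lemma logPd_mul_exp_update (H : SepSystem κ h (univ.pi J)) (hJ : IsBox J) (hx : x ∈ univ.pi J)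
    (hik : i ≠ k) (hs : s ∈ J i) (ht : t ∈ J i) :
    logPd h i k (Function.update x i s) * Real.exp (Real.log (h k (Function.update x i s))) =
      logPd h i k (Function.update x i t) * Real.exp (Real.log (h k (Function.update x i t))) := by
  refine eq_of_hasDerivAt_zero (f := fun t => logPd h i k (Function.update x i t) *
    Real.exp (Real.log (h k (Function.update x i t)))) (hJ i).1 (hJ i).2.1 (fun t ht => ?_) hs ht
  have hm := update_mem_box hx ht
  convert! (hasDerivAt_comp_update (H.diff_logPd i k hm)).mul
    (hasDerivAt_comp_update (H.diff_log k hm)).exp using 1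
  rw [H.pd_self i k hik _ hm]
  simp only [logPd]
  ring

lemma logPd_sub_update (H : SepSystem κ h (univ.pi J)) (hJ : IsBox J) (hx : x ∈ univ.pi J)
    (hik : i ≠ k) (hs : s ∈ J i) (ht : t ∈ J i) :
    logPd h k k (Function.update x i s) - logPd h i k (Function.update x i s) =
      logPd h k k (Function.update x i t) - logPd h i k (Function.update x i t) := by
  refine eq_of_hasDerivAt_zero (f := fun t => logPd h k k (Function.update x i t) -
    logPd h i k (Function.update x i t)) (hJ i).1 (hJ i).2.1 (fun t ht => ?_) hs ht
  have hm := update_mem_box hx ht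
  convert! (hasDerivAt_comp_update (H.diff_logPd k k hm)).sub
    (hasDerivAt_comp_update (H.diff_logPd i k hm)) using 1
  rw [H.pd_self i k hik _ hm, H.pd_logPd_diag hik.symm hm]
  ring

end SepSystem

section LineAlgebra

variable {n : ℕ}

/-- The function `√|hᵢ|` along the line through `z` in the direction `i`. -/
def lineSqrt (h : Fin n → (Fin n → ℝ) → ℝ) (i : Fin n) (z : Fin n → ℝ) (t : ℝ) : ℝ :=
  Real.exp (Real.log (h i (Function.update z i t)) / 2)

/-- The derivative of `log |hⱼ|` by arc length along the line through `z` in the direction `i`. -/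
def lineLogDeriv (h : Fin n → (Fin n → ℝ) → ℝ) (i : Fin n) (z : Fin n → ℝ) (j : Fin n) (t : ℝ) :
    ℝ :=
  logPd h j i (Function.update z i t) * (lineSqrt h i z t)⁻¹

/-- Functions along the line through `z` in the direction `i`, generating (if `F` satisfies a
suitable differential equation) an algebra closed under differentiation by arc length. -/
def lineGen (h : Fin n → (Fin n → ℝ) → ℝ) (i : Fin n) (z : Fin n → ℝ) (F : ℝ → ℝ) :
    Option (Fin 5 × {j : Fin n // j ≠ i}) → ℝ → ℝ
  | none => F
  | some (c, j) => ![lineLogDeriv h i z j,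
      fun t => logPd h i j (Function.update z i t),
      fun t => pd j (logPd h i j) (Function.update z i t),
      fun t => logPd h j j (Function.update z i t),
      fun t => (h j (Function.update z i t))⁻¹] c

/-- The algebra generated by `lineGen`. -/
def lineAlgebra (h : Fin n → (Fin n → ℝ) → ℝ) (i : Fin n) (z : Fin n → ℝ) (F : ℝ → ℝ) :
    Subalgebra ℝ (ℝ → ℝ) :=
  Algebra.adjoin ℝ (range (lineGen h i z F))

variable {κ : ℝ} {h : Fin n → (Fin n → ℝ) → ℝ} {J : Fin n → Set ℝ} {z : Fin n → ℝ}
  {i j k : Fin n} {F : ℝ → ℝ} {t : ℝ}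

lemma lineSqrt_ne_zero : lineSqrt h i z t ≠ 0 := Real.exp_ne_zero _

lemma logPd_update_eq_lineSqrt_mul :
    logPd h j i (Function.update z i t) = lineSqrt h i z t * lineLogDeriv h i z j t := by
  rw [lineLogDeriv, mul_comm, inv_mul_cancel_right₀ lineSqrt_ne_zero]

lemma lineGen_mem_lineAlgebra (a : Option (Fin 5 × {j : Fin n // j ≠ i})) :
    lineGen h i z F a ∈ lineAlgebra h i z F :=
  Algebra.subset_adjoin ⟨a, rfl⟩

lemma lineLogDeriv_mem_lineAlgebra (hj : j ≠ i) : lineLogDeriv h i z j ∈ lineAlgebra h i z F :=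
  lineGen_mem_lineAlgebra (some (0, ⟨j, hj⟩))

namespace SepSystem

lemma hasDerivAt_lineSqrt (H : SepSystem κ h (univ.pi J)) (hz : z ∈ univ.pi J) (ht : t ∈ J i) :
    HasDerivAt (lineSqrt h i z)
      (lineSqrt h i z t * (logPd h i i (Function.update z i t) / 2)) t :=
  ((hasDerivAt_comp_update (H.diff_log i (update_mem_box hz ht))).div_const 2).exp

lemma exists_eq_mul_lineSqrt_sq (H : SepSystem κ h (univ.pi J)) (hJ : IsBox J)
    (hz : z ∈ univ.pi J) (i : Fin n) :
    ∃ ε ≠ 0, ∀ t ∈ J i, h i (Function.update z i t) = ε * lineSqrt h i z t ^ 2 := by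
  have deriv_eq_zero : ∀ t ∈ J i, HasDerivAt
      (fun t => h i (Function.update z i t) * (lineSqrt h i z t ^ 2)⁻¹) 0 t := by
    intro t ht
    have hm := update_mem_box hz ht
    have hne : lineSqrt h i z t ≠ 0 := lineSqrt_ne_zero
    convert! (hasDerivAt_comp_update (differentiableAt_of_contDiffOn (H.smooth i) H.isOpen hm)).mul
      (((H.hasDerivAt_lineSqrt hz ht).fun_pow 2).fun_inv (pow_ne_zero 2 hne)) using 1
    rw [H.pd_eq_logPd_mul hm]
    field_simp
    ring
  have hne : ∀ t, lineSqrt h i z t ^ 2 ≠ 0 := fun t => pow_ne_zero 2 lineSqrt_ne_zero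
  refine ⟨h i z * (lineSqrt h i z (z i) ^ 2)⁻¹,
    mul_ne_zero (H.ne_zero i z hz) (inv_ne_zero (hne _)), fun t ht => ?_⟩
  rw [← div_eq_iff (hne t), div_eq_mul_inv, eq_of_hasDerivAt_zero (hJ i).1 (hJ i).2.1
    deriv_eq_zero ht (hz i (mem_univ i)), Function.update_eq_self]

/-- This is the equation `gauss`, with the arc length as the parameter. -/
lemma hasDerivAt_lineLogDeriv (H : SepSystem κ h (univ.pi J)) (hJ : IsBox J)
    (hz : z ∈ univ.pi J) (hj : j ≠ i) {ε : ℝ} (hε0 : ε ≠ 0)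
    (hε : ∀ t ∈ J i, h i (Function.update z i t) = ε * lineSqrt h i z t ^ 2) (ht : t ∈ J i) :
    HasDerivAt (lineLogDeriv h i z j) (lineSqrt h i z t * (-1 / 2 * (lineLogDeriv h i z j t ^ 2
      + ε * (4 * κ + (h j (Function.update z i t))⁻¹ * (2 * pd j (logPd h i j)
          (Function.update z i t) + logPd h i j (Function.update z i t) ^ 2
          - logPd h i j (Function.update z i t) * logPd h j j (Function.update z i t))
        + ∑ l ∈ {l | l ≠ i ∧ l ≠ j}, (h l (Function.update z i t))⁻¹ *
          (logPd h i l (Function.update z i t) * logPd h j l z))))) t := by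
  have hm := update_mem_box hz ht
  have hgauss := H.gauss i j hj.symm _ hm
  have hsum : ∑ l ∈ {l | l ≠ i ∧ l ≠ j}, (h l (Function.update z i t))⁻¹ *
      (logPd h i l (Function.update z i t) * logPd h j l (Function.update z i t)) =
      ∑ l ∈ {l | l ≠ i ∧ l ≠ j}, (h l (Function.update z i t))⁻¹ *
      (logPd h i l (Function.update z i t) * logPd h j l z) := by
    refine Finset.sum_congr rfl fun l hl => ?_
    simp only [Finset.mem_filter, Finset.mem_univ, true_and] at hl
    rw [H.logPd_update hJ hz hl.2.symm hj hl.1 ht]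
  have hne : lineSqrt h i z t ≠ 0 := lineSqrt_ne_zero
  convert! (hasDerivAt_comp_update (H.diff_logPd j i hm)).mul
    ((H.hasDerivAt_lineSqrt hz ht).fun_inv hne) using 1
  rw [hsum, hε t ht] at hgauss
  rw [logPd_update_eq_lineSqrt_mul] at hgauss ⊢
  generalize ∑ l ∈ {l | l ≠ i ∧ l ≠ j}, (h l (Function.update z i t))⁻¹ *
    (logPd h i l (Function.update z i t) * logPd h j l z) = S at *
  generalize (h j (Function.update z i t))⁻¹ * (2 * pd j (logPd h i j)
    (Function.update z i t) + logPd h i j (Function.update z i t) ^ 2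
    - logPd h i j (Function.update z i t) * logPd h j j (Function.update z i t)) = P at *
  field_simp at hgauss ⊢
  linear_combination -hgauss

lemma exists_mem_lineAlgebra_hasDerivAt_lineLogDeriv (H : SepSystem κ h (univ.pi J))
    (hJ : IsBox J) (hz : z ∈ univ.pi J) (hj : j ≠ i) :
    ∃ Y ∈ lineAlgebra h i z F, ∀ t ∈ J i,
      HasDerivAt (lineLogDeriv h i z j) (lineSqrt h i z t * Y t) t := by
  obtain ⟨ε, hε0, hε⟩ := H.exists_eq_mul_lineSqrt_sq hJ hz i
  have gen_mem : ∀ c : Fin 5, ∀ l (hl : l ≠ i),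
      lineGen h i z F (some (c, ⟨l, hl⟩)) ∈ lineAlgebra h i z F :=
    fun c l hl => lineGen_mem_lineAlgebra _
  have const_mem : ∀ c : ℝ, (fun _ => c) ∈ lineAlgebra h i z F := fun c =>
    (lineAlgebra h i z F).algebraMap_mem c
  have sum_mem' : (fun t => ∑ l ∈ {l | l ≠ i ∧ l ≠ j}, (h l (Function.update z i t))⁻¹ *
      (logPd h i l (Function.update z i t) * logPd h j l z)) ∈ lineAlgebra h i z F := by
    simp only [← Finset.sum_fn]
    refine sum_mem fun l hl => ?_
    have hli := (Finset.mem_filter.1 hl).2.1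
    exact mul_mem (gen_mem 4 l hli) (mul_mem (gen_mem 1 l hli) (const_mem _))
  exact ⟨_, mul_mem (const_mem _) (add_mem (pow_mem (gen_mem 0 j hj) 2) (mul_mem (const_mem ε)
    (add_mem (add_mem (const_mem _) (mul_mem (gen_mem 4 j hj) (sub_mem (add_mem (mul_mem
    (const_mem 2) (gen_mem 2 j hj)) (pow_mem (gen_mem 1 j hj) 2)) (mul_mem (gen_mem 1 j hj)
    (gen_mem 3 j hj))))) sum_mem'))),
    fun t ht => H.hasDerivAt_lineLogDeriv hJ hz hj hε0 hε ht⟩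

lemma exists_mem_lineAlgebra_hasDerivAt (H : SepSystem κ h (univ.pi J)) (hJ : IsBox J)
    (hz : z ∈ univ.pi J) (hk : k ≠ i) {c : ℝ}
    (hF : ∀ t ∈ J i, HasDerivAt F ((F t - c) * logPd h k i (Function.update z i t)) t)
    (a : Option (Fin 5 × {j : Fin n // j ≠ i})) :
    ∃ Y ∈ lineAlgebra h i z F, ∀ t ∈ J i,
      HasDerivAt (lineGen h i z F a) (lineSqrt h i z t * Y t) t := by
  rcases a with _ | ⟨b, j, hj⟩
  · refine ⟨(F - fun _ => c) * lineLogDeriv h i z k, mul_mem (sub_mem (lineGen_mem_lineAlgebra none)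
      ((lineAlgebra h i z F).algebraMap_mem c)) (lineLogDeriv_mem_lineAlgebra hk), fun t ht => ?_⟩
    convert! hF t ht using 1
    rw [logPd_update_eq_lineSqrt_mul, Pi.mul_apply, Pi.sub_apply]
    ring
  have gen_mem : ∀ b : Fin 5, lineGen h i z F (some (b, ⟨j, hj⟩)) ∈ lineAlgebra h i z F :=
    fun b => lineGen_mem_lineAlgebra _
  have hbox : ∀ t ∈ J i, Function.update z i t ∈ univ.pi J := fun t ht => update_mem_box hz ht
  fin_cases b
  · exact H.exists_mem_lineAlgebra_hasDerivAt_lineLogDeriv hJ hz hj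
  · refine ⟨_, neg_mem (mul_mem (gen_mem 1) (gen_mem 0)), fun t ht => ?_⟩
    convert! hasDerivAt_comp_update (H.diff_logPd i j (hbox t ht)) using 1
    rw [H.pd_self i j hj.symm _ (hbox t ht), logPd_update_eq_lineSqrt_mul]
    simp [lineGen]
    ring
  · refine ⟨_, sub_mem (mul_mem (pow_mem (gen_mem 1) 2) (gen_mem 0))
      (mul_mem (gen_mem 2) (gen_mem 0)), fun t ht => ?_⟩
    convert! hasDerivAt_comp_update (H.diff_pd_logPd i j j (hbox t ht)) using 1
    rw [H.pd_pd_logPd hj.symm (hbox t ht), logPd_update_eq_lineSqrt_mul]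
    simp [lineGen]
    ring
  · refine ⟨_, neg_mem (mul_mem (gen_mem 1) (gen_mem 0)), fun t ht => ?_⟩
    convert! hasDerivAt_comp_update (H.diff_logPd j j (hbox t ht)) using 1
    rw [H.pd_logPd_diag hj (hbox t ht), logPd_update_eq_lineSqrt_mul]
    simp [lineGen]
    ring
  · refine ⟨_, neg_mem (mul_mem (gen_mem 4) (gen_mem 0)), fun t ht => ?_⟩
    convert! hasDerivAt_comp_update ((differentiableAt_of_contDiffOn (H.smooth j) H.isOpen
      (hbox t ht)).fun_inv (H.ne_zero j _ (hbox t ht))) using 1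
    rw [H.pd_inv_eq_neg_mul_logPd (hbox t ht), logPd_update_eq_lineSqrt_mul]
    simp [lineGen]
    ring

lemma compat_of_compat_near (H : SepSystem κ h (univ.pi J)) (hJ : IsBox J) (hz : z ∈ univ.pi J)
    (hj : j ≠ i) (hk : k ≠ i) {cj ck : ℝ}
    (hF : ∀ t ∈ J i, HasDerivAt F ((F t - ck) * logPd h k i (Function.update z i t)) t)
    (h0 : ∀ᶠ t in nhds (z i), (F t - cj) * logPd h j i (Function.update z i t) =
      (F t - ck) * logPd h k i (Function.update z i t)) (ht : t ∈ J i) :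
    (F t - cj) * logPd h j i (Function.update z i t) =
      (F t - ck) * logPd h k i (Function.update z i t) := by
  have sub_const_mem : ∀ c : ℝ, (F - fun _ => c) ∈ lineAlgebra h i z F := fun c =>
    sub_mem (lineGen_mem_lineAlgebra none) ((lineAlgebra h i z F).algebraMap_mem c)
  have hzero := eq_zero_of_mem_adjoin (hJ i).2.1 (hJ i).1
    (fun t ht => (H.hasDerivAt_lineSqrt hz ht).continuousAt.continuousWithinAt)
    (fun t _ => lineSqrt_ne_zero) (H.exists_mem_lineAlgebra_hasDerivAt hJ hz hk hF)
    (sub_mem (mul_mem (sub_const_mem cj) (lineLogDeriv_mem_lineAlgebra hj))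
      (mul_mem (sub_const_mem ck) (lineLogDeriv_mem_lineAlgebra hk)))
    (hz i (mem_univ i)) (by
      filter_upwards [h0] with t ht
      simp only [logPd_update_eq_lineSqrt_mul] at ht
      apply mul_left_cancel₀ (lineSqrt_ne_zero (h := h) (i := i) (z := z) (t := t))
      simp only [Pi.sub_apply, Pi.mul_apply, Pi.zero_apply]
      linear_combination ht) ht
  simp only [Pi.sub_apply, Pi.mul_apply] at hzero
  rw [logPd_update_eq_lineSqrt_mul, logPd_update_eq_lineSqrt_mul]
  linear_combination lineSqrt h i z t * hzero

end SepSystem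

end LineAlgebra

/-! ### Extension of solutions -/

section ExtensionOfSolutions

variable {n : ℕ} {κ : ℝ} {h : Fin n → (Fin n → ℝ) → ℝ} {J J' : Fin n → Set ℝ} {x y : Fin n → ℝ}
  {lam : Fin n → ℝ → ℝ} {i j k : Fin n} {I : Set ℝ} {s t t₀ : ℝ}

lemma IsBox.update (hJ : IsBox J) (hI : IsOpen I ∧ I.OrdConnected ∧ I.Nonempty) :
    IsBox (Function.update J i I) := by
  intro k
  by_cases hk : k = i
  · subst hk
    simpa using hI
  · simpa [Function.update_of_ne hk] using hJ k

lemma update_subset_of_subset (hI : I ⊆ J i) (k : Fin n) : Function.update J i I k ⊆ J k := by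
  by_cases hk : k = i
  · subst hk
    simpa using hI
  · simp [Function.update_of_ne hk]

lemma update_mem_pi_update (hx : x ∈ univ.pi J) (ht : t ∈ I) :
    Function.update x i t ∈ univ.pi (Function.update J i I) := by
  intro k _
  by_cases hk : k = i
  · subst hk
    simpa using ht
  · simpa [Function.update_of_ne hk] using hx k (mem_univ k)

/-- The candidate for the continuation of `lam i` along the line through `x` in direction `i`: the
value at `t` of the solution of `F' = (F - lam k (x k)) ∂ᵢ log |h k|` with `F t₀ = lam i t₀`. -/
def lineContinuation (h : Fin n → (Fin n → ℝ) → ℝ) (lam : Fin n → ℝ → ℝ) (i k : Fin n) (t₀ : ℝ)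
    (x : Fin n → ℝ) (t : ℝ) : ℝ :=
  lam k (x k) + (lam i t₀ - lam k (x k)) * Real.exp
    (Real.log (h k (Function.update x i t)) - Real.log (h k (Function.update x i t₀)))

lemma SepSystem.hasDerivAt_log_sub_log (H : SepSystem κ h (univ.pi J)) {m : Fin n} (hmi : m ≠ i)
    (hx : x ∈ univ.pi J) (ht : t ∈ J i) (ht₀ : t₀ ∈ J i) (hs : s ∈ J m) :
    HasDerivAt (fun s => Real.log (h k (Function.update (Function.update x m s) i t)) -
        Real.log (h k (Function.update (Function.update x m s) i t₀)))
      (logPd h k m (Function.update (Function.update x m s) i t) -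
        logPd h k m (Function.update (Function.update x m s) i t₀)) s := by
  have hline : ∀ r ∈ J i, HasDerivAt
      (fun s => Real.log (h k (Function.update (Function.update x m s) i r)))
      (logPd h k m (Function.update (Function.update x m s) i r)) s := by
    intro r hr
    simp_rw [Function.update_comm hmi]
    exact hasDerivAt_comp_update (H.diff_log k (update_mem_box (update_mem_box hx hr) hs))
  exact (hline t ht).sub (hline t₀ ht₀)

lemma SepSystem.lineContinuation_update_of_ne (H : SepSystem κ h (univ.pi J)) (hJ : IsBox J)
    {m : Fin n} (hki : k ≠ i) (hmi : m ≠ i) (hmk : m ≠ k) (ht₀ : t₀ ∈ J i) (ht : t ∈ J i)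
    (hx : x ∈ univ.pi J) (hs : s ∈ J m) :
    lineContinuation h lam i k t₀ (Function.update x m s) t =
      lineContinuation h lam i k t₀ x t := by
  have deriv_eq_zero : ∀ s ∈ J m, HasDerivAt
      (fun s => lineContinuation h lam i k t₀ (Function.update x m s) t) 0 s := by
    intro s hs
    have hxs := update_mem_box hx hs
    simp only [lineContinuation, Function.update_of_ne (Ne.symm hmk)]
    convert! ((H.hasDerivAt_log_sub_log hmi hx ht ht₀ hs).exp.const_mul
      (lam i t₀ - lam k (x k))).const_add (lam k (x k)) using 1
    rw [H.logPd_update hJ hxs (Ne.symm hmk) hki hmi ht,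
      H.logPd_update hJ hxs (Ne.symm hmk) hki hmi ht₀]
    ring
  simpa only [Function.update_eq_self] using
    eq_of_hasDerivAt_zero (hJ m).1 (hJ m).2.1 deriv_eq_zero hs (hx m (mem_univ m))

lemma IsSol.lineContinuation_update_self (hJ : IsBox J) (H : SepSystem κ h (univ.pi J))
    (hki : k ≠ i) (hIs : I ⊆ J i) (hl : IsSol h (Function.update J i I) lam) (ht₀ : t₀ ∈ I)
    (ht : t ∈ J i) (hx : x ∈ univ.pi J) (hs : s ∈ J k) :
    lineContinuation h lam i k t₀ (Function.update x k s) t =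
      lineContinuation h lam i k t₀ x t := by
  have deriv_eq_zero : ∀ s ∈ J k, HasDerivAt
      (fun s => lineContinuation h lam i k t₀ (Function.update x k s) t) 0 s := by
    intro s hs
    have hxs := update_mem_box hx hs
    have hlk := hl _ (update_mem_pi_update hxs ht₀) i k hki.symm
    simp only [Function.update_self, Function.update_of_ne hki] at hlk
    simp only [lineContinuation, Function.update_self]
    convert! hlk.add ((hlk.const_sub (lam i t₀)).mul
      (H.hasDerivAt_log_sub_log hki hx ht (hIs ht₀) hs).exp) using 1
    have hsub := H.logPd_sub_update hJ hxs hki.symm ht (hIs ht₀)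
    have hmul : logPd h i k (Function.update (Function.update x k s) i t) *
        Real.exp (Real.log (h k (Function.update (Function.update x k s) i t)) -
          Real.log (h k (Function.update (Function.update x k s) i t₀))) =
        logPd h i k (Function.update (Function.update x k s) i t₀) := by
      rw [Real.exp_sub, mul_div_assoc', H.logPd_mul_exp_update hJ hxs hki.symm ht (hIs ht₀),
        mul_div_cancel_right₀ _ (Real.exp_ne_zero _)]
    generalize Real.exp (Real.log (h k (Function.update (Function.update x k s) i t)) -
      Real.log (h k (Function.update (Function.update x k s) i t₀))) = E at *
    linear_combination (lam k s - lam i t₀) * E * hsub + (lam k s - lam i t₀) * hmul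
  simpa only [Function.update_eq_self] using
    eq_of_hasDerivAt_zero (hJ k).1 (hJ k).2.1 deriv_eq_zero hs (hx k (mem_univ k))

lemma IsSol.lineContinuation_eq (hJ : IsBox J) (H : SepSystem κ h (univ.pi J))
    (hki : k ≠ i) (hIs : I ⊆ J i) (hl : IsSol h (Function.update J i I) lam) (ht₀ : t₀ ∈ I)
    (ht : t ∈ J i) (hx : x ∈ univ.pi J) (hy : y ∈ univ.pi J) :
    lineContinuation h lam i k t₀ x t = lineContinuation h lam i k t₀ y t := by
  refine eq_of_update_eq (J := J) (f := fun x => lineContinuation h lam i k t₀ x t)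
    Finset.univ (fun m _ x hx s hs => ?_) hx hy (by simp)
  by_cases hmi : m = i
  · subst hmi
    simp [lineContinuation, Function.update_of_ne hki, Function.update_idem]
  by_cases hmk : m = k
  · subst hmk
    exact hl.lineContinuation_update_self hJ H hki hIs ht₀ ht hx hs
  · exact H.lineContinuation_update_of_ne hJ hki hmi hmk (hIs ht₀) ht hx hs

lemma SepSystem.hasDerivAt_lineContinuation (H : SepSystem κ h (univ.pi J)) (hx : x ∈ univ.pi J)
    (ht : t ∈ J i) : HasDerivAt (lineContinuation h lam i k t₀ x)
      ((lineContinuation h lam i k t₀ x t - lam k (x k)) * logPd h k i (Function.update x i t))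
      t := by
  convert! (((hasDerivAt_comp_update (H.diff_log k (update_mem_box hx ht))).sub_const
    (Real.log (h k (Function.update x i t₀)))).exp.const_mul
    (lam i t₀ - lam k (x k))).const_add (lam k (x k)) using 1
  simp only [lineContinuation, logPd]
  ring

lemma IsSol.lineContinuation_eqOn (hJ : IsBox J) (H : SepSystem κ h (univ.pi J)) (hki : k ≠ i)
    (hI : IsOpen I ∧ I.OrdConnected ∧ I.Nonempty) (hIs : I ⊆ J i)
    (hl : IsSol h (Function.update J i I) lam) (ht₀ : t₀ ∈ I) (hy : y ∈ univ.pi J) :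
    EqOn (lineContinuation h lam i k t₀ y) (lam i) I := by
  intro t ht
  have hJ' := hJ.update (i := i) hI
  have H' := H.mono hJ'.isOpen (pi_mono fun k _ => update_subset_of_subset hIs k)
  have heq := hl.eq_exp hJ' H' (update_mem_pi_update hy ht₀) hki (t := t) (by simpa using ht)
  simp only [Function.update_self, Function.update_of_ne hki, Function.update_idem] at heq
  exact heq.symm

/-- A function `F` on `J i` solving, on all lines in direction `i`, the equations of `IsSol` for
`lam i`. -/
def IsLineSol (h : Fin n → (Fin n → ℝ) → ℝ) (J : Fin n → Set ℝ) (lam : Fin n → ℝ → ℝ) (i : Fin n)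
    (F : ℝ → ℝ) : Prop :=
  ∀ x ∈ univ.pi J, ∀ j, j ≠ i → ∀ t ∈ J i,
    HasDerivAt F ((F t - lam j (x j)) * logPd h j i (Function.update x i t)) t

lemma IsSol.isLineSol_lineContinuation (hJ : IsBox J) (H : SepSystem κ h (univ.pi J))
    (hki : k ≠ i) (hI : IsOpen I ∧ I.OrdConnected ∧ I.Nonempty) (hIs : I ⊆ J i)
    (hl : IsSol h (Function.update J i I) lam) (ht₀ : t₀ ∈ I) (hy : y ∈ univ.pi J) :
    IsLineSol h J lam i (lineContinuation h lam i k t₀ y) := by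
  have hasDerivAt_k : ∀ x ∈ univ.pi J, ∀ t ∈ J i, HasDerivAt (lineContinuation h lam i k t₀ y)
      ((lineContinuation h lam i k t₀ y t - lam k (x k)) *
        logPd h k i (Function.update x i t)) t := by
    intro x hx t ht
    have heq : ∀ t ∈ J i, lineContinuation h lam i k t₀ y t = lineContinuation h lam i k t₀ x t :=
      fun t ht => hl.lineContinuation_eq hJ H hki hIs ht₀ ht hy hx
    rw [heq t ht]
    exact (H.hasDerivAt_lineContinuation hx ht).congr_of_eventuallyEq
      (Filter.eventuallyEq_of_mem ((hJ i).1.mem_nhds ht) heq)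
  intro x hx j hj t ht
  have hcompat := H.compat_of_compat_near (cj := lam j (x j)) (ck := lam k (x k)) hJ
    (update_mem_box hx (hIs ht₀)) hj hki
    (by simpa only [Function.update_idem] using hasDerivAt_k x hx)
    (by
      rw [Function.update_self]
      filter_upwards [hI.1.mem_nhds ht₀] with s hs
      have hxs := update_mem_pi_update (i := i) hx hs
      have hsj := hl _ hxs j i hj
      have hsk := hl _ hxs k i hki
      simp only [Function.update_self, Function.update_of_ne hj, Function.update_of_ne hki]
        at hsj hsk
      simp only [Function.update_idem]
      rw [hl.lineContinuation_eqOn hJ H hki hI hIs ht₀ hy hs]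
      exact hsj.unique hsk) ht
  simp only [Function.update_idem] at hcompat
  rw [hcompat]
  exact hasDerivAt_k x hx t ht

lemma IsLineSol.sub_mul_logPd_eq (hJ : IsBox J) (H : SepSystem κ h (univ.pi J)) {F : ℝ → ℝ}
    (hF : IsLineSol h J lam i F) (hji : j ≠ i) (hx : x ∈ univ.pi J) (hs : s ∈ J i) (ht : t ∈ J i) :
    (lam j (x j) - F s) * logPd h i j (Function.update x i s) =
      (lam j (x j) - F t) * logPd h i j (Function.update x i t) := by
  refine eq_of_hasDerivAt_zero (f := fun t => (lam j (x j) - F t) *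
    logPd h i j (Function.update x i t)) (hJ i).1 (hJ i).2.1 (fun t ht => ?_) hs ht
  have hxt := update_mem_box hx ht
  convert! ((hF x hx j hji t ht).const_sub (lam j (x j))).mul
    (hasDerivAt_comp_update (H.diff_logPd i j hxt)) using 1
  rw [H.pd_self i j hji.symm _ hxt]
  ring

lemma IsLineSol.isSol_update (hJ : IsBox J) (H : SepSystem κ h (univ.pi J)) {F : ℝ → ℝ}
    (hF : IsLineSol h J lam i F) (hIs : I ⊆ J i) (hl : IsSol h (Function.update J i I) lam)
    (ht₀ : t₀ ∈ I) (hFt₀ : F t₀ = lam i t₀) : IsSol h J (Function.update lam i F) := by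
  intro x hx a b hab
  have hxi := hx i (mem_univ i)
  by_cases hb : b = i
  · subst hb
    simpa [Function.update_of_ne hab] using hF x hx a hab (x b) hxi
  have hold := hl _ (update_mem_pi_update hx ht₀) a b hab
  rw [Function.update_of_ne hb] at hold ⊢
  by_cases ha : a = i
  · subst ha
    simp only [Function.update_self] at hold ⊢
    convert! hold using 1
    simpa [hFt₀] using hF.sub_mul_logPd_eq hJ H hb hx hxi (hIs ht₀)
  · rw [Function.update_of_ne ha] at hold ⊢
    rwa [H.logPd_update hJ hx hab ha hb (hIs ht₀)] at hold

lemma IsSol.extend_direction (hJ : IsBox J) (H : SepSystem κ h (univ.pi J)) (hn : 1 < n)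
    (hI : IsOpen I ∧ I.OrdConnected ∧ I.Nonempty) (hIs : I ⊆ J i)
    (hl : IsSol h (Function.update J i I) lam) :
    ∃ F : ℝ → ℝ, EqOn F (lam i) I ∧ IsSol h J (Function.update lam i F) := by
  have : Nontrivial (Fin n) := Fin.nontrivial_iff_two_le.2 hn
  obtain ⟨k, hki⟩ := exists_ne i
  obtain ⟨y, hy⟩ := hJ.nonempty
  obtain ⟨t₀, ht₀⟩ := hI.2.2
  have heq := hl.lineContinuation_eqOn hJ H hki hI hIs ht₀ hy
  exact ⟨_, heq, (hl.isLineSol_lineContinuation hJ H hki hI hIs ht₀ hy).isSol_update hJ H hIs hl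
    ht₀ (heq ht₀)⟩

theorem IsSol.extend (hJ : IsBox J) (H : SepSystem κ h (univ.pi J)) (hn : 1 < n) (hJ' : IsBox J')
    (hs : ∀ i, J' i ⊆ J i) (hl : IsSol h J' lam) :
    ∃ mu, IsSol h J mu ∧ ∀ i, EqOn (mu i) (lam i) (J' i) := by
  suffices hsuff : ∀ s : Finset (Fin n), ∃ mu, IsSol h (fun k => if k ∈ s then J k else J' k) mu ∧
      ∀ i, EqOn (mu i) (lam i) (J' i) by
    simpa using hsuff Finset.univ
  intro s
  induction s using Finset.induction_on with
  | empty => exact ⟨lam, by simpa using hl, fun i => eqOn_refl (lam i) (J' i)⟩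
  | insert a s ha ih =>
    obtain ⟨mu, hmu, heq⟩ := ih
    let B : Fin n → Set ℝ := fun k => if k ∈ insert a s then J k else J' k
    have hB : IsBox B := by
      intro k
      simp only [B]
      split_ifs
      exacts [hJ k, hJ' k]
    have hBs : ∀ k, B k ⊆ J k := by
      intro k
      simp only [B]
      split_ifs
      exacts [subset_rfl, hs k]
    have hBa : B a = J a := by simp [B]
    have hupd : (fun k => if k ∈ s then J k else J' k) = Function.update B a (J' a) := by
      ext1 k
      by_cases hk : k = a
      · subst hk
        simp [ha]
      · simp [B, hk]
    rw [hupd] at hmu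
    obtain ⟨F, hF, hsol⟩ := hmu.extend_direction hB
      (H.mono hB.isOpen (pi_mono fun k _ => hBs k)) hn (hJ' a) (hBa ▸ hs a)
    refine ⟨Function.update mu a F, hsol, fun k => ?_⟩
    by_cases hk : k = a
    · subst hk
      simpa only [Function.update_self] using hF.trans (heq k)
    · simpa only [Function.update_of_ne hk] using heq k

theorem SepSystem.exists_sol (hJ : IsBox J) (H : SepSystem κ h (univ.pi J)) (hn : 1 < n) :
    ∃ lam, IsSol h J lam ∧ ∀ x ∈ univ.pi J, ∃ i j, lam i (x i) ≠ lam j (x j) := by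
  obtain ⟨J', hJ', hs, mu, hmu, x, hx, i, j, hij⟩ := H.exists_sol_local hJ.nonempty hn
  obtain ⟨lam, hlam, heq⟩ := hmu.extend hJ H hn hJ' (hJ'.subset_of_pi_subset hs)
  refine ⟨lam, hlam, fun y hy => ⟨i, j, fun he => hij ?_⟩⟩
  simpa only [heq i (hx i (mem_univ i)), heq j (hx j (mem_univ j))] using
    hlam.eq_of_eq hJ H hy he (hs hx)

end ExtensionOfSolutions

/-! ### The metric in terms of the eigenvalues -/

section Form

variable {n : ℕ}

lemma pd_eq_zero_of_update_eq {f : (Fin n → ℝ) → ℝ} {x : Fin n → ℝ} {k : Fin n}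
    (h : ∀ s, f (Function.update x k s) = f x) : pd k f x = 0 := by
  by_cases hf : DifferentiableAt ℝ f x
  · refine (hasDerivAt_comp_update_self hf k).unique ?_
    simpa only [h] using hasDerivAt_const (x k) (f x)
  · simp [pd, fderiv_zero_of_not_differentiableAt hf]

section NonconstIndices

variable {κ : ℝ} {h : Fin n → (Fin n → ℝ) → ℝ} {J : Fin n → Set ℝ} {lam : Fin n → ℝ → ℝ}
  {x y z : Fin n → ℝ} {S : Finset (Fin n)} {a b i k : Fin n} {t : ℝ}

open Classical in
/-- The set `S` of the indices `a` for which the eigenvalue `σ_a = lam a` is not constant. -/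
def nonconstIndices (J : Fin n → Set ℝ) (lam : Fin n → ℝ → ℝ) : Finset (Fin n) :=
  {a | ∃ s ∈ J a, ∃ t ∈ J a, lam a s ≠ lam a t}

lemma mem_nonconstIndices :
    a ∈ nonconstIndices J lam ↔ ∃ s ∈ J a, ∃ t ∈ J a, lam a s ≠ lam a t := by
  simp [nonconstIndices]

lemma eq_of_notMem_nonconstIndices (hi : i ∉ nonconstIndices J lam) {s t : ℝ} (hs : s ∈ J i)
    (ht : t ∈ J i) : lam i s = lam i t := by
  by_contra hne
  exact hi (mem_nonconstIndices.2 ⟨s, hs, t, ht, hne⟩)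

lemma IsSol.ne_of_mem_nonconstIndices (hJ : IsBox J) (H : SepSystem κ h (univ.pi J))
    (hl : IsSol h J lam) (ha : a ∈ nonconstIndices J lam) (hab : a ≠ b) (hx : x ∈ univ.pi J) :
    lam a (x a) ≠ lam b (x b) := by
  intro he
  obtain ⟨s, hs, t, ht, hst⟩ := mem_nonconstIndices.1 ha
  have hconst := (hl.const_of_eq hJ H hx hab he).1
  exact hst ((hconst s hs).trans (hconst t ht).symm)

/-- The product of the differences of the `i`-th eigenvalue and the eigenvalues `lam b`, `b ∈ S`. -/
def eigenvalueProd (S : Finset (Fin n)) (lam : Fin n → ℝ → ℝ) (i : Fin n) (x : Fin n → ℝ) : ℝ :=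
  ∏ b ∈ S.erase i, (lam i (x i) - lam b (x b))

lemma eigenvalueProd_update (hki : k ≠ i) (hk : k ∉ S) (t : ℝ) :
    eigenvalueProd S lam i (Function.update x k t) = eigenvalueProd S lam i x := by
  refine Finset.prod_congr rfl fun b hb => ?_
  have hbk : b ≠ k := by
    rintro rfl
    exact hk (Finset.mem_of_mem_erase hb)
  rw [Function.update_of_ne hki.symm, Function.update_of_ne hbk]

lemma eigenvalueProd_eq_mul (hki : k ≠ i) (hk : k ∈ S) :
    eigenvalueProd S lam i = fun x =>
      (lam i (x i) - lam k (x k)) * eigenvalueProd (S.erase k) lam i x := by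
  ext x
  rw [eigenvalueProd, eigenvalueProd, Finset.erase_right_comm]
  exact (Finset.mul_prod_erase _ _ (Finset.mem_erase.2 ⟨hki, hk⟩)).symm

/-- The quotient of `h i` by `eigenvalueProd S lam i`. -/
def reducedComponent (h : Fin n → (Fin n → ℝ) → ℝ) (S : Finset (Fin n)) (lam : Fin n → ℝ → ℝ)
    (i : Fin n) (x : Fin n → ℝ) : ℝ :=
  h i x * (eigenvalueProd S lam i x)⁻¹

variable (hJ : IsBox J) (H : SepSystem κ h (univ.pi J)) (hn : 1 < n) (hl : IsSol h J lam)
include hJ H hl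

lemma IsSol.eigenvalueProd_ne_zero (i : Fin n) (hx : x ∈ univ.pi J) :
    eigenvalueProd (nonconstIndices J lam) lam i x ≠ 0 := by
  refine Finset.prod_ne_zero_iff.2 fun b hb => sub_ne_zero.2 ?_
  obtain ⟨hbi, hb⟩ := Finset.mem_erase.1 hb
  exact (hl.ne_of_mem_nonconstIndices hJ H hb hbi hx).symm

lemma IsSol.eq_eigenvalueProd_mul (i : Fin n) (hx : x ∈ univ.pi J) :
    h i x = eigenvalueProd (nonconstIndices J lam) lam i x *
      reducedComponent h (nonconstIndices J lam) lam i x := by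
  have hne := hl.eigenvalueProd_ne_zero hJ H i hx
  rw [reducedComponent]
  field_simp

lemma IsSol.logPd_eq_zero (hki : k ≠ i) (hk : k ∉ nonconstIndices J lam)
    (hy : y ∈ univ.pi J) (hne : lam k (y k) ≠ lam i (y i)) (hx : x ∈ univ.pi J) :
    logPd h i k x = 0 := by
  have hxk := hx k (mem_univ k)
  have hder : HasDerivAt (lam k) 0 (x k) :=
    (hasDerivAt_const (x k) (lam k (x k))).congr_of_eventuallyEq <|
      Filter.eventuallyEq_of_mem ((hJ k).1.mem_nhds hxk)
        fun t ht => eq_of_notMem_nonconstIndices hk ht hxk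
  refine (mul_eq_zero.1 ((hl x hx i k hki.symm).unique hder)).resolve_left fun h0 => hne ?_
  exact hl.eq_of_eq hJ H hx (sub_eq_zero.1 h0) hy

include hn

lemma IsSol.contDiffOn_comp_apply (a : Fin n) :
    ContDiffOn ℝ ∞ (fun x : Fin n → ℝ => lam a (x a)) (univ.pi J) :=
  (hl.contDiffOn hJ H hn a).comp (contDiff_apply ℝ ℝ a).contDiffOn fun _ hx => hx a (mem_univ a)

lemma IsSol.contDiffOn_eigenvalueProd (S : Finset (Fin n)) (i : Fin n) :
    ContDiffOn ℝ ∞ (eigenvalueProd S lam i) (univ.pi J) :=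
  contDiffOn_prod fun b _ =>
    (hl.contDiffOn_comp_apply hJ H hn i).sub (hl.contDiffOn_comp_apply hJ H hn b)

lemma IsSol.contDiffOn_reducedComponent (i : Fin n) :
    ContDiffOn ℝ ∞ (reducedComponent h (nonconstIndices J lam) lam i) (univ.pi J) :=
  (H.smooth i).mul ((hl.contDiffOn_eigenvalueProd hJ H hn _ i).inv
    fun _ hx => hl.eigenvalueProd_ne_zero hJ H i hx)

lemma IsSol.pd_sub_eq (hki : k ≠ i) (hx : x ∈ univ.pi J) :
    pd k (fun x => lam i (x i) - lam k (x k)) x =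
      (lam i (x i) - lam k (x k)) * logPd h i k x := by
  have hd : DifferentiableAt ℝ (fun x : Fin n → ℝ => lam i (x i) - lam k (x k)) x :=
    differentiableAt_of_contDiffOn ((hl.contDiffOn_comp_apply hJ H hn i).sub
      (hl.contDiffOn_comp_apply hJ H hn k)) H.isOpen hx
  have hpd := hasDerivAt_comp_update_self hd k
  simp only [Function.update_self, Function.update_of_ne hki.symm] at hpd
  rw [hpd.unique ((hl x hx i k hki.symm).const_sub (lam i (x i)))]
  ring

lemma IsSol.pd_eigenvalueProd_of_mem (hki : k ≠ i) (hk : k ∈ S) (hx : x ∈ univ.pi J) :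
    pd k (eigenvalueProd S lam i) x = logPd h i k x * eigenvalueProd S lam i x := by
  have hsm := hl.contDiffOn_comp_apply hJ H hn
  rw [eigenvalueProd_eq_mul hki hk,
    pd_mul (differentiableAt_of_contDiffOn ((hsm i).sub (hsm k)) H.isOpen hx)
      (differentiableAt_of_contDiffOn (hl.contDiffOn_eigenvalueProd hJ H hn _ i) H.isOpen hx),
    pd_eq_zero_of_update_eq (eigenvalueProd_update hki (Finset.notMem_erase k S)),
    hl.pd_sub_eq hJ H hn hki hx]
  ring

lemma IsSol.pd_eigenvalueProd (hki : k ≠ i) (hy : y ∈ univ.pi J)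
    (hk : k ∈ nonconstIndices J lam ∨ lam k (y k) ≠ lam i (y i)) (hx : x ∈ univ.pi J) :
    pd k (eigenvalueProd (nonconstIndices J lam) lam i) x =
      logPd h i k x * eigenvalueProd (nonconstIndices J lam) lam i x := by
  by_cases hkS : k ∈ nonconstIndices J lam
  · exact hl.pd_eigenvalueProd_of_mem hJ H hn hki hkS hx
  · rw [hl.logPd_eq_zero hJ H hki hkS hy (hk.resolve_left hkS) hx, zero_mul,
      pd_eq_zero_of_update_eq (eigenvalueProd_update hki hkS)]

lemma IsSol.pd_reducedComponent (hki : k ≠ i) (hy : y ∈ univ.pi J)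
    (hk : k ∈ nonconstIndices J lam ∨ lam k (y k) ≠ lam i (y i)) (hx : x ∈ univ.pi J) :
    pd k (reducedComponent h (nonconstIndices J lam) lam i) x = 0 := by
  have hpd := pd_congr_on H.isOpen hx (fun z hz => hl.eq_eigenvalueProd_mul hJ H i hz) k
  rw [pd_mul (differentiableAt_of_contDiffOn (hl.contDiffOn_eigenvalueProd hJ H hn _ i) H.isOpen hx)
      (differentiableAt_of_contDiffOn (hl.contDiffOn_reducedComponent hJ H hn i) H.isOpen hx),
    H.pd_eq_logPd_mul hx i k, hl.pd_eigenvalueProd hJ H hn hki hy hk hx,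
    hl.eq_eigenvalueProd_mul hJ H i hx] at hpd
  refine (mul_eq_zero.1 ?_).resolve_left (hl.eigenvalueProd_ne_zero hJ H i hx)
  linear_combination -hpd

lemma IsSol.reducedComponent_eq_of_eq (hy : y ∈ univ.pi J) (hx : x ∈ univ.pi J)
    (hz : z ∈ univ.pi J) (hxz : ∀ k, k ∉ nonconstIndices J lam → lam k (y k) = lam i (y i) →
      x k = z k) (hi : x i = z i) :
    reducedComponent h (nonconstIndices J lam) lam i x =
      reducedComponent h (nonconstIndices J lam) lam i z := by
  classical
  refine eq_of_pd_eq_zero hJ (fun x hx => differentiableAt_of_contDiffOn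
    (hl.contDiffOn_reducedComponent hJ H hn i) H.isOpen hx)
    {k | k ≠ i ∧ (k ∈ nonconstIndices J lam ∨ lam k (y k) ≠ lam i (y i))} ?_ hx hz ?_
  · intro k hk x hx
    simp only [Finset.mem_filter, Finset.mem_univ, true_and] at hk
    exact hl.pd_reducedComponent hJ H hn hk.1 hy hk.2 hx
  · intro k hk
    simp only [Finset.mem_filter, Finset.mem_univ, true_and, not_and_or, not_not, not_or] at hk
    rcases hk with rfl | ⟨hkS, hke⟩
    exacts [hi, hxz k hkS hke]

lemma IsSol.reducedComponent_update_of_mem (ha : a ∈ nonconstIndices J lam) (hx : x ∈ univ.pi J)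
    (hy : y ∈ univ.pi J) :
    reducedComponent h (nonconstIndices J lam) lam a (Function.update y a (x a)) =
      reducedComponent h (nonconstIndices J lam) lam a x := by
  refine hl.reducedComponent_eq_of_eq hJ H hn hy (update_mem_box hy (hx a (mem_univ a))) hx
    (fun k hk he => ?_) (Function.update_self _ _ _)
  have hak : a ≠ k := by
    rintro rfl
    exact hk ha
  exact absurd he.symm (hl.ne_of_mem_nonconstIndices hJ H ha hak hy)

end NonconstIndices

variable {κ : ℝ} {J : Fin n → Set ℝ} {g : (Fin n → ℝ) → Matrix (Fin n) (Fin n) ℝ}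

lemma hasConcircularForm_of_subsingleton (hn : ¬ 1 < n)
    (hg : ∀ i j, ContDiffOn ℝ ∞ (fun x => g x i j) (univ.pi J)) : HasConcircularForm g J := by
  refine ⟨∅, fun _ => 0, fun _ _ => 0, fun _ _ => 0, fun i j x => g x i j, by simp,
    fun i j _ _ _ => ⟨hg i j, fun x _ y _ hxy => ?_⟩, by simp, fun h => absurd h hn⟩
  rw [show x = y from funext fun k => hxy k (Finset.notMem_empty k) rfl]

theorem SepSystem.hasConcircularForm (hJ : IsBox J)
    (H : SepSystem κ (fun i x => g x i i) (univ.pi J)) (hn : 1 < n)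
    (hdiag : ∀ x ∈ univ.pi J, ∀ i j, i ≠ j → g x i j = 0) : HasConcircularForm g J := by
  obtain ⟨lam, hlam, hnt⟩ := H.exists_sol hJ hn
  obtain ⟨y, hy⟩ := hJ.nonempty
  let f := reducedComponent (fun i x => g x i i) (nonconstIndices J lam) lam
  have hf : ∀ i, ContDiffOn ℝ ∞ (f i) (univ.pi J) := hlam.contDiffOn_reducedComponent hJ H hn
  have hg : ∀ i, ∀ x ∈ univ.pi J,
      g x i i = eigenvalueProd (nonconstIndices J lam) lam i x * f i x :=
    fun i x hx => hlam.eq_eigenvalueProd_mul hJ H i hx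
  refine ⟨nonconstIndices J lam, fun i => lam i (y i), fun a t => f a (Function.update y a t), lam,
    fun i j x => if i = j then f i x else 0, fun a ha => ⟨?_, hlam.contDiffOn hJ H hn a,
      mem_nonconstIndices.1 ha⟩, fun i j hi hj he => ?_,
    fun x hx => ⟨fun a ha => ?_, fun i j hi hj he => ?_, fun i j hij _ => hdiag x hx i j hij⟩,
    fun _ => Or.inr (hnt y hy)⟩
  · exact (hf a).comp (contDiff_update ∞ y a).contDiffOn fun t ht => update_mem_box hy ht
  · rcases eq_or_ne i j with rfl | hij
    · simp only [if_true]
      exact ⟨hf i, fun x hx z hz hxz =>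
        hlam.reducedComponent_eq_of_eq hJ H hn hy hx hz hxz (hxz i hi rfl)⟩
    · simpa only [if_neg hij, implies_true, and_true] using contDiffOn_const
  · simp only [f]
    rw [hlam.reducedComponent_update_of_mem hJ H hn ha hx hy, hg a x hx, mul_comm, eigenvalueProd]
  · rcases eq_or_ne i j with rfl | hij
    · simp only [if_true]
      rw [hg i x hx, eigenvalueProd, Finset.erase_eq_of_notMem hi,
        eq_of_notMem_nonconstIndices hi (hx i (mem_univ i)) (hy i (mem_univ i))]
    · simp only [if_neg hij, mul_zero, hdiag x hx i j hij]

end Form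

/-! ### Orthogonal metrics -/

section Orthogonal

variable {n : ℕ} {κ : ℝ} {g T : (Fin n → ℝ) → Matrix (Fin n) (Fin n) ℝ} {Ω Ω' : Set (Fin n → ℝ)}
  {x : Fin n → ℝ} {m : Fin n → (Fin n → ℝ) → ℝ} {i j k : Fin n}

/-- `g` is a smooth nondegenerate diagonal metric on the open set `Ω`. -/
structure OrthMetric (g : (Fin n → ℝ) → Matrix (Fin n) (Fin n) ℝ) (Ω : Set (Fin n → ℝ)) : Prop where
  isOpen : IsOpen Ω
  smooth : ∀ i, ContDiffOn ℝ ∞ (fun x => g x i i) Ω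
  ne_zero : ∀ i, ∀ x ∈ Ω, g x i i ≠ 0
  off_diag : ∀ x ∈ Ω, ∀ i j, i ≠ j → g x i j = 0

/-- The diagonal components of a metric. -/
def diagOf (g : (Fin n → ℝ) → Matrix (Fin n) (Fin n) ℝ) (i : Fin n) (x : Fin n → ℝ) : ℝ := g x i i

/-- At the point `x`, the tensor `T` is diagonal, with eigenvalues `m i` with respect to `g`. -/
def IsDiagAt (g T : (Fin n → ℝ) → Matrix (Fin n) (Fin n) ℝ) (m : Fin n → ℝ) (x : Fin n → ℝ) :
    Prop :=
  ∀ i j, T x i j = if i = j then m i * g x i i else 0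

/-- The Levi-Civita separability conditions for an orthogonal metric, expressed with the
logarithmic derivatives of its components. -/
def LeviCivitaAt (g : (Fin n → ℝ) → Matrix (Fin n) (Fin n) ℝ) (x : Fin n → ℝ) : Prop :=
  ∀ i j, i ≠ j → ∀ k, pd j (logPd (diagOf g) k i) x =
    logPd (diagOf g) k i x * logPd (diagOf g) k j x
      - logPd (diagOf g) j i x * logPd (diagOf g) k j x
      - logPd (diagOf g) i j x * logPd (diagOf g) k i x

namespace OrthMetric

lemma mono (hg : OrthMetric g Ω) (hΩ' : IsOpen Ω') (hs : Ω' ⊆ Ω) : OrthMetric g Ω' where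
  isOpen := hΩ'
  smooth i := (hg.smooth i).mono hs
  ne_zero i x hx := hg.ne_zero i x (hs hx)
  off_diag x hx := hg.off_diag x (hs hx)

variable (hg : OrthMetric g Ω)
include hg

lemma inv_eq (hx : x ∈ Ω) : (g x)⁻¹ = Matrix.diagonal fun i => (g x i i)⁻¹ := by
  have g_eq : g x = Matrix.diagonal fun i => g x i i := by
    ext i j
    by_cases hij : i = j
    · subst hij
      simp
    · rw [Matrix.diagonal_apply_ne _ hij, hg.off_diag x hx i j hij]
  refine Matrix.inv_eq_right_inv ?_
  rw [g_eq, Matrix.diagonal_mul_diagonal, ← Matrix.diagonal_one]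
  congr 1
  ext i
  simp [hg.ne_zero i x hx]

lemma diff (hx : x ∈ Ω) (i : Fin n) : DifferentiableAt ℝ (fun x => g x i i) x :=
  differentiableAt_of_contDiffOn (hg.smooth i) hg.isOpen hx

lemma pd_diag (hx : x ∈ Ω) (i j : Fin n) :
    pd j (fun y => g y i i) x = logPd (diagOf g) i j x * g x i i := by
  have h0 := hg.ne_zero i x hx
  simp only [logPd, diagOf]
  rw [pd_log (hg.diff hx i) h0]
  field_simp

lemma pd_off_diag (hx : x ∈ Ω) (hij : i ≠ j) (k : Fin n) : pd k (fun y => g y i j) x = 0 :=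
  pd_eq_zero_of_eqOn hg.isOpen hx (fun y hy => hg.off_diag y hy i j hij) k

lemma christoffel_eq (hx : x ∈ Ω) (k i j : Fin n) :
    christoffel g k i j x = (1 / 2) * ((g x k k)⁻¹ * (pd i (fun y => g y j k) x +
      pd j (fun y => g y i k) x - pd k (fun y => g y i j) x)) := by
  rw [christoffel, hg.inv_eq hx, Finset.sum_eq_single k]
  · simp
  · intro l _ hl
    simp [Matrix.diagonal_apply_ne _ (Ne.symm hl)]
  · simp

lemma christoffel_left (hx : x ∈ Ω) (i j : Fin n) :
    christoffel g i i j x = (1 / 2) * logPd (diagOf g) i j x := by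
  have h0 := hg.ne_zero i x hx
  rw [hg.christoffel_eq hx]
  by_cases hij : i = j
  · subst hij
    rw [hg.pd_diag hx]
    field_simp
    ring
  · rw [hg.pd_off_diag hx (Ne.symm hij), hg.pd_off_diag hx hij, hg.pd_diag hx]
    field_simp
    ring

lemma christoffel_symm (k i j : Fin n) (hx : x ∈ Ω) :
    christoffel g k i j x = christoffel g k j i x := by
  have pd_symm : pd k (fun y => g y i j) x = pd k (fun y => g y j i) x := by
    by_cases hij : i = j
    · rw [hij]
    · rw [hg.pd_off_diag hx hij, hg.pd_off_diag hx (Ne.symm hij)]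
  rw [hg.christoffel_eq hx, hg.christoffel_eq hx, pd_symm]
  ring

lemma christoffel_right (hx : x ∈ Ω) (i j : Fin n) :
    christoffel g i j i x = (1 / 2) * logPd (diagOf g) i j x := by
  rw [hg.christoffel_symm i j i hx, hg.christoffel_left hx]

lemma christoffel_diag (hx : x ∈ Ω) (hik : i ≠ k) :
    christoffel g k i i x = -(1 / 2) * ((g x k k)⁻¹ * g x i i * logPd (diagOf g) i k x) := by
  rw [hg.christoffel_eq hx, hg.pd_off_diag hx hik, hg.pd_diag hx]
  ring

lemma christoffel_distinct (hx : x ∈ Ω) (hij : i ≠ j) (hik : i ≠ k) (hjk : j ≠ k) :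
    christoffel g k i j x = 0 := by
  rw [hg.christoffel_eq hx, hg.pd_off_diag hx hik, hg.pd_off_diag hx hij, hg.pd_off_diag hx hjk]
  ring

lemma contDiffOn_logPd (i j : Fin n) : ContDiffOn ℝ ∞ (logPd (diagOf g) i j) Ω :=
  contDiffOn_pd ((hg.smooth i).log fun x hx => hg.ne_zero i x hx) hg.isOpen j

lemma diff_logPd (hx : x ∈ Ω) (i j : Fin n) : DifferentiableAt ℝ (logPd (diagOf g) i j) x :=
  differentiableAt_of_contDiffOn (hg.contDiffOn_logPd i j) hg.isOpen hx

/-! #### Curvature -/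

lemma pd_christoffel_left (hx : x ∈ Ω) (i j k : Fin n) :
    pd j (christoffel g i i k) x = (1 / 2) * pd j (logPd (diagOf g) i k) x := by
  rw [pd_congr_on hg.isOpen hx (fun y hy => hg.christoffel_left hy i k),
    pd_const_mul _ (hg.diff_logPd hx i k)]

lemma pd_christoffel_diag (hx : x ∈ Ω) (hij : i ≠ j) :
    pd i (christoffel g i j j) x = -(1 / 2) * ((g x i i)⁻¹ * g x j j *
      (pd i (logPd (diagOf g) j i) x + logPd (diagOf g) j i x ^ 2
        - logPd (diagOf g) i i x * logPd (diagOf g) j i x)) := by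
  have hi := hg.ne_zero i x hx
  have hinv : DifferentiableAt ℝ (fun y => (g y i i)⁻¹) x := (hg.diff hx i).fun_inv hi
  rw [pd_congr_on hg.isOpen hx (fun y hy => hg.christoffel_diag hy (Ne.symm hij)),
    pd_const_mul _ ((hinv.fun_mul (hg.diff hx j)).fun_mul (hg.diff_logPd hx j i)),
    pd_mul (hinv.fun_mul (hg.diff hx j)) (hg.diff_logPd hx j i), pd_mul hinv (hg.diff hx j),
    pd_inv (hg.diff hx i) hi, hg.pd_diag hx, hg.pd_diag hx]
  field_simp
  ring

lemma christoffel_mul_sub_distinct (hx : x ∈ Ω) (hij : i ≠ j) (hik : i ≠ k) (hjk : j ≠ k)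
    (m : Fin n) :
    christoffel g i i m x * christoffel g m j k x - christoffel g i j m x * christoffel g m i k x =
      (if m = i then -(1 / 4) * (logPd (diagOf g) i j x * logPd (diagOf g) i k x) else 0) +
      (if m = j then (1 / 4) * (logPd (diagOf g) i j x * logPd (diagOf g) j k x) else 0) +
      (if m = k then (1 / 4) * (logPd (diagOf g) i k x * logPd (diagOf g) k j x) else 0) := by
  by_cases hmi : m = i
  · subst hmi
    rw [if_pos rfl, if_neg hij, if_neg hik, hg.christoffel_right hx m j, hg.christoffel_left hx m k,
      hg.christoffel_distinct hx hjk (Ne.symm hij) (Ne.symm hik)]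
    ring
  by_cases hmj : m = j
  · subst hmj
    rw [if_neg hmi, if_pos rfl, if_neg hjk, hg.christoffel_left hx, hg.christoffel_left hx,
      hg.christoffel_distinct hx hik hij (Ne.symm hjk)]
    ring
  rw [hg.christoffel_left hx, hg.christoffel_distinct hx (Ne.symm hmj) (Ne.symm hij) hmi]
  by_cases hmk : m = k
  · subst hmk
    rw [if_neg hmi, if_neg hmj, if_pos rfl, hg.christoffel_right hx]
    ring
  · rw [if_neg hmi, if_neg hmj, if_neg hmk,
      hg.christoffel_distinct hx hjk (Ne.symm hmj) (Ne.symm hmk)]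
    ring

lemma riemann_distinct (hx : x ∈ Ω) (hij : i ≠ j) (hik : i ≠ k) (hjk : j ≠ k) :
    riemann g i k i j x = -(1 / 2) * pd j (logPd (diagOf g) i k) x +
      (1 / 4) * (logPd (diagOf g) i j x * logPd (diagOf g) j k x +
        logPd (diagOf g) i k x * logPd (diagOf g) k j x -
        logPd (diagOf g) i j x * logPd (diagOf g) i k x) := by
  have pd_christoffel_distinct : pd i (christoffel g i j k) x = 0 :=
    pd_eq_zero_of_eqOn hg.isOpen hx
      (fun y hy => hg.christoffel_distinct hy hjk (Ne.symm hij) (Ne.symm hik)) i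
  rw [riemann, pd_christoffel_distinct, hg.pd_christoffel_left hx,
    Finset.sum_congr rfl fun m _ => hg.christoffel_mul_sub_distinct hx hij hik hjk m]
  simp only [Finset.sum_add_distrib, Finset.sum_ite_eq', Finset.mem_univ, if_true]
  ring

lemma christoffel_mul_sub_pair (hx : x ∈ Ω) (hij : i ≠ j) (m : Fin n) :
    christoffel g i i m x * christoffel g m j j x - christoffel g i j m x * christoffel g m i j x =
      (if m = i then -(1 / 4) * ((g x i i)⁻¹ * g x j j * (logPd (diagOf g) i i x *
        logPd (diagOf g) j i x) + logPd (diagOf g) i j x ^ 2) else 0) +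
      (if m = j then (1 / 4) * (logPd (diagOf g) i j x * logPd (diagOf g) j j x +
        (g x i i)⁻¹ * g x j j * logPd (diagOf g) j i x ^ 2) else 0) +
      (if m ≠ i ∧ m ≠ j then -(1 / 4) * g x j j * ((g x m m)⁻¹ * (logPd (diagOf g) i m x *
        logPd (diagOf g) j m x)) else 0) := by
  by_cases hmi : m = i
  · subst hmi
    rw [if_pos rfl, if_neg hij, if_neg (by tauto), hg.christoffel_right hx m j,
      hg.christoffel_left hx m j, hg.christoffel_left hx m m,
      hg.christoffel_diag hx (Ne.symm hij)]
    ring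
  by_cases hmj : m = j
  · subst hmj
    rw [if_neg hmi, if_pos rfl, if_neg (by tauto), hg.christoffel_left hx,
      hg.christoffel_left hx, hg.christoffel_diag hx hmi, hg.christoffel_right hx]
    ring
  · rw [if_neg hmi, if_neg hmj, if_pos ⟨hmi, hmj⟩, hg.christoffel_left hx,
      hg.christoffel_diag hx (Ne.symm hmj),
      hg.christoffel_distinct hx (Ne.symm hmj) (Ne.symm hij) hmi]
    ring

lemma riemann_pair (hx : x ∈ Ω) (hij : i ≠ j) :
    riemann g i j i j x * (-4 * (g x j j)⁻¹) =
      (g x j j)⁻¹ * (2 * pd j (logPd (diagOf g) i j) x + logPd (diagOf g) i j x ^ 2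
        - logPd (diagOf g) i j x * logPd (diagOf g) j j x)
      + (g x i i)⁻¹ * (2 * pd i (logPd (diagOf g) j i) x + logPd (diagOf g) j i x ^ 2
        - logPd (diagOf g) j i x * logPd (diagOf g) i i x)
      + ∑ k ∈ {k | k ≠ i ∧ k ≠ j},
          (g x k k)⁻¹ * (logPd (diagOf g) i k x * logPd (diagOf g) j k x) := by
  have hi := hg.ne_zero i x hx
  have hj := hg.ne_zero j x hx
  rw [riemann, hg.pd_christoffel_diag hx hij, hg.pd_christoffel_left hx,
    Finset.sum_congr rfl fun m _ => hg.christoffel_mul_sub_pair hx hij m]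
  simp only [Finset.sum_add_distrib, Finset.sum_ite_eq', Finset.mem_univ, if_true]
  rw [← Finset.sum_filter, ← Finset.mul_sum]
  field_simp
  ring

/-! #### Diagonal tensors -/

section Diagonal

variable (hT : ∀ x ∈ Ω, IsDiagAt g T (fun i => m i x) x) (hx : x ∈ Ω)
include hT hx

lemma covDeriv_same (hm : ∀ i, DifferentiableAt ℝ (m i) x) (k i : Fin n) :
    covDeriv g T k i i x = pd k (m i) x * g x i i := by
  rw [covDeriv, pd_congr_on hg.isOpen hx (fun y hy => hT y hy i i)]
  simp only [if_true]
  rw [pd_mul (hm i) (hg.diff hx i), hg.pd_diag hx, Finset.sum_eq_single i, Finset.sum_eq_single i]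
  · rw [hT x hx, if_pos rfl, hg.christoffel_right hx]
    ring
  · intro l _ hl
    rw [hT x hx, if_neg (Ne.symm hl), mul_zero]
  · simp
  · intro l _ hl
    rw [hT x hx, if_neg hl, mul_zero]
  · simp

lemma covDeriv_ne (k : Fin n) (hij : i ≠ j) :
    covDeriv g T k i j x = -(christoffel g j k i x * (m j x * g x j j))
      - christoffel g i k j x * (m i x * g x i i) := by
  rw [covDeriv, pd_eq_zero_of_eqOn hg.isOpen hx (fun y hy => by rw [hT y hy i j, if_neg hij]),
    Finset.sum_eq_single j, Finset.sum_eq_single i]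
  · rw [hT x hx, if_pos rfl, hT x hx, if_pos rfl]
    ring
  · intro l _ hl
    rw [hT x hx, if_neg (Ne.symm hl), mul_zero]
  · simp
  · intro l _ hl
    rw [hT x hx, if_neg hl, mul_zero]
  · simp

lemma covDeriv_left (hij : i ≠ j) :
    covDeriv g T i i j x = (1 / 2) * (logPd (diagOf g) i j x * g x i i * (m j x - m i x)) := by
  have hj := hg.ne_zero j x hx
  rw [hg.covDeriv_ne hT hx i hij, hg.christoffel_diag hx hij, hg.christoffel_left hx]
  field_simp

lemma covDeriv_right (hij : i ≠ j) :
    covDeriv g T j i j x = (1 / 2) * (logPd (diagOf g) j i x * g x j j * (m i x - m j x)) := by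
  have hi := hg.ne_zero i x hx
  rw [hg.covDeriv_ne hT hx j hij, hg.christoffel_diag hx (Ne.symm hij), hg.christoffel_left hx]
  field_simp
  ring

lemma covDeriv_distinct (hij : i ≠ j) (hik : i ≠ k) (hjk : j ≠ k) : covDeriv g T k i j x = 0 := by
  rw [hg.covDeriv_ne hT hx k hij, hg.christoffel_distinct hx (Ne.symm hik) (Ne.symm hjk) hij,
    hg.christoffel_distinct hx (Ne.symm hjk) (Ne.symm hik) (Ne.symm hij)]
  ring

lemma concircular_of_diag (hm : ∀ i, DifferentiableAt ℝ (m i) x)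
    (h0 : ∀ i k, i ≠ k → pd k (m i) x = 0)
    (h1 : ∀ i j, i ≠ j → pd j (m j) x = (m j x - m i x) * logPd (diagOf g) i j x) (i j k : Fin n) :
    covDeriv g T k i j x = (1 / 2) * (pd i (m i) x * g x j k + pd j (m j) x * g x i k) := by
  by_cases hij : i = j
  · subst hij
    rw [hg.covDeriv_same hT hx hm]
    by_cases hik : i = k
    · subst hik
      ring
    · rw [h0 i k hik, hg.off_diag x hx i k hik]
      ring
  by_cases hik : i = k
  · subst hik
    rw [hg.covDeriv_left hT hx hij, hg.off_diag x hx j i (Ne.symm hij), h1 i j hij]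
    ring
  by_cases hjk : j = k
  · subst hjk
    rw [hg.covDeriv_right hT hx hij, hg.off_diag x hx i j hij, h1 j i (Ne.symm hij)]
    ring
  rw [hg.covDeriv_distinct hT hx hij hik hjk, hg.off_diag x hx i k hik, hg.off_diag x hx j k hjk]
  ring

lemma diag_of_concircular (hm : ∀ i, DifferentiableAt ℝ (m i) x) {α : Fin n → ℝ}
    (hα : ∀ i j k, covDeriv g T k i j x = (1 / 2) * (α i * g x j k + α j * g x i k)) :
    (∀ i k, i ≠ k → pd k (m i) x = 0) ∧
    ∀ i j, i ≠ j → pd j (m j) x = (m j x - m i x) * logPd (diagOf g) i j x := by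
  have pd_mul_eq : ∀ i k, pd k (m i) x * g x i i = α i * g x i k := by
    intro i k
    rw [← hg.covDeriv_same hT hx hm, hα]
    ring
  constructor
  · intro i k hik
    refine (mul_eq_zero.1 ?_).resolve_right (hg.ne_zero i x hx)
    rw [pd_mul_eq, hg.off_diag x hx i k hik, mul_zero]
  · intro i j hij
    have hleft := hα i j i
    rw [hg.covDeriv_left hT hx hij, hg.off_diag x hx j i (Ne.symm hij)] at hleft
    rw [mul_right_cancel₀ (hg.ne_zero j x hx) (pd_mul_eq j j)]
    apply mul_right_cancel₀ (hg.ne_zero i x hx)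
    linear_combination -2 * hleft

end Diagonal

/-! #### The Levi-Civita separability conditions -/

lemma pd_eigenvalue_of_killing (hms : ∀ i, ContDiffOn ℝ ∞ (m i) Ω)
    (hT : ∀ x ∈ Ω, IsDiagAt g T (fun i => m i x) x)
    (hK : ∀ i j k, covDeriv g T i j k x + covDeriv g T j k i x + covDeriv g T k i j x = 0)
    (hx : x ∈ Ω) (i j : Fin n) :
    pd j (m i) x = (m i x - m j x) * logPd (diagOf g) i j x := by
  have hmd i : DifferentiableAt ℝ (m i) x := differentiableAt_of_contDiffOn (hms i) hg.isOpen hx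
  apply mul_right_cancel₀ (hg.ne_zero i x hx)
  have hKij := hK j i i
  by_cases hij : i = j
  · subst hij
    rw [hg.covDeriv_same hT hx hmd] at hKij
    linear_combination (1 / 3) * hKij
  · rw [hg.covDeriv_same hT hx hmd, hg.covDeriv_left hT hx hij,
      hg.covDeriv_right hT hx (Ne.symm hij)] at hKij
    linear_combination hKij

/- The Levi-Civita conditions are the integrability conditions of the equations for the eigenvalues
in `pd_eigenvalue_of_killing`. -/
lemma leviCivitaAt_of_killing (hmI : Function.Injective fun i => m i x)
    (hms : ∀ i, ContDiffOn ℝ ∞ (m i) Ω) (hT : ∀ x ∈ Ω, IsDiagAt g T (fun i => m i x) x)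
    (hK : ∀ x ∈ Ω, ∀ i j k, covDeriv g T i j k x + covDeriv g T j k i x + covDeriv g T k i j x = 0)
    (hx : x ∈ Ω) : LeviCivitaAt g x := by
  intro i j hij k
  have hmd i : DifferentiableAt ℝ (m i) x := differentiableAt_of_contDiffOn (hms i) hg.isOpen hx
  have hpd i j : ∀ x ∈ Ω, pd j (m i) x = (m i x - m j x) * logPd (diagOf g) i j x :=
    fun x hx => hg.pd_eigenvalue_of_killing hms hT (hK x hx) hx i j
  have hlog : pd i (logPd (diagOf g) k j) x = pd j (logPd (diagOf g) k i) x :=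
    pd_comm ((hg.smooth k).log fun x hx => hg.ne_zero k x hx) hg.isOpen hx i j
  have hcomm := pd_comm (hms k) hg.isOpen hx j i
  rw [pd_congr_on hg.isOpen hx (hpd k i), pd_congr_on hg.isOpen hx (hpd k j),
    pd_mul ((hmd k).fun_sub (hmd i)) (hg.diff_logPd hx k i),
    pd_mul ((hmd k).fun_sub (hmd j)) (hg.diff_logPd hx k j),
    pd_sub (hmd k) (hmd i), pd_sub (hmd k) (hmd j), hpd k j x hx, hpd k i x hx, hpd i j x hx,
    hpd j i x hx, hlog] at hcomm
  have hne : m j x - m i x ≠ 0 := sub_ne_zero.2 (hmI.ne hij.symm)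
  apply mul_left_cancel₀ hne
  linear_combination hcomm

lemma pd_logPd_eq_zero (hlc : LeviCivitaAt g x)
    (hcurv : ∀ l k i j, riemann g l k i j x =
      κ * (g x j k * (1 : Matrix (Fin n) (Fin n) ℝ) l i
        - g x i k * (1 : Matrix (Fin n) (Fin n) ℝ) l j))
    (hx : x ∈ Ω) (hij : i ≠ j) (hik : i ≠ k) (hjk : j ≠ k) :
    pd k (logPd (diagOf g) i j) x = 0 := by
  have hR := hcurv i j i k
  rw [hg.riemann_distinct hx hik hij (Ne.symm hjk), hg.off_diag x hx k j (Ne.symm hjk),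
    hg.off_diag x hx i j hij] at hR
  linear_combination -(4 / 3) * hR + (1 / 3) * hlc j k hjk i

lemma sepSystem (hlc : ∀ x ∈ Ω, LeviCivitaAt g x)
    (hcurv : ∀ x ∈ Ω, ∀ l k i j, riemann g l k i j x =
      κ * (g x j k * (1 : Matrix (Fin n) (Fin n) ℝ) l i
        - g x i k * (1 : Matrix (Fin n) (Fin n) ℝ) l j)) :
    SepSystem κ (diagOf g) Ω where
  isOpen := hg.isOpen
  smooth := hg.smooth
  ne_zero := hg.ne_zero
  pd_mixed i j k hij hik hjk x hx := hg.pd_logPd_eq_zero (hlc x hx) (hcurv x hx) hx hij hik hjk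
  quad i j k hij hik hjk x hx := by
    have hmixed := hg.pd_logPd_eq_zero (hlc x hx) (hcurv x hx) hx (Ne.symm hik) (Ne.symm hjk) hij
    linear_combination hmixed - hlc x hx i j hij k
  pd_self i j hij x hx := by
    linear_combination hlc x hx j i (Ne.symm hij) i
  gauss i j hij x hx := by
    have hR := hg.riemann_pair hx hij
    rw [hcurv x hx i j i j, hg.off_diag x hx i j hij] at hR
    have hj := hg.ne_zero j x hx
    simp only [diagOf] at hR ⊢
    rw [← hR]
    simp
    field_simp

end OrthMetric

end Orthogonal

/-! ### Separability of the Hamilton–Jacobi equation -/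

section HamiltonJacobi

variable {n : ℕ} {V C : Set (Fin n → ℝ)} {x : Fin n → ℝ}

lemma contDiffOn_deriv_fst {E : Type*} [NormedAddCommGroup E] [NormedSpace ℝ E] {W : ℝ → E → ℝ}
    {I : Set ℝ} {C : Set E} (hI : IsOpen I) (hC : IsOpen C)
    (hW : ContDiffOn ℝ ∞ (fun q : ℝ × E => W q.1 q.2) (I ×ˢ C)) :
    ContDiffOn ℝ ∞ (fun q : ℝ × E => deriv (fun t => W t q.2) q.1) (I ×ˢ C) := by
  have hfderiv : ContDiffOn ℝ ∞ (fun q : ℝ × E =>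
      fderiv ℝ (fun q : ℝ × E => W q.1 q.2) q (1, 0)) (I ×ˢ C) :=
    (hW.fderiv_of_isOpen (hI.prod hC) (by simp)).clm_apply contDiffOn_const
  refine hfderiv.congr fun q hq => ?_
  have hline : HasDerivAt (fun t : ℝ => (t, q.2)) ((1 : ℝ), (0 : E)) q.1 :=
    (hasDerivAt_id q.1).prodMk (hasDerivAt_const _ _)
  exact ((differentiableAt_of_contDiffOn hW (hI.prod hC) hq).hasFDerivAt.comp_hasDerivAt q.1
    hline).deriv

lemma contDiffOn_comp_eval {f : ℝ → ℝ} {i : Fin n}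
    (hf : ContDiffOn ℝ ∞ f ((fun x : Fin n → ℝ => x i) '' V)) :
    ContDiffOn ℝ ∞ (fun x : Fin n → ℝ => f (x i)) V :=
  hf.comp (contDiff_apply ℝ ℝ i).contDiffOn fun x hx => ⟨x, hx, rfl⟩

lemma pd_comp_eval {f : ℝ → ℝ} {i : Fin n}
    (h : DifferentiableAt ℝ (fun x : Fin n → ℝ => f (x i)) x) (k : Fin n) :
    pd k (fun x : Fin n → ℝ => f (x i)) x = if k = i then deriv f (x i) else 0 := by
  have hline := hasDerivAt_comp_update_self h k
  split_ifs with hki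
  · subst hki
    simp only [Function.update_self] at hline
    exact hline.deriv.symm
  · simp only [Function.update_of_ne (Ne.symm hki)] at hline
    exact hline.unique (hasDerivAt_const _ _)

section SumOfProducts

variable {G : Fin n → (Fin n → ℝ) → ℝ} {s : Fin n → ℝ → ℝ} {E : ℝ}

lemma sum_pd_mul_add_eq_zero (hV : IsOpen V) (hG : ∀ i, ContDiffOn ℝ ∞ (G i) V)
    (hs : ∀ i, ContDiffOn ℝ ∞ (s i) ((fun x : Fin n → ℝ => x i) '' V))
    (hsum : ∀ x ∈ V, ∑ i, G i x * s i (x i) = E) (j : Fin n) (hx : x ∈ V) :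
    ∑ i, pd j (G i) x * s i (x i) + G j x * deriv (s j) (x j) = 0 := by
  have hGd i := differentiableAt_of_contDiffOn (hG i) hV hx
  have hsd i := differentiableAt_of_contDiffOn (contDiffOn_comp_eval (hs i)) hV hx
  have hpd := pd_congr_on hV hx hsum j
  rw [pd_const, pd_sum fun i _ => (hGd i).fun_mul (hsd i)] at hpd
  rw [← hpd, Finset.sum_congr rfl fun i _ => pd_mul (hGd i) (hsd i) j, Finset.sum_add_distrib]
  simp [pd_comp_eval (hsd _)]

lemma sum_pd_pd_mul_add_eq_zero (hV : IsOpen V) (hG : ∀ i, ContDiffOn ℝ ∞ (G i) V)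
    (hs : ∀ i, ContDiffOn ℝ ∞ (s i) ((fun x : Fin n → ℝ => x i) '' V))
    (hsum : ∀ x ∈ V, ∑ i, G i x * s i (x i) = E) {j k : Fin n} (hjk : j ≠ k) (hx : x ∈ V) :
    ∑ i, pd k (pd j (G i)) x * s i (x i) + pd j (G k) x * deriv (s k) (x k)
      + pd k (G j) x * deriv (s j) (x j) = 0 := by
  have hGd := differentiableAt_of_contDiffOn (hG j) hV hx
  have hGd' i := differentiableAt_of_contDiffOn (contDiffOn_pd (hG i) hV j) hV hx
  have hsd i := differentiableAt_of_contDiffOn (contDiffOn_comp_eval (hs i)) hV hx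
  have hsd' := differentiableAt_of_contDiffOn (contDiffOn_comp_eval
    ((hs j).deriv_of_isOpen (isOpenMap_eval j V hV) (by simp))) hV hx
  have hpd := pd_congr_on hV hx (fun y hy => sum_pd_mul_add_eq_zero hV hG hs hsum j hy) k
  rw [pd_const, pd_add (.fun_sum fun i _ => (hGd' i).fun_mul (hsd i)) (hGd.fun_mul hsd'),
    pd_sum fun i _ => (hGd' i).fun_mul (hsd i), pd_mul hGd hsd', pd_comp_eval hsd',
    if_neg hjk.symm, Finset.sum_congr rfl fun i _ => pd_mul (hGd' i) (hsd i) k,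
    Finset.sum_add_distrib] at hpd
  have hdiag : ∑ i, pd j (G i) x * pd k (fun x : Fin n → ℝ => s i (x i)) x =
      pd j (G k) x * deriv (s k) (x k) := by simp [pd_comp_eval (hsd _)]
  linear_combination hpd - hdiag

/-- The Stäckel operator `∂ⱼ∂ᵢ - (∂ⱼ log Gᵢ) ∂ᵢ - (∂ᵢ log Gⱼ) ∂ⱼ` of the diagonal contravariant
metric `G`. It annihilates the components of `G` if and only if the Levi-Civita conditions hold. -/
def staeckelOp (G : Fin n → (Fin n → ℝ) → ℝ) (i j : Fin n) (f : (Fin n → ℝ) → ℝ)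
    (x : Fin n → ℝ) : ℝ :=
  pd j (pd i f) x - pd j (G i) x / G i x * pd i f x - pd i (G j) x / G j x * pd j f x

lemma sum_staeckelOp_mul_eq_zero (hV : IsOpen V) (hG : ∀ i, ContDiffOn ℝ ∞ (G i) V)
    (hG0 : ∀ i, G i x ≠ 0)
    (hs : ∀ i, ContDiffOn ℝ ∞ (s i) ((fun x : Fin n → ℝ => x i) '' V))
    (hsum : ∀ x ∈ V, ∑ i, G i x * s i (x i) = E) {j k : Fin n} (hjk : j ≠ k) (hx : x ∈ V) :
    ∑ i, staeckelOp G j k (G i) x * s i (x i) = 0 := by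
  have hsplit : ∑ i, staeckelOp G j k (G i) x * s i (x i) =
      ∑ i, pd k (pd j (G i)) x * s i (x i)
        - pd k (G j) x / G j x * ∑ i, pd j (G i) x * s i (x i)
        - pd j (G k) x / G k x * ∑ i, pd k (G i) x * s i (x i) := by
    rw [Finset.mul_sum, Finset.mul_sum, ← Finset.sum_sub_distrib, ← Finset.sum_sub_distrib]
    exact Finset.sum_congr rfl fun i _ => by unfold staeckelOp; ring
  have hderiv (l : Fin n) :
      deriv (s l) (x l) = -(∑ i, pd l (G i) x * s i (x i)) / G l x := by
    rw [eq_div_iff (hG0 l)]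
    linear_combination sum_pd_mul_add_eq_zero hV hG hs hsum l hx
  have hsecond := sum_pd_pd_mul_add_eq_zero hV hG hs hsum hjk hx
  rw [hderiv j, hderiv k] at hsecond
  linear_combination hsplit + hsecond

end SumOfProducts

lemma eq_zero_of_forall_sum_mul_sq_eq_zero {P : Fin n → (Fin n → ℝ) → ℝ}
    {a : Fin n → ℝ} (hC : IsOpen C) (hCn : C.Nonempty) (hP : ∀ l, ContDiffOn ℝ ∞ (P l) C)
    (hdet : ∀ c ∈ C, (Matrix.of fun l m => pd m (P l) c).det ≠ 0)
    (hsum : ∀ c ∈ C, ∑ l, a l * P l c ^ 2 = 0) (k : Fin n) : a k = 0 := by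
  have haP : ∀ c ∈ C, ∀ l, a l * P l c = 0 := by
    intro c hc
    have hPd l := differentiableAt_of_contDiffOn (hP l) hC hc
    refine congrFun (Matrix.eq_zero_of_vecMul_eq_zero (hdet c hc) (funext fun m => ?_))
    have hpd := pd_congr_on hC hc hsum m
    rw [pd_const, pd_sum fun l _ => ((hPd l).fun_pow 2).const_mul (a l)] at hpd
    have hterm l : pd m (fun c => a l * P l c ^ 2) c = 2 * (a l * P l c * pd m (P l) c) := by
      simp_rw [pow_two]
      rw [pd_const_mul _ ((hPd l).fun_mul (hPd l)), pd_mul (hPd l) (hPd l)]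
      ring
    simp only [hterm, ← Finset.mul_sum] at hpd
    simpa [Matrix.vecMul, dotProduct] using hpd
  by_contra hne
  obtain ⟨c, hc⟩ := hCn
  exact hdet c hc (Matrix.det_eq_zero_of_row_eq_zero k fun m => pd_eq_zero_of_eqOn hC hc
    (fun c' hc' => (mul_eq_zero.1 (haP c' hc' k)).resolve_left hne) m)

namespace OrthMetric

variable {g : (Fin n → ℝ) → Matrix (Fin n) (Fin n) ℝ}

lemma sum_inv_mul_mul (hg : OrthMetric g V) (hx : x ∈ V) (p : Fin n → ℝ) :
    ∑ i, ∑ j, (g x)⁻¹ i j * p i * p j = ∑ i, (diagOf g i x)⁻¹ * p i ^ 2 := by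
  rw [hg.inv_eq hx]
  simp [Matrix.diagonal_apply, diagOf, pow_two, mul_assoc]

lemma pd_inv_diagOf (hg : OrthMetric g V) (hx : x ∈ V) (i j : Fin n) :
    pd j (fun x => (diagOf g i x)⁻¹) x = -1 * (logPd (diagOf g) i j x * (diagOf g i x)⁻¹) := by
  have hne : g x i i ≠ 0 := hg.ne_zero i x hx
  unfold diagOf
  rw [pd_inv (hg.diff hx i) hne, hg.pd_diag hx]
  unfold diagOf
  field_simp

lemma contDiffOn_inv_diagOf (hg : OrthMetric g V) (i : Fin n) :
    ContDiffOn ℝ ∞ (fun x => (diagOf g i x)⁻¹) V :=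
  (hg.smooth i).inv (hg.ne_zero i)

lemma leviCivitaAt_of_staeckelOp_eq_zero (hg : OrthMetric g V) (hx : x ∈ V)
    (h : ∀ i j, i ≠ j → ∀ k,
      staeckelOp (fun i x => (diagOf g i x)⁻¹) i j (fun x => (diagOf g k x)⁻¹) x = 0) :
    LeviCivitaAt g x := by
  intro i j hij k
  have hop := h i j hij k
  have hGd := differentiableAt_of_contDiffOn (hg.contDiffOn_inv_diagOf k) hg.isOpen hx
  have hne (l : Fin n) : diagOf g l x ≠ 0 := hg.ne_zero l x hx
  rw [staeckelOp, pd_congr_on hg.isOpen hx (fun z hz => hg.pd_inv_diagOf hz k i),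
    pd_const_mul _ ((hg.diff_logPd hx k i).fun_mul hGd), pd_mul (hg.diff_logPd hx k i) hGd,
    hg.pd_inv_diagOf hx k j, hg.pd_inv_diagOf hx k i, hg.pd_inv_diagOf hx i j,
    hg.pd_inv_diagOf hx j i] at hop
  have hi := hne i
  have hj := hne j
  have hk := hne k
  field_simp at hop
  linear_combination -hop

/-- Differentiating the separated equation `∑ₗ gˡˡ (∂ₗ Wₗ)² = 2E` in the coordinates shows that the
Stäckel operators applied to the `gˡˡ` are the coefficients of a relation between the `(∂ₗ Wₗ)²`,
and completeness of the integral forces such a relation to be trivial. -/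
lemma leviCivitaAt_of_separable (hg : OrthMetric g V) {W : Fin n → ℝ → (Fin n → ℝ) → ℝ}
    {E : (Fin n → ℝ) → ℝ} (hC : IsOpen C) (hCn : C.Nonempty)
    (hW : ∀ i, ContDiffOn ℝ ∞ (fun q : ℝ × (Fin n → ℝ) => W i q.1 q.2)
      (((fun x : Fin n → ℝ => x i) '' V) ×ˢ C))
    (hHJ : ∀ x ∈ V, ∀ c ∈ C, (1 / 2) * ∑ i, ∑ j, (g x)⁻¹ i j *
      deriv (fun t => W i t c) (x i) * deriv (fun t => W j t c) (x j) = E c)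
    (hdet : ∀ c ∈ C,
      (Matrix.of fun i j => pd j (fun c' => deriv (fun t => W i t c') (x i)) c).det ≠ 0)
    (hx : x ∈ V) : LeviCivitaAt g x := by
  refine hg.leviCivitaAt_of_staeckelOp_eq_zero hx fun i j hij k => ?_
  have hP (l : Fin n) := contDiffOn_deriv_fst (isOpenMap_eval l V hg.isOpen) hC (hW l)
  refine eq_zero_of_forall_sum_mul_sq_eq_zero hC hCn
    (P := fun l c => deriv (fun t => W l t c) (x l))
    (a := fun k => staeckelOp (fun i x => (diagOf g i x)⁻¹) i j (fun x => (diagOf g k x)⁻¹) x)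
    (fun l => (hP l).comp (contDiff_const.prodMk contDiff_id).contDiffOn
      fun c hc => ⟨⟨x, hx, rfl⟩, hc⟩) hdet (fun c hc => ?_) k
  refine sum_staeckelOp_mul_eq_zero hg.isOpen hg.contDiffOn_inv_diagOf
    (fun l => inv_ne_zero (hg.ne_zero l x hx)) (E := 2 * E c)
    (s := fun l t => deriv (fun t => W l t c) t ^ 2) (fun l => ?_) (fun z hz => ?_) hij hx
  · exact ((hP l).comp (contDiff_id.prodMk contDiff_const).contDiffOn fun t ht => ⟨ht, hc⟩).pow 2
  · rw [← hHJ z hz c hc, hg.sum_inv_mul_mul hz fun l => deriv (fun t => W l t c) (z l)]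
    ring

end OrthMetric

end HamiltonJacobi

/-! ### Change of coordinates for the covariant derivative -/

section ChangeOfCoordinates

open Matrix

variable {n : ℕ} {g T A B : (Fin n → ℝ) → Matrix (Fin n) (Fin n) ℝ} {x : Fin n → ℝ}
  {Ω : Set (Fin n → ℝ)}

/-- The matrix of the `k`-th partial derivatives of the entries of `A`. -/
def pdMatrix (k : Fin n) (A : (Fin n → ℝ) → Matrix (Fin n) (Fin n) ℝ) (x : Fin n → ℝ) :
    Matrix (Fin n) (Fin n) ℝ :=
  .of fun i j => pd k (fun y => A y i j) x

/-- The matrix of the endomorphism `v ↦ Γ(∂ₖ, v)`. -/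
def christoffelMatrix (g : (Fin n → ℝ) → Matrix (Fin n) (Fin n) ℝ) (k : Fin n) (x : Fin n → ℝ) :
    Matrix (Fin n) (Fin n) ℝ :=
  .of fun l i => christoffel g l k i x

/-- The matrix of components of `∇ₖ T`. -/
def covDerivMatrix (g T : (Fin n → ℝ) → Matrix (Fin n) (Fin n) ℝ) (k : Fin n) (x : Fin n → ℝ) :
    Matrix (Fin n) (Fin n) ℝ :=
  .of fun i j => covDeriv g T k i j x

/-- The Jacobian matrix of `τ`. -/
def jacobian (τ : (Fin n → ℝ) → Fin n → ℝ) (x : Fin n → ℝ) : Matrix (Fin n) (Fin n) ℝ :=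
  .of fun a i => pd i (fun y => τ y a) x

/-- The components of the pullback under `τ` of the covariant 2-tensor with components `T`. -/
def pullback (τ : (Fin n → ℝ) → Fin n → ℝ) (T : (Fin n → ℝ) → Matrix (Fin n) (Fin n) ℝ)
    (x : Fin n → ℝ) : Matrix (Fin n) (Fin n) ℝ :=
  (jacobian τ x)ᵀ * T (τ x) * jacobian τ x

/-- The equation `∇ₖ Tᵢⱼ = α₍ᵢ gⱼ₎ₖ` of a concircular tensor at the point `x`. -/
def ConcircularAt (g T : (Fin n → ℝ) → Matrix (Fin n) (Fin n) ℝ) (x : Fin n → ℝ) : Prop :=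
  ∃ α : Fin n → ℝ, ∀ i j k, covDeriv g T k i j x = (1 / 2) * (α i * g x j k + α j * g x i k)

lemma pdMatrix_congr_on (hΩ : IsOpen Ω) (hx : x ∈ Ω) (h : ∀ y ∈ Ω, A y = B y) (k : Fin n) :
    pdMatrix k A x = pdMatrix k B x :=
  Matrix.ext fun _ _ => pd_congr_on hΩ hx (fun y hy => by rw [h y hy]) k

lemma pdMatrix_transpose (k : Fin n) : pdMatrix k (fun y => (A y)ᵀ) x = (pdMatrix k A x)ᵀ := rfl

lemma pdMatrix_mul (hA : ∀ i j, DifferentiableAt ℝ (fun y => A y i j) x)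
    (hB : ∀ i j, DifferentiableAt ℝ (fun y => B y i j) x) (k : Fin n) :
    pdMatrix k (fun y => A y * B y) x = pdMatrix k A x * B x + A x * pdMatrix k B x := by
  ext i j
  simp only [pdMatrix, Matrix.add_apply, Matrix.mul_apply, Matrix.of_apply,
    ← Finset.sum_add_distrib]
  rw [pd_sum fun l _ => (hA i l).fun_mul (hB l j)]
  exact Finset.sum_congr rfl fun l _ => pd_mul (hA i l) (hB l j) k

lemma pd_comp {f : (Fin n → ℝ) → ℝ} {τ : (Fin n → ℝ) → Fin n → ℝ}
    (hf : DifferentiableAt ℝ f (τ x)) (hτ : DifferentiableAt ℝ τ x) (k : Fin n) :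
    pd k (fun y => f (τ y)) x = ∑ c, jacobian τ x c k * pd c f (τ x) := by
  have hchain : fderiv ℝ (fun y => f (τ y)) x = (fderiv ℝ f (τ x)).comp (fderiv ℝ τ x) :=
    fderiv_comp x hf hτ
  have hsum : fderiv ℝ τ x (Pi.single k 1) = ∑ c, jacobian τ x c k • Pi.single c (1 : ℝ) := by
    ext a
    simp [jacobian, pd, fderiv_apply hτ a, Pi.single_apply]
  simp [pd, hchain, hsum]

lemma pdMatrix_comp {τ : (Fin n → ℝ) → Fin n → ℝ}
    (hA : ∀ i j, DifferentiableAt ℝ (fun y => A y i j) (τ x)) (hτ : DifferentiableAt ℝ τ x)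
    (k : Fin n) :
    pdMatrix k (fun y => A (τ y)) x = ∑ c, jacobian τ x c k • pdMatrix c A (τ x) := by
  ext i j
  simpa [pdMatrix, Matrix.sum_apply] using pd_comp (hA i j) hτ k

lemma covDerivMatrix_eq (k : Fin n) :
    covDerivMatrix g T k x = pdMatrix k T x - (christoffelMatrix g k x)ᵀ * T x
      - T x * christoffelMatrix g k x := by
  ext i j
  simp [covDerivMatrix, covDeriv, pdMatrix, christoffelMatrix, Matrix.mul_apply, mul_comm]

lemma mul_christoffelMatrix_apply (hdet : (g x).det ≠ 0) (k m i : Fin n) :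
    (g x * christoffelMatrix g k x) m i = (1 / 2) *
      (pd k (fun y => g y i m) x + pd i (fun y => g y k m) x - pd m (fun y => g y k i) x) := by
  let S : Fin n → ℝ := fun m =>
    pd k (fun y => g y i m) x + pd i (fun y => g y k m) x - pd m (fun y => g y k i) x
  have hS : g x *ᵥ ((g x)⁻¹ *ᵥ S) = S := by
    rw [mulVec_mulVec, mul_nonsing_inv _ (isUnit_iff_ne_zero.2 hdet), one_mulVec]
  change _ = (1 / 2) * S m
  rw [← congrFun hS m]
  simp only [mul_apply, mulVec, dotProduct, christoffelMatrix, of_apply, christoffel,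
    Finset.mul_sum, S]
  exact Finset.sum_congr rfl fun l _ => Finset.sum_congr rfl fun m' _ => by ring

lemma christoffelMatrix_apply_comm (hΩ : IsOpen Ω) (hx : x ∈ Ω) (hsymm : ∀ y ∈ Ω, (g y).IsSymm)
    (k l i : Fin n) : christoffelMatrix g k x l i = christoffelMatrix g i x l k := by
  have hpd (l : Fin n) : pd l (fun y => g y k i) x = pd l (fun y => g y i k) x :=
    pd_congr_on hΩ hx (fun y hy => (hsymm y hy).apply i k) l
  simp only [christoffelMatrix, of_apply, christoffel, hpd]
  congr! 4 with m
  exact add_comm (pd k (fun y => g y i m) x) _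

lemma transpose_christoffelMatrix_mul (hsymm : (g x).IsSymm) (k : Fin n) :
    (christoffelMatrix g k x)ᵀ * g x = (g x * christoffelMatrix g k x)ᵀ := by
  rw [transpose_mul, hsymm.eq]

lemma pdMatrix_metric (hΩ : IsOpen Ω) (hx : x ∈ Ω) (hsymm : ∀ y ∈ Ω, (g y).IsSymm)
    (hdet : (g x).det ≠ 0) (k : Fin n) :
    pdMatrix k g x = (christoffelMatrix g k x)ᵀ * g x + g x * christoffelMatrix g k x := by
  ext i j
  have hpd (a b c : Fin n) : pd c (fun y => g y a b) x = pd c (fun y => g y b a) x :=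
    pd_congr_on hΩ hx (fun y hy => (hsymm y hy).apply b a) c
  rw [transpose_christoffelMatrix_mul (hsymm x hx), Matrix.add_apply, transpose_apply,
    mul_christoffelMatrix_apply hdet, mul_christoffelMatrix_apply hdet, hpd j i k, hpd k j i,
    hpd k i j, pdMatrix, of_apply, hpd j k i, hpd i k j]
  ring

lemma christoffelMatrix_eq_of_torsionFree_of_metric (hsymm : (g x).IsSymm) (hdet : (g x).det ≠ 0)
    {Γ : Fin n → Matrix (Fin n) (Fin n) ℝ} (htf : ∀ k l i, Γ k l i = Γ i l k)
    (hmet : ∀ k, pdMatrix k g x = (Γ k)ᵀ * g x + g x * Γ k) (k : Fin n) :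
    christoffelMatrix g k x = Γ k := by
  have hlower : g x * christoffelMatrix g k x = g x * Γ k := by
    ext m i
    have hpd (a b c : Fin n) :
        pd c (fun y => g y a b) x = (g x * Γ c) b a + (g x * Γ c) a b := by
      have hentry := congrFun (congrFun (hmet c) a) b
      rw [← hsymm.eq, ← transpose_mul, hsymm.eq] at hentry
      exact hentry
    have htf' (a b c : Fin n) : (g x * Γ a) b c = (g x * Γ c) b a := by
      simp only [mul_apply, htf a _ c]
    rw [mul_christoffelMatrix_apply hdet, hpd, hpd, hpd, htf' i m k, htf' i k m, htf' m k i,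
      htf' k i m, htf' m i k]
    ring
  have hunit := isUnit_iff_ne_zero.2 hdet
  rw [← nonsing_inv_mul_cancel_left (g x) (christoffelMatrix g k x) hunit, hlower,
    nonsing_inv_mul_cancel_left _ _ hunit]

section Transformation

variable {g' T' : (Fin n → ℝ) → Matrix (Fin n) (Fin n) ℝ} {τ : (Fin n → ℝ) → Fin n → ℝ}
  {Ω' : Set (Fin n → ℝ)}

lemma pullback_isSymm (hT : (T (τ x)).IsSymm) : (pullback τ T x).IsSymm := by
  rw [pullback, IsSymm, transpose_mul, transpose_mul, transpose_transpose, hT.eq, mul_assoc]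

lemma contDiffOn_jacobian (hΩ : IsOpen Ω) (hτ : ContDiffOn ℝ ∞ τ Ω) (a i : Fin n) :
    ContDiffOn ℝ ∞ (fun y => jacobian τ y a i) Ω :=
  contDiffOn_pd (contDiffOn_pi.1 hτ a) hΩ i

lemma contDiffOn_pullback (hΩ : IsOpen Ω) (hτ : ContDiffOn ℝ ∞ τ Ω) (hmaps : MapsTo τ Ω Ω')
    (hT' : ∀ a b, ContDiffOn ℝ ∞ (fun y => T' y a b) Ω') (i j : Fin n) :
    ContDiffOn ℝ ∞ (fun x => pullback τ T' x i j) Ω := by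
  simp only [pullback, mul_apply, transpose_apply]
  exact .sum fun b _ => .mul (.sum fun a _ => (contDiffOn_jacobian hΩ hτ a i).mul
    ((hT' a b).comp hτ hmaps)) (contDiffOn_jacobian hΩ hτ b j)

lemma pdMatrix_jacobian_symm (hΩ : IsOpen Ω) (hx : x ∈ Ω) (hτ : ContDiffOn ℝ ∞ τ Ω)
    (k a i : Fin n) : pdMatrix k (jacobian τ) x a i = pdMatrix i (jacobian τ) x a k :=
  pd_comm (contDiffOn_pi.1 hτ a) hΩ hx k i

lemma pdMatrix_pullback (hΩ : IsOpen Ω) (hx : x ∈ Ω) (hτ : ContDiffOn ℝ ∞ τ Ω)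
    (hT' : ∀ a b, DifferentiableAt ℝ (fun y => T' y a b) (τ x)) (k : Fin n) :
    pdMatrix k (pullback τ T') x =
      (pdMatrix k (jacobian τ) x)ᵀ * T' (τ x) * jacobian τ x
        + (jacobian τ x)ᵀ * (∑ c, jacobian τ x c k • pdMatrix c T' (τ x)) * jacobian τ x
        + (jacobian τ x)ᵀ * T' (τ x) * pdMatrix k (jacobian τ) x := by
  have hD a i := differentiableAt_of_contDiffOn (contDiffOn_jacobian hΩ hτ a i) hΩ hx
  have hτd := differentiableAt_of_contDiffOn hτ hΩ hx
  have hT'τ a b : DifferentiableAt ℝ (fun y => T' (τ y) a b) x := (hT' a b).comp x hτd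
  have hDT a b : DifferentiableAt ℝ (fun y => ((jacobian τ y)ᵀ * T' (τ y)) a b) x := by
    simp only [mul_apply, transpose_apply]
    exact .fun_sum fun c _ => (hD c a).fun_mul (hT'τ c b)
  change pdMatrix k (fun y => (jacobian τ y)ᵀ * T' (τ y) * jacobian τ y) x = _
  rw [pdMatrix_mul hDT hD, pdMatrix_mul (A := fun y => (jacobian τ y)ᵀ) (B := fun y => T' (τ y))
      (fun a i => hD i a) hT'τ, pdMatrix_transpose,
    pdMatrix_comp hT' hτd, add_mul]

/-- The transformed connection is torsion-free and metric, hence the Levi-Civita connection of the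
pulled back metric. -/
lemma jacobian_mul_christoffelMatrix (hΩ : IsOpen Ω) (hx : x ∈ Ω) (hτ : ContDiffOn ℝ ∞ τ Ω)
    (hΩ' : IsOpen Ω') (hx' : τ x ∈ Ω') (hg' : ∀ a b, DifferentiableAt ℝ (fun y => g' y a b) (τ x))
    (hsymm : ∀ y ∈ Ω', (g' y).IsSymm) (hdet : (g' (τ x)).det ≠ 0) (hJ : (jacobian τ x).det ≠ 0)
    (hg : ∀ y ∈ Ω, g y = pullback τ g' y) (k : Fin n) :
    jacobian τ x * christoffelMatrix g k x =
      (∑ c, jacobian τ x c k • christoffelMatrix g' c (τ x)) * jacobian τ x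
        + pdMatrix k (jacobian τ) x := by
  set D := jacobian τ x
  let C (k : Fin n) := ∑ c, D c k • christoffelMatrix g' c (τ x)
  let X (k : Fin n) := C k * D + pdMatrix k (jacobian τ) x
  have hDX (k : Fin n) : D * (D⁻¹ * X k) = X k :=
    mul_nonsing_inv_cancel_left _ _ (isUnit_iff_ne_zero.2 hJ)
  have hgx : g x = Dᵀ * g' (τ x) * D := hg x hx
  have hgsymm : (g x).IsSymm := hg x hx ▸ pullback_isSymm (hsymm _ hx')
  have hgdet : (g x).det ≠ 0 := by
    rw [hgx, det_mul, det_mul, det_transpose]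
    exact mul_ne_zero (mul_ne_zero hJ hdet) hJ
  have hXtf (k l i : Fin n) : X k l i = X i l k := by
    simp only [X, C, Matrix.add_apply, pdMatrix_jacobian_symm hΩ hx hτ k l i, mul_apply,
      Matrix.sum_apply, Matrix.smul_apply, smul_eq_mul, Finset.sum_mul]
    rw [Finset.sum_comm]
    congr! 3 with a _ c
    rw [christoffelMatrix_apply_comm hΩ' hx' hsymm c l a]
    ring
  have hmet (k : Fin n) :
      pdMatrix k g x = (D⁻¹ * X k)ᵀ * g x + g x * (D⁻¹ * X k) := by
    have hC : ∑ c, D c k • pdMatrix c g' (τ x) = (C k)ᵀ * g' (τ x) + g' (τ x) * C k := by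
      simp only [C, pdMatrix_metric hΩ' hx' hsymm hdet, smul_add, Finset.sum_add_distrib,
        transpose_sum, transpose_smul, Finset.sum_mul, Finset.mul_sum, smul_mul, Matrix.mul_smul]
    have hgX : g x * (D⁻¹ * X k) = Dᵀ * g' (τ x) * X k := by rw [hgx, mul_assoc _ D, hDX]
    have hXg : (D⁻¹ * X k)ᵀ * g x = (X k)ᵀ * g' (τ x) * D := by
      rw [← hgsymm.eq, ← transpose_mul, hgX, transpose_mul, transpose_mul, transpose_transpose,
        (hsymm _ hx').eq, mul_assoc]
    rw [hgX, hXg, pdMatrix_congr_on hΩ hx hg, pdMatrix_pullback hΩ hx hτ hg', hC]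
    simp only [X, transpose_add, transpose_mul, mul_add, add_mul, mul_assoc]
    abel
  rw [christoffelMatrix_eq_of_torsionFree_of_metric hgsymm hgdet (Γ := fun k => D⁻¹ * X k)
    (fun k l i => by simp only [mul_apply, hXtf k _ i]) hmet k, hDX]

lemma covDerivMatrix_pullback (hΩ : IsOpen Ω) (hx : x ∈ Ω) (hτ : ContDiffOn ℝ ∞ τ Ω)
    (hΩ' : IsOpen Ω') (hx' : τ x ∈ Ω') (hg' : ∀ a b, DifferentiableAt ℝ (fun y => g' y a b) (τ x))
    (hT' : ∀ a b, DifferentiableAt ℝ (fun y => T' y a b) (τ x))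
    (hsymm : ∀ y ∈ Ω', (g' y).IsSymm) (hdet : (g' (τ x)).det ≠ 0) (hJ : (jacobian τ x).det ≠ 0)
    (hg : ∀ y ∈ Ω, g y = pullback τ g' y) (hT : ∀ y ∈ Ω, T y = pullback τ T' y) (k : Fin n) :
    covDerivMatrix g T k x = (jacobian τ x)ᵀ *
      (∑ c, jacobian τ x c k • covDerivMatrix g' T' c (τ x)) * jacobian τ x := by
  have hΓ := jacobian_mul_christoffelMatrix hΩ hx hτ hΩ' hx' hg' hsymm hdet hJ hg k
  set D := jacobian τ x
  set C := ∑ c, D c k • christoffelMatrix g' c (τ x)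
  have hTΓ : T x * christoffelMatrix g k x =
      Dᵀ * T' (τ x) * (C * D + pdMatrix k (jacobian τ) x) := by
    rw [← hΓ, hT x hx, pullback, mul_assoc _ D]
  have hΓT : (christoffelMatrix g k x)ᵀ * T x =
      (C * D + pdMatrix k (jacobian τ) x)ᵀ * T' (τ x) * D := by
    rw [← hΓ, transpose_mul, hT x hx, pullback]
    simp only [mul_assoc, D]
  have hsum : ∑ c, D c k • covDerivMatrix g' T' c (τ x) =
      ∑ c, D c k • pdMatrix c T' (τ x) - Cᵀ * T' (τ x) - T' (τ x) * C := by
    simp only [C, covDerivMatrix_eq, smul_sub, Finset.sum_sub_distrib, transpose_sum,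
      transpose_smul, Finset.sum_mul, Finset.mul_sum, smul_mul, Matrix.mul_smul]
  rw [covDerivMatrix_eq, hTΓ, hΓT, hsum, pdMatrix_congr_on hΩ hx hT,
    pdMatrix_pullback hΩ hx hτ hT']
  simp only [transpose_add, transpose_mul, mul_add, add_mul, mul_sub, sub_mul, mul_assoc, D]
  abel

lemma ConcircularAt.of_pullback (hΩ : IsOpen Ω) (hx : x ∈ Ω) (hτ : ContDiffOn ℝ ∞ τ Ω)
    (hΩ' : IsOpen Ω') (hx' : τ x ∈ Ω') (hg' : ∀ a b, DifferentiableAt ℝ (fun y => g' y a b) (τ x))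
    (hT' : ∀ a b, DifferentiableAt ℝ (fun y => T' y a b) (τ x))
    (hsymm : ∀ y ∈ Ω', (g' y).IsSymm) (hdet : (g' (τ x)).det ≠ 0) (hJ : (jacobian τ x).det ≠ 0)
    (hg : ∀ y ∈ Ω, g y = pullback τ g' y) (hT : ∀ y ∈ Ω, T y = pullback τ T' y)
    (h : ConcircularAt g' T' (τ x)) : ConcircularAt g T x := by
  obtain ⟨α, hα⟩ := h
  set D := jacobian τ x
  have hgx : g x = Dᵀ * g' (τ x) * D := hg x hx
  have hgsymm : (g x).IsSymm := hg x hx ▸ pullback_isSymm (hsymm _ hx')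
  have hsum (k : Fin n) : ∑ c, D c k • covDerivMatrix g' T' c (τ x) = (1 / 2 : ℝ) •
      (vecMulVec α ((Dᵀ * g' (τ x)) k) + vecMulVec ((Dᵀ * g' (τ x)) k) α) := by
    ext a b
    simp only [covDerivMatrix, of_apply, hα, vecMulVec_apply, Matrix.add_apply, Matrix.smul_apply,
      Matrix.sum_apply, smul_eq_mul, mul_apply, transpose_apply, Finset.mul_sum, Finset.sum_mul,
      ← Finset.sum_add_distrib]
    refine Finset.sum_congr rfl fun c _ => ?_
    rw [(hsymm _ hx').apply c a, (hsymm _ hx').apply c b]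
    ring
  refine ⟨α ᵥ* D, fun i j k => ?_⟩
  have hrow : (Dᵀ * g' (τ x)) k ᵥ* D = g x k := by rw [hgx]; rfl
  have hcov : covDerivMatrix g T k x =
      (1 / 2 : ℝ) • (vecMulVec (α ᵥ* D) (g x k) + vecMulVec (g x k) (α ᵥ* D)) := by
    rw [covDerivMatrix_pullback hΩ hx hτ hΩ' hx' hg' hT' hsymm hdet hJ hg hT, hsum, ← hrow]
    simp only [Matrix.mul_smul, Matrix.smul_mul, mul_add, add_mul, mul_vecMulVec, vecMulVec_mul,
      mulVec_transpose, D]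
  have hentry := congrFun (congrFun hcov i) j
  simp only [covDerivMatrix, of_apply, Matrix.smul_apply, Matrix.add_apply, vecMulVec_apply,
    smul_eq_mul] at hentry
  rw [hentry, hgsymm.apply j k, hgsymm.apply i k]
  ring

end Transformation

end ChangeOfCoordinates

/-! ### Components of tensors in charts -/

section Charts

open Matrix

variable {n : ℕ} {M : Type*} [TopologicalSpace M] [ChartedSpace (Fin n → ℝ) M]
  {φ ψ : OpenPartialHomeomorph M (Fin n → ℝ)} {T T' : Tensor2 n M} {x : Fin n → ℝ} {p : M}

/-- A tensor as a field of bilinear forms on the model space `Fin n → ℝ`, to which all the tangent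
spaces are definitionally equal. -/
def asForm (T : Tensor2 n M) (p : M) : LinearMap.BilinForm ℝ (Fin n → ℝ) := T p

/-- The derivative at `x` of the inverse of a chart, as an endomorphism of the model space. -/
def dsymm (φ : OpenPartialHomeomorph M (Fin n → ℝ)) (x : Fin n → ℝ) :
    (Fin n → ℝ) →L[ℝ] (Fin n → ℝ) :=
  mfderiv 𝓘(ℝ, Fin n → ℝ) 𝓘(ℝ, Fin n → ℝ) φ.symm x

/-- The derivative at `p` of a chart, as an endomorphism of the model space. -/
def dchart (φ : OpenPartialHomeomorph M (Fin n → ℝ)) (p : M) :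
    (Fin n → ℝ) →L[ℝ] (Fin n → ℝ) :=
  mfderiv 𝓘(ℝ, Fin n → ℝ) 𝓘(ℝ, Fin n → ℝ) φ p

lemma IsCoord.mdifferentiable (hφ : IsCoord φ) :
    φ.MDifferentiable 𝓘(ℝ, Fin n → ℝ) 𝓘(ℝ, Fin n → ℝ) :=
  ⟨(contMDiffOn_of_mem_maximalAtlas hφ).mdifferentiableOn (by simp),
    (contMDiffOn_symm_of_mem_maximalAtlas hφ).mdifferentiableOn (by simp)⟩

lemma IsCoord.dchart_dsymm (hφ : IsCoord φ) (hx : x ∈ φ.target) (v : Fin n → ℝ) :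
    dchart φ (φ.symm x) (dsymm φ x v) = v :=
  congrArg (fun f : (Fin n → ℝ) →L[ℝ] (Fin n → ℝ) => f v) (hφ.mdifferentiable.comp_symm_deriv hx)

lemma IsCoord.dsymm_dchart (hφ : IsCoord φ) (hp : p ∈ φ.source) (v : Fin n → ℝ) :
    dsymm φ (φ p) (dchart φ p v) = v :=
  congrArg (fun f : (Fin n → ℝ) →L[ℝ] (Fin n → ℝ) => f v) (hφ.mdifferentiable.symm_comp_deriv hp)

lemma IsCoord.dsymm_surjective (hφ : IsCoord φ) (hx : x ∈ φ.target) :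
    Function.Surjective (dsymm φ x) := fun v =>
  ⟨dchart φ (φ.symm x) v, by simpa only [φ.right_inv hx] using hφ.dsymm_dchart (φ.map_target hx) v⟩

lemma comp_apply (i j : Fin n) : comp T φ x i j =
    asForm T (φ.symm x) (dsymm φ x (Pi.single i 1)) (dsymm φ x (Pi.single j 1)) := rfl

lemma asForm_dsymm (u v : Fin n → ℝ) :
    asForm T (φ.symm x) (dsymm φ x u) (dsymm φ x v) = u ⬝ᵥ comp T φ x *ᵥ v := by
  have hcomp : comp T φ x = LinearMap.BilinForm.toMatrix'
      ((asForm T (φ.symm x)).compl₁₂ (dsymm φ x).toLinearMap (dsymm φ x).toLinearMap) := rfl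
  rw [← toBilin'_apply', hcomp, toBilin'_toMatrix']
  rfl

/-- The coordinate change from `φ` to `ψ`. -/
def transition (φ ψ : OpenPartialHomeomorph M (Fin n → ℝ)) (x : Fin n → ℝ) : Fin n → ℝ :=
  ψ (φ.symm x)

lemma isOpen_overlap {M : Type*} [TopologicalSpace M] (φ ψ : OpenPartialHomeomorph M (Fin n → ℝ)) :
    IsOpen (φ.target ∩ φ.symm ⁻¹' ψ.source) :=
  φ.symm.isOpen_inter_preimage ψ.open_source

section Transition

variable (hφ : IsCoord φ) (hψ : IsCoord ψ)
include hφ hψ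

lemma contDiffOn_transition :
    ContDiffOn ℝ ∞ (transition φ ψ) (φ.target ∩ φ.symm ⁻¹' ψ.source) :=
  contMDiffOn_iff_contDiffOn.1 ((contMDiffOn_of_mem_maximalAtlas hψ).comp'
    (contMDiffOn_symm_of_mem_maximalAtlas hφ))

variable (hx : x ∈ φ.target ∩ φ.symm ⁻¹' ψ.source)
include hx

lemma differentiableAt_transition : DifferentiableAt ℝ (transition φ ψ) x :=
  differentiableAt_of_contDiffOn (contDiffOn_transition hφ hψ) (isOpen_overlap φ ψ) hx

lemma dsymm_eq_comp_fderiv_transition :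
    dsymm φ x = (dsymm ψ (transition φ ψ x)).comp (fderiv ℝ (transition φ ψ) x) := by
  have hsymm : φ.symm =ᶠ[nhds x] ψ.symm ∘ transition φ ψ := by
    filter_upwards [(isOpen_overlap φ ψ).mem_nhds hx] with y hy
    exact (ψ.left_inv hy.2).symm
  rw [← mfderiv_eq_fderiv]
  exact hsymm.mfderiv_eq.trans (mfderiv_comp x
    (hψ.mdifferentiable.mdifferentiableAt_symm (ψ.map_source hx.2))
    (differentiableAt_transition hφ hψ hx).mdifferentiableAt)

lemma fderiv_transition_apply (v : Fin n → ℝ) :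
    fderiv ℝ (transition φ ψ) x v = jacobian (transition φ ψ) x *ᵥ v := by
  have hjac : jacobian (transition φ ψ) x =
      LinearMap.toMatrix' (fderiv ℝ (transition φ ψ) x).toLinearMap := by
    ext a i
    simp [jacobian, pd, fderiv_apply (differentiableAt_transition hφ hψ hx) a,
      LinearMap.toMatrix'_apply]
  rw [hjac, LinearMap.toMatrix'_mulVec]
  rfl

lemma dsymm_apply_eq_jacobian_mulVec (v : Fin n → ℝ) :
    dsymm φ x v = dsymm ψ (transition φ ψ x) (jacobian (transition φ ψ) x *ᵥ v) := by
  rw [dsymm_eq_comp_fderiv_transition hφ hψ hx, ← fderiv_transition_apply hφ hψ hx,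
    ContinuousLinearMap.comp_apply]

lemma comp_eq_pullback : comp T φ x = pullback (transition φ ψ) (comp T ψ) x := by
  have hform (u v : Fin n → ℝ) :
      u ⬝ᵥ comp T φ x *ᵥ v = u ⬝ᵥ pullback (transition φ ψ) (comp T ψ) x *ᵥ v := by
    have hp : φ.symm x = ψ.symm (transition φ ψ x) := (ψ.left_inv hx.2).symm
    rw [← asForm_dsymm, dsymm_apply_eq_jacobian_mulVec hφ hψ hx,
      dsymm_apply_eq_jacobian_mulVec hφ hψ hx, hp, asForm_dsymm, pullback]
    simp only [← mulVec_mulVec, dotProduct_mulVec, vecMul_transpose]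
  ext i j
  simpa using hform (Pi.single i 1) (Pi.single j 1)

lemma det_jacobian_transition_ne_zero : (jacobian (transition φ ψ) x).det ≠ 0 := by
  intro hdet
  obtain ⟨v, hv, hv0⟩ := exists_mulVec_eq_zero_iff.2 hdet
  refine hv ?_
  rw [← hφ.dchart_dsymm hx.1 v, dsymm_apply_eq_jacobian_mulVec hφ hψ hx, hv0, map_zero, map_zero]

end Transition

lemma IsCoord.det_comp_ne_zero (hφ : IsCoord φ) (hx : x ∈ φ.target)
    (hT : (T (φ.symm x)).Nondegenerate) : (comp T φ x).det ≠ 0 := by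
  intro hdet
  obtain ⟨v, hv, hv0⟩ := exists_vecMul_eq_zero_iff.2 hdet
  refine hv ?_
  have hker : dsymm φ x v = 0 := by
    refine hT.1 (dsymm φ x v) fun w => ?_
    obtain ⟨u, rfl⟩ := hφ.dsymm_surjective hx w
    change asForm T (φ.symm x) (dsymm φ x v) (dsymm φ x u) = 0
    rw [asForm_dsymm, dotProduct_mulVec, hv0, zero_dotProduct]
  rw [← hφ.dchart_dsymm hx v, hker, map_zero]

/-- The tensor with components `A` in the chart `φ`, extended by junk outside the domain of `φ`. -/
def tensorOf (φ : OpenPartialHomeomorph M (Fin n → ℝ))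
    (A : (Fin n → ℝ) → Matrix (Fin n) (Fin n) ℝ) : Tensor2 n M := fun p =>
  ((toBilin' (A (φ p))).compl₁₂ (dchart φ p).toLinearMap (dchart φ p).toLinearMap :
    LinearMap.BilinForm ℝ (Fin n → ℝ))

lemma IsCoord.comp_tensorOf (hφ : IsCoord φ) (hx : x ∈ φ.target)
    (A : (Fin n → ℝ) → Matrix (Fin n) (Fin n) ℝ) : comp (tensorOf φ A) φ x = A x := by
  ext i j
  change toBilin' (A (φ (φ.symm x))) (dchart φ (φ.symm x) (dsymm φ x (Pi.single i 1)))
    (dchart φ (φ.symm x) (dsymm φ x (Pi.single j 1))) = _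
  rw [hφ.dchart_dsymm hx, hφ.dchart_dsymm hx, φ.right_inv hx, toBilin'_single]

lemma IsCoord.eq_of_comp_eq (hφ : IsCoord φ) (hp : p ∈ φ.source)
    (h : comp T φ (φ p) = comp T' φ (φ p)) : T p = T' p := by
  change asForm T p = asForm T' p
  refine LinearMap.ext fun v => LinearMap.ext fun w => ?_
  have hform := asForm_dsymm (T := T) (φ := φ) (x := φ p) (dchart φ p v) (dchart φ p w)
  rwa [h, ← asForm_dsymm, φ.left_inv hp, hφ.dsymm_dchart hp, hφ.dsymm_dchart hp] at hform

end Charts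

/-! ### Tensors given locally or in a chart -/

section Locality

open Matrix

variable {n : ℕ} {M : Type*} [TopologicalSpace M] [ChartedSpace (Fin n → ℝ) M]
  {φ ψ : OpenPartialHomeomorph M (Fin n → ℝ)} {g T T' L : Tensor2 n M} {x : Fin n → ℝ} {p : M}
  {U V : Set M} {Ω : Set (Fin n → ℝ)}

lemma comp_congr (h : T (φ.symm x) = T' (φ.symm x)) : comp T φ x = comp T' φ x := by
  ext i j
  rw [comp_apply, comp_apply, asForm, asForm, h]

lemma covDeriv_congr {G A A' : (Fin n → ℝ) → Matrix (Fin n) (Fin n) ℝ} (hΩ : IsOpen Ω)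
    (hx : x ∈ Ω) (h : ∀ y ∈ Ω, A y = A' y) (k i j : Fin n) :
    covDeriv G A k i j x = covDeriv G A' k i j x := by
  rw [covDeriv, covDeriv, h x hx, pd_congr_on hΩ hx fun y hy => by rw [h y hy]]

lemma IsSmoothSymmOn.mono (hT : IsSmoothSymmOn T U) (h : V ⊆ U) : IsSmoothSymmOn T V :=
  ⟨fun p hp => hT.1 p (h hp), fun φ hφ i j =>
    (hT.2 φ hφ i j).mono fun _ hx => ⟨hx.1, h hx.2⟩⟩

lemma IsConcircularOn.mono (hL : IsConcircularOn g L U) (h : V ⊆ U) : IsConcircularOn g L V :=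
  ⟨hL.1.mono h, fun φ hφ x hx hxV => hL.2 φ hφ x hx (h hxV)⟩

lemma isConcircularOn_of_locally (h : ∀ p ∈ U, ∃ (W : Set M) (L' : Tensor2 n M),
    IsOpen W ∧ p ∈ W ∧ IsConcircularOn g L' W ∧ ∀ q ∈ W, L q = L' q) :
    IsConcircularOn g L U := by
  refine ⟨⟨fun p hp v w => ?_, fun φ hφ i j x hx => ?_⟩, fun φ hφ x hx hxU => ?_⟩
  · obtain ⟨W, L', -, hpW, hL', hLL'⟩ := h p hp
    rw [hLL' p hpW]
    exact hL'.1.1 p hpW v w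
  · obtain ⟨W, L', hW, hpW, hL', hLL'⟩ := h _ hx.2
    have hnhds := (φ.symm.isOpen_inter_preimage hW).mem_nhds ⟨hx.1, hpW⟩
    refine (((hL'.1.2 φ hφ i j).contDiffAt hnhds).congr_of_eventuallyEq ?_).contDiffWithinAt
    filter_upwards [hnhds] with y hy
    rw [comp_congr (hLL' _ hy.2)]
  · obtain ⟨W, L', hW, hpW, hL', hLL'⟩ := h _ hxU
    obtain ⟨α, hα⟩ := hL'.2 φ hφ x hx hpW
    refine ⟨α, fun i j k => ?_⟩
    rw [← hα i j k]
    exact covDeriv_congr (φ.symm.isOpen_inter_preimage hW) ⟨hx, hpW⟩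
      (fun y hy => comp_congr (hLL' _ hy.2)) k i j

lemma IsPseudoRiemannian.contDiffOn_comp (hg : IsPseudoRiemannian g) (hφ : IsCoord φ)
    (i j : Fin n) : ContDiffOn ℝ ∞ (fun x => comp g φ x i j) φ.target := by
  simpa using hg.1.2 φ hφ i j

lemma IsPseudoRiemannian.isSymm_comp (hg : IsPseudoRiemannian g) : (comp g φ x).IsSymm :=
  .ext fun _ _ => hg.1.1 _ (mem_univ _) _ _

lemma IsCoord.asForm_comm_of_isSymm_comp (hφ : IsCoord φ) (hp : p ∈ φ.source)
    (hT : (comp T φ (φ p)).IsSymm) (v w : Fin n → ℝ) : asForm T p v w = asForm T p w v := by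
  have hform (v w : Fin n → ℝ) :
      asForm T p v w = dchart φ p v ⬝ᵥ comp T φ (φ p) *ᵥ dchart φ p w := by
    rw [← asForm_dsymm, φ.left_inv hp, hφ.dsymm_dchart hp, hφ.dsymm_dchart hp]
  rw [hform, hform, dotProduct_mulVec, ← mulVec_transpose, hT.eq, dotProduct_comm]

lemma isConcircularOn_of_chart (hg : IsPseudoRiemannian g) (hφ : IsCoord φ) (hΩ : IsOpen Ω)
    (hs : Ω ⊆ φ.target) (hsmooth : ∀ i j, ContDiffOn ℝ ∞ (fun x => comp L φ x i j) Ω)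
    (hsymm : ∀ x ∈ Ω, (comp L φ x).IsSymm)
    (hL : ∀ x ∈ Ω, ConcircularAt (comp g φ) (comp L φ) x) :
    IsConcircularOn g L (φ.source ∩ φ ⁻¹' Ω) := by
  have hopen (ψ : OpenPartialHomeomorph M (Fin n → ℝ)) :
      IsOpen (ψ.target ∩ ψ.symm ⁻¹' (φ.source ∩ φ ⁻¹' Ω)) :=
    ψ.symm.isOpen_inter_preimage (φ.isOpen_inter_preimage hΩ)
  have hsub (ψ : OpenPartialHomeomorph M (Fin n → ℝ)) :
      ψ.target ∩ ψ.symm ⁻¹' (φ.source ∩ φ ⁻¹' Ω) ⊆ ψ.target ∩ ψ.symm ⁻¹' φ.source :=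
    fun x hx => ⟨hx.1, hx.2.1⟩
  refine ⟨⟨fun p hp => hφ.asForm_comm_of_isSymm_comp hp.1 (hsymm _ hp.2), fun ψ hψ i j => ?_⟩,
    fun ψ hψ x hx hxU => ?_⟩
  · refine (contDiffOn_pullback (hopen ψ) ((contDiffOn_transition hψ hφ).mono (hsub ψ))
      (fun x hx => hx.2.2) hsmooth i j).congr fun x hx => ?_
    rw [comp_eq_pullback hψ hφ (hsub ψ hx)]
  · have hτx : transition ψ φ x ∈ Ω := hxU.2
    exact ConcircularAt.of_pullback (hopen ψ) ⟨hx, hxU⟩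
      ((contDiffOn_transition hψ hφ).mono (hsub ψ)) hΩ hτx
      (fun a b => differentiableAt_of_contDiffOn (hg.contDiffOn_comp hφ a b) φ.open_target (hs hτx))
      (fun a b => differentiableAt_of_contDiffOn (hsmooth a b) hΩ hτx)
      (fun y _ => hg.isSymm_comp) (hφ.det_comp_ne_zero (hs hτx) (hg.2 _))
      (det_jacobian_transition_ne_zero hψ hφ (hsub ψ ⟨hx, hxU⟩))
      (fun y hy => comp_eq_pullback hψ hφ (hsub ψ hy))
      (fun y hy => comp_eq_pullback hψ hφ (hsub ψ hy)) (hL _ hτx)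

lemma IsOrthogonal.orthMetric (hg : IsPseudoRiemannian g) (hφ : IsCoord φ)
    (ho : IsOrthogonal g φ) : OrthMetric (comp g φ) φ.target where
  isOpen := φ.open_target
  smooth i := hg.contDiffOn_comp hφ i i
  ne_zero i x hx hgii := by
    refine hφ.det_comp_ne_zero hx (hg.2 _) (det_eq_zero_of_row_eq_zero i fun j => ?_)
    by_cases hij : i = j
    · rw [← hij, hgii]
    · exact ho x hx i j hij
  off_diag := ho

lemma IsSeparable.sepSystem (hg : IsPseudoRiemannian g) {κ : ℝ} (hκ : HasConstantCurvature g κ)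
    (hφ : IsCoord φ) (ho : IsOrthogonal g φ) (hs : IsSeparable g φ) :
    SepSystem κ (diagOf (comp g φ)) φ.target := by
  have hG := ho.orthMetric hg hφ
  refine hG.sepSystem (fun x hx => ?_) (hκ φ hφ)
  obtain ⟨V, C, W, E, hV, hxV, hVs, hC, hCn, hW, hHJ⟩ := hs x hx
  exact (hG.mono hV hVs).leviCivitaAt_of_separable hC hCn hW
    (fun x hx c hc => (hHJ x hx c hc).1) (fun c hc => (hHJ x hxV c hc).2) hxV

theorem IsSeparable.hasConcircularForm (hg : IsPseudoRiemannian g) {κ : ℝ}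
    (hκ : HasConstantCurvature g κ) (hφ : IsCoord φ) (ho : IsOrthogonal g φ)
    (hs : IsSeparable g φ) {J : Fin n → Set ℝ} (hJ : IsBox J) (hJs : univ.pi J ⊆ φ.target) :
    HasConcircularForm (comp g φ) J := by
  by_cases hn : 1 < n
  · exact SepSystem.hasConcircularForm hJ ((hs.sepSystem hg hκ hφ ho).mono hJ.isOpen hJs) hn
      fun x hx => ho x (hJs hx)
  · exact hasConcircularForm_of_subsingleton hn fun i j => (hg.contDiffOn_comp hφ i j).mono hJs

end Locality

/-! ### Charts that diagonalize a characteristic Killing tensor -/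

section Adapted

open Matrix

variable {n : ℕ} {M : Type*} [TopologicalSpace M] [ChartedSpace (Fin n → ℝ) M]
  {φ : OpenPartialHomeomorph M (Fin n → ℝ)} {g K L L' T : Tensor2 n M} {x u l l' : Fin n → ℝ}
  {p : M} {κ μ : ℝ}

/-- The eigenspace as a subspace of the model space `Fin n → ℝ`, to which the tangent space is
definitionally equal. -/
def eigModel (g T : Tensor2 n M) (p : M) (μ : ℝ) : Submodule ℝ (Fin n → ℝ) :=
  LinearMap.ker (asForm T p - μ • asForm g p)

lemma IsCoord.dsymm_mem_eigModel_iff (hφ : IsCoord φ) (hx : x ∈ φ.target) :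
    dsymm φ x u ∈ eigModel g T (φ.symm x) μ ↔ u ᵥ* (comp T φ x - μ • comp g φ x) = 0 := by
  have hker : dsymm φ x u ∈ eigModel g T (φ.symm x) μ ↔ ∀ w, asForm T (φ.symm x) (dsymm φ x u) w -
      μ * asForm g (φ.symm x) (dsymm φ x u) w = 0 := LinearMap.ext_iff
  have hform (v : Fin n → ℝ) : asForm T (φ.symm x) (dsymm φ x u) (dsymm φ x v) -
      μ * asForm g (φ.symm x) (dsymm φ x u) (dsymm φ x v) =
        u ᵥ* (comp T φ x - μ • comp g φ x) ⬝ᵥ v := by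
    rw [asForm_dsymm, asForm_dsymm, vecMul_sub, sub_dotProduct, vecMul_smul, smul_dotProduct,
      ← dotProduct_mulVec, ← dotProduct_mulVec, smul_eq_mul]
  rw [hker, (hφ.dsymm_surjective hx).forall]
  simp only [hform]
  exact dotProduct_eq_zero_iff

lemma injective_of_eigenvalues {G A : Matrix (Fin n) (Fin n) ℝ} (hG : G.det ≠ 0)
    {m ν : Fin n → ℝ} (hA : A = diagonal m * G) (hν : Function.Injective ν)
    (h : ∀ k, ∃ u : Fin n → ℝ, u ≠ 0 ∧ u ᵥ* (A - ν k • G) = 0) : Function.Injective m := by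
  have hex (k : Fin n) : ∃ i, m i = ν k := by
    obtain ⟨u, hu, huA⟩ := h k
    have hfactor : A - ν k • G = diagonal (fun i => m i - ν k) * G := by
      rw [hA, smul_eq_diagonal_mul, ← sub_mul, diagonal_sub]
    rw [hfactor, ← vecMul_vecMul] at huA
    obtain ⟨i, hi⟩ := Function.ne_iff.1 hu
    have hui := congrFun (eq_zero_of_vecMul_eq_zero hG huA) i
    rw [vecMul_diagonal] at hui
    exact ⟨i, sub_eq_zero.1 ((mul_eq_zero.1 hui).resolve_left hi)⟩
  choose s hs using hex
  have hsν : m ∘ s = ν := funext hs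
  have hsI : Function.Injective s := (hsν ▸ hν).of_comp
  exact (hsν ▸ hν : Function.Injective (m ∘ s)).of_comp_right
    (Finite.surjective_of_injective hsI)

lemma apply_eq_zero_of_diagonal_mul_isSymm {G : Matrix (Fin n) (Fin n) ℝ} {m : Fin n → ℝ}
    (hG : G.IsSymm) (hmG : (diagonal m * G).IsSymm) {i j : Fin n} (hij : m i ≠ m j) :
    G i j = 0 := by
  have hcomm := hmG.apply i j
  rw [diagonal_mul, diagonal_mul, hG.apply] at hcomm
  exact (mul_eq_mul_right_iff.1 hcomm).resolve_left hij.symm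

/-- `φ` is a chart in which `g` and `K` are diagonal, the eigenvalues of `K` are distinct and `g`
satisfies the separability and curvature equations. -/
structure AdaptedChart (κ : ℝ) (g K : Tensor2 n M) (φ : OpenPartialHomeomorph M (Fin n → ℝ)) :
    Prop where
  coord : IsCoord φ
  orth : OrthMetric (comp g φ) φ.target
  sep : SepSystem κ (diagOf (comp g φ)) φ.target
  eig : ∀ x ∈ φ.target, ∃ m : Fin n → ℝ, Function.Injective m ∧
    IsDiagAt (comp g φ) (comp K φ) m x

lemma IsCoord.exists_comp_eq_diagonal_mul (hφ : IsCoord φ) (hx : x ∈ φ.target)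
    (hg : (g (φ.symm x)).Nondegenerate)
    (hdist : ∃ ν : Fin n → ℝ, Function.Injective ν ∧ ∀ i, eigSpace g K (φ.symm x) (ν i) ≠ ⊥)
    (hcoord : ∀ i, ∃ μ : ℝ, coordVec φ x i ∈ eigSpace g K (φ.symm x) μ) :
    ∃ m : Fin n → ℝ, Function.Injective m ∧ comp K φ x = diagonal m * comp g φ x := by
  choose m hm using hcoord
  have hdiag : comp K φ x = diagonal m * comp g φ x := by
    ext i j
    have hrow := congrFun ((hφ.dsymm_mem_eigModel_iff hx).1 (hm i)) j
    rw [single_one_vecMul] at hrow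
    rw [diagonal_mul]
    exact sub_eq_zero.1 hrow
  obtain ⟨ν, hν, hne⟩ := hdist
  refine ⟨m, injective_of_eigenvalues (hφ.det_comp_ne_zero hx hg) hdiag hν fun k => ?_, hdiag⟩
  obtain ⟨v, hv, hv0⟩ := Submodule.exists_mem_ne_zero_of_ne_bot (hne k)
  obtain ⟨u, rfl⟩ := hφ.dsymm_surjective hx v
  exact ⟨u, fun hu => hv0 (by rw [hu]; exact map_zero _), (hφ.dsymm_mem_eigModel_iff hx).1 hv⟩

lemma IsCharacteristicKilling.exists_adaptedChart (hg : IsPseudoRiemannian g)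
    (hκ : HasConstantCurvature g κ) (hK : IsCharacteristicKilling g K) (p : M) :
    ∃ φ, AdaptedChart κ g K φ ∧ p ∈ φ.source := by
  obtain ⟨hKil, hdist, hdiag⟩ := hK
  obtain ⟨φ, hφ, hp, hcoord⟩ := hdiag p
  have hm (x) (hx : x ∈ φ.target) := hφ.exists_comp_eq_diagonal_mul hx (hg.2 _) (hdist _)
    (hcoord x hx)
  have ho : IsOrthogonal g φ := fun x hx i j hij => by
    obtain ⟨m, hmI, hm⟩ := hm x hx
    exact apply_eq_zero_of_diagonal_mul_isSymm hg.isSymm_comp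
      (hm ▸ .ext fun i j => hKil.1.1 _ (mem_univ _) _ _) (hmI.ne hij)
  have hG := ho.orthMetric hg hφ
  let m (i : Fin n) (x : Fin n → ℝ) := comp K φ x i i / comp g φ x i i
  have hmdiag (x) (hx : x ∈ φ.target) : Function.Injective (fun i => m i x) ∧
      IsDiagAt (comp g φ) (comp K φ) (fun i => m i x) x := by
    obtain ⟨m', hm'I, hm'⟩ := hm x hx
    have hmm' : (fun i => m i x) = m' := by
      ext i
      simp only [m, hm', diagonal_mul, mul_div_cancel_right₀ _ (hG.ne_zero i x hx)]
    rw [hmm']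
    refine ⟨hm'I, fun i j => ?_⟩
    rw [hm', diagonal_mul]
    split_ifs with hij
    · rw [hij]
    · rw [ho x hx i j hij, mul_zero]
  have hmsmooth (i : Fin n) : ContDiffOn ℝ ∞ (m i) φ.target :=
    .div (by simpa using hKil.1.2 φ hφ i i) (hG.smooth i) (hG.ne_zero i)
  exact ⟨φ, ⟨hφ, hG, hG.sepSystem (fun x hx => hG.leviCivitaAt_of_killing (hmdiag x hx).1 hmsmooth
    (fun x hx => (hmdiag x hx).2) (hKil.2 φ hφ) hx) (hκ φ hφ),
    fun x hx => ⟨_, hmdiag x hx⟩⟩, hp⟩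

/-- At `p` each eigenspace of `L` is contained in an eigenspace of `L'`. -/
def FinerAt (g L L' : Tensor2 n M) (p : M) : Prop :=
  ∀ μ : ℝ, ∃ ν : ℝ, eigSpace g L p μ ≤ eigSpace g L' p ν

namespace AdaptedChart

variable (H : AdaptedChart κ g K φ) (hx : x ∈ φ.target)
include H hx

lemma eq_diagonal_mul (hl : IsDiagAt (comp g φ) (comp T φ) l x) :
    comp T φ x = diagonal l * comp g φ x := by
  ext i j
  rw [hl, diagonal_mul]
  split_ifs with hij
  · rw [hij]
  · rw [H.orth.off_diag x hx i j hij, mul_zero]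

lemma dsymm_mem_eigModel_iff (hl : IsDiagAt (comp g φ) (comp T φ) l x) :
    dsymm φ x u ∈ eigModel g T (φ.symm x) μ ↔ ∀ j, u j = 0 ∨ l j = μ := by
  have hdiag : comp T φ x - μ • comp g φ x =
      diagonal fun i => (l i - μ) * comp g φ x i i := by
    ext i j
    rw [Matrix.sub_apply, Matrix.smul_apply, hl, diagonal_apply, smul_eq_mul]
    split_ifs with hij
    · rw [hij, sub_mul]
    · rw [H.orth.off_diag x hx i j hij, mul_zero, sub_zero]
  rw [H.coord.dsymm_mem_eigModel_iff hx, hdiag, funext_iff]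
  simp only [vecMul_diagonal, Pi.zero_apply, mul_eq_zero, H.orth.ne_zero _ x hx, or_false,
    sub_eq_zero]

lemma dsymm_single_mem_eigModel_iff (hl : IsDiagAt (comp g φ) (comp T φ) l x) {i : Fin n} :
    dsymm φ x (Pi.single i 1) ∈ eigModel g T (φ.symm x) μ ↔ l i = μ := by
  rw [H.dsymm_mem_eigModel_iff hx hl]
  refine ⟨fun h => (h i).resolve_left (by simp), fun hi j => ?_⟩
  by_cases hij : j = i
  · exact .inr (hij ▸ hi)
  · exact .inl (Pi.single_eq_of_ne hij 1)

lemma exists_isDiagAt_of_leavesInvariant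
    (hL : LeavesEigenspacesInvariantOn g K L {φ.symm x}) :
    ∃ l, IsDiagAt (comp g φ) (comp L φ) l x := by
  obtain ⟨m, hmI, hm⟩ := H.eig x hx
  have hrow (i : Fin n) : ∃ l : ℝ, ∀ j, comp L φ x i j = l * comp g φ x i j := by
    obtain ⟨u, hu, hLu⟩ := hL _ rfl (m i) _ ((H.dsymm_single_mem_eigModel_iff hx hm).2 rfl)
    obtain ⟨c, rfl⟩ := H.coord.dsymm_surjective hx u
    have hc : c = c i • Pi.single i 1 := by
      ext a
      by_cases ha : a = i
      · simp [ha]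
      · rw [((H.dsymm_mem_eigModel_iff hx hm).1 hu a).resolve_right (hmI.ne ha)]
        simp [ha]
    refine ⟨c i, fun j => ?_⟩
    have hLj : asForm L (φ.symm x) (dsymm φ x (Pi.single i 1)) (dsymm φ x (Pi.single j 1)) =
      asForm g (φ.symm x) (dsymm φ x c) (dsymm φ x (Pi.single j 1)) := hLu _
    rwa [hc, map_smul, map_smul, LinearMap.smul_apply, smul_eq_mul] at hLj
  choose l hl using hrow
  refine ⟨l, fun i j => ?_⟩
  split_ifs with hij
  · rw [hl, hij]
  · rw [hl, H.orth.off_diag x hx i j hij, mul_zero]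

lemma leavesInvariant_of_isDiagAt (hl : IsDiagAt (comp g φ) (comp L φ) l x) :
    LeavesEigenspacesInvariantOn g K L {φ.symm x} := by
  obtain ⟨m, -, hm⟩ := H.eig x hx
  rintro _ rfl μ v hv
  obtain ⟨c, rfl⟩ := H.coord.dsymm_surjective hx v
  refine ⟨dsymm φ x (c ᵥ* diagonal l), (H.dsymm_mem_eigModel_iff hx hm).2 fun j => ?_, fun w => ?_⟩
  · refine ((H.dsymm_mem_eigModel_iff hx hm).1 hv j).imp_left fun hcj => ?_
    rw [vecMul_diagonal, hcj, zero_mul]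
  · obtain ⟨d, rfl⟩ := H.coord.dsymm_surjective hx w
    change asForm L (φ.symm x) (dsymm φ x c) (dsymm φ x d) =
      asForm g (φ.symm x) (dsymm φ x (c ᵥ* diagonal l)) (dsymm φ x d)
    rw [asForm_dsymm, asForm_dsymm, H.eq_diagonal_mul hx hl, dotProduct_mulVec, dotProduct_mulVec,
      vecMul_vecMul]

lemma leavesInvariant_iff : LeavesEigenspacesInvariantOn g K L {φ.symm x} ↔
    ∃ l, IsDiagAt (comp g φ) (comp L φ) l x :=
  ⟨H.exists_isDiagAt_of_leavesInvariant hx, fun ⟨_, hl⟩ => H.leavesInvariant_of_isDiagAt hx hl⟩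

lemma finerAt_iff (hl : IsDiagAt (comp g φ) (comp L φ) l x)
    (hl' : IsDiagAt (comp g φ) (comp L' φ) l' x) :
    FinerAt g L L' (φ.symm x) ↔ ∀ i j, l i = l j → l' i = l' j := by
  constructor
  · intro h i j hij
    obtain ⟨ν, hν⟩ := h (l i)
    have hl'ν (k : Fin n) (hk : l k = l i) : l' k = ν :=
      (H.dsymm_single_mem_eigModel_iff hx hl').1
        (hν ((H.dsymm_single_mem_eigModel_iff hx hl).2 hk))
    rw [hl'ν i rfl, hl'ν j hij.symm]
  · intro h μ
    suffices ∃ ν, ∀ j, l j = μ → l' j = ν by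
      obtain ⟨ν, hν⟩ := this
      refine ⟨ν, fun v hv => ?_⟩
      obtain ⟨c, rfl⟩ := H.coord.dsymm_surjective hx v
      exact (H.dsymm_mem_eigModel_iff hx hl').2 fun j =>
        ((H.dsymm_mem_eigModel_iff hx hl).1 hv j).imp_right (hν j)
    by_cases hμ : ∃ i, l i = μ
    · obtain ⟨i, rfl⟩ := hμ
      exact ⟨l' i, fun j hj => h j i hj⟩
    · exact ⟨0, fun j hj => (hμ ⟨j, hj⟩).elim⟩

end AdaptedChart

end Adapted

/-! ### Concircular tensors adapted to a characteristic Killing tensor -/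

section DiagonalConcircular

variable {n : ℕ} {G T : (Fin n → ℝ) → Matrix (Fin n) (Fin n) ℝ} {Ω : Set (Fin n → ℝ)}
  {x : Fin n → ℝ} {κ : ℝ} {J : Fin n → Set ℝ} {lam : Fin n → ℝ → ℝ}

lemma OrthMetric.isDiagAt_self (hG : OrthMetric G Ω) (hx : x ∈ Ω) :
    IsDiagAt G G (fun _ => 1) x := by
  intro i j
  split_ifs with hij
  · rw [one_mul, hij]
  · exact hG.off_diag x hx i j hij

lemma OrthMetric.concircularAt_self (hG : OrthMetric G Ω) (hx : x ∈ Ω) : ConcircularAt G G x :=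
  ⟨_, hG.concircular_of_diag (m := fun _ _ => 1) (fun _ hy => hG.isDiagAt_self hy) hx
    (fun _ => differentiableAt_const _) (fun _ _ _ => pd_const _ _)
    fun _ _ _ => by rw [pd_const, sub_self, zero_mul]⟩

lemma OrthMetric.exists_isSol_of_concircularAt (hJ : IsBox J) (hG : OrthMetric G (univ.pi J))
    {m : Fin n → (Fin n → ℝ) → ℝ} (hm : ∀ i, ContDiffOn ℝ ∞ (m i) (univ.pi J))
    (hT : ∀ x ∈ univ.pi J, IsDiagAt G T (fun i => m i x) x)
    (hc : ∀ x ∈ univ.pi J, ConcircularAt G T x) :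
    ∃ lam, IsSol (diagOf G) J lam ∧ ∀ x ∈ univ.pi J, ∀ i, lam i (x i) = m i x := by
  have hmd (i : Fin n) (x) (hx : x ∈ univ.pi J) : DifferentiableAt ℝ (m i) x :=
    differentiableAt_of_contDiffOn (hm i) hJ.isOpen hx
  have hpd (x) (hx : x ∈ univ.pi J) : (∀ i k, i ≠ k → pd k (m i) x = 0) ∧
      ∀ i j, i ≠ j → pd j (m j) x = (m j x - m i x) * logPd (diagOf G) i j x :=
    let ⟨_, hα⟩ := hc x hx
    hG.diag_of_concircular hT hx (fun i => hmd i x hx) hα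
  obtain ⟨x₀, hx₀⟩ := hJ.nonempty
  have hm_update (i : Fin n) (x) (hx : x ∈ univ.pi J) :
      m i (Function.update x₀ i (x i)) = m i x := by
    refine eq_of_pd_eq_zero hJ (hmd i) (Finset.univ.erase i)
      (fun k hk y hy => (hpd y hy).1 i k (Finset.ne_of_mem_erase hk).symm)
      (update_mem_box hx₀ (hx i (mem_univ i))) hx fun k hk => ?_
    have hki : k = i := by simpa using hk
    rw [hki, Function.update_self]
  refine ⟨fun i t => m i (Function.update x₀ i t), fun x hx i j hij => ?_,
    fun x hx i => hm_update i x hx⟩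
  simp only [hm_update j x hx, hm_update i x hx]
  rw [← (hpd x hx).2 i j hij]
  refine (hasDerivAt_comp_update_self (hmd j x hx) j).congr_of_eventuallyEq ?_
  filter_upwards [(hJ j).1.mem_nhds (hx j (mem_univ j))] with s hs
  simpa only [Function.update_self] using hm_update j _ (update_mem_box hx hs)

lemma IsSol.contDiffOn_eval (hlam : IsSol (diagOf G) J lam) (hJ : IsBox J)
    (hsep : SepSystem κ (diagOf G) (univ.pi J)) (hn : 1 < n) (i : Fin n) :
    ContDiffOn ℝ ∞ (fun x : Fin n → ℝ => lam i (x i)) (univ.pi J) :=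
  (hlam.contDiffOn hJ hsep hn i).comp (contDiff_apply ℝ ℝ i).contDiffOn
    fun _ hx => hx i (mem_univ i)

lemma OrthMetric.concircularAt_of_isSol (hJ : IsBox J) (hG : OrthMetric G (univ.pi J))
    (hsep : SepSystem κ (diagOf G) (univ.pi J)) (hn : 1 < n) (hlam : IsSol (diagOf G) J lam)
    (hT : ∀ x ∈ univ.pi J, IsDiagAt G T (fun i => lam i (x i)) x) (hx : x ∈ univ.pi J) :
    ConcircularAt G T x := by
  have hd (i : Fin n) : DifferentiableAt ℝ (fun y : Fin n → ℝ => lam i (y i)) x :=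
    differentiableAt_of_contDiffOn (hlam.contDiffOn_eval hJ hsep hn i) hJ.isOpen hx
  refine ⟨_, hG.concircular_of_diag (m := fun i y => lam i (y i)) hT hx hd
    (fun i k hik => ?_) fun i j hij => ?_⟩
  · rw [pd_comp_eval (hd i), if_neg hik.symm]
  · rw [pd_comp_eval (hd j), if_pos rfl, (hlam x hx i j hij).deriv]

end DiagonalConcircular

section ChartBox

variable {n : ℕ} {M : Type*} [TopologicalSpace M] {φ : OpenPartialHomeomorph M (Fin n → ℝ)}
  {J : Fin n → Set ℝ} {x : Fin n → ℝ}

/-- The part of the domain of `φ` with coordinates in the box `univ.pi J`. -/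
def chartBox (φ : OpenPartialHomeomorph M (Fin n → ℝ)) (J : Fin n → Set ℝ) : Set M :=
  φ.source ∩ φ ⁻¹' univ.pi J

lemma IsBox.isOpen_chartBox (hJ : IsBox J) : IsOpen (chartBox φ J) :=
  φ.isOpen_inter_preimage hJ.isOpen

lemma symm_mem_chartBox (hJs : univ.pi J ⊆ φ.target) (hx : x ∈ univ.pi J) :
    φ.symm x ∈ chartBox φ J :=
  ⟨φ.map_target (hJs hx), by rwa [mem_preimage, φ.right_inv (hJs hx)]⟩

end ChartBox

section Admissible

variable {n : ℕ} {M : Type*} [TopologicalSpace M] [ChartedSpace (Fin n → ℝ) M]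
  {φ : OpenPartialHomeomorph M (Fin n → ℝ)} {g K L L' : Tensor2 n M} {x : Fin n → ℝ} {p q : M}
  {U W : Set M} {κ : ℝ} {J : Fin n → Set ℝ} {lam mu : Fin n → ℝ → ℝ}

/-- Near `p` the tensor `L` is concircular and leaves the eigenspaces of `K` invariant. -/
def AdmissibleAt (g K L : Tensor2 n M) (p : M) : Prop :=
  ∃ W, IsOpen W ∧ p ∈ W ∧ IsConcircularOn g L W ∧ LeavesEigenspacesInvariantOn g K L W

lemma isOpen_admissibleAt : IsOpen {p | AdmissibleAt g K L p} := by
  rw [isOpen_iff_forall_mem_open]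
  rintro p ⟨W, hW, hp, hL⟩
  exact ⟨W, fun q hq => ⟨W, hW, hq, hL⟩, hW, hp⟩

lemma AdmissibleAt.congr (h : AdmissibleAt g K L p) (hW : IsOpen W) (hp : p ∈ W)
    (he : ∀ q ∈ W, L' q = L q) : AdmissibleAt g K L' p := by
  obtain ⟨W', hW', hp', hc, hi⟩ := h
  refine ⟨W ∩ W', hW.inter hW', ⟨hp, hp'⟩, ?_, fun q hq => ?_⟩
  · exact isConcircularOn_of_locally fun q hq => ⟨W ∩ W', L, hW.inter hW', hq,
      hc.mono inter_subset_right, fun r hr => he r hr.1⟩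
  · rw [he q hq.1]
    exact hi q hq.2

lemma isConcircularOn_of_admissibleAt (h : ∀ p ∈ U, AdmissibleAt g K L p) :
    IsConcircularOn g L U :=
  isConcircularOn_of_locally fun p hp =>
    let ⟨W, hW, hpW, hc, _⟩ := h p hp
    ⟨W, L, hW, hpW, hc, fun _ _ => rfl⟩

lemma leavesEigenspacesInvariantOn_of_admissibleAt (h : ∀ p ∈ U, AdmissibleAt g K L p) :
    LeavesEigenspacesInvariantOn g K L U :=
  fun p hp => let ⟨_, _, hpW, _, hi⟩ := h p hp; hi p hpW

/-- `L` is diagonal on a box of the chart `φ`, its `i`-th eigenvalue being the function `lam i` of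
the `i`-th coordinate. -/
def IsDiagOn (g L : Tensor2 n M) (φ : OpenPartialHomeomorph M (Fin n → ℝ)) (J : Fin n → Set ℝ)
    (lam : Fin n → ℝ → ℝ) : Prop :=
  ∀ x ∈ univ.pi J, IsDiagAt (comp g φ) (comp L φ) (fun i => lam i (x i)) x

lemma IsDiagOn.contDiffOn_comp (hL : IsDiagOn g L φ J lam)
    (hG : OrthMetric (comp g φ) (univ.pi J))
    (hlam : ∀ i, ContDiffOn ℝ ∞ (fun x : Fin n → ℝ => lam i (x i)) (univ.pi J)) (i j : Fin n) :
    ContDiffOn ℝ ∞ (fun x => comp L φ x i j) (univ.pi J) := by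
  refine ContDiffOn.congr (f := fun x => if i = j then lam i (x i) * comp g φ x i i else 0) ?_
    fun x hx => hL x hx i j
  split_ifs
  · exact (hlam i).mul (hG.smooth i)
  · exact contDiffOn_const

lemma IsDiagOn.isSymm_comp (hL : IsDiagOn g L φ J lam) (hx : x ∈ univ.pi J) :
    (comp L φ x).IsSymm := by
  refine .ext fun i j => ?_
  rw [hL x hx, hL x hx]
  by_cases hij : i = j
  · rw [hij]
  · rw [if_neg hij, if_neg (Ne.symm hij)]

lemma IsDiagOn.eq (hL : IsDiagOn g L φ J lam) (hL' : IsDiagOn g L' φ J mu) (hφ : IsCoord φ)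
    (h : ∀ i, EqOn (lam i) (mu i) (J i)) (hp : p ∈ chartBox φ J) : L p = L' p := by
  refine hφ.eq_of_comp_eq hp.1 ?_
  ext i j
  rw [hL _ hp.2, hL' _ hp.2]
  simp only [h i (hp.2 i (mem_univ i))]

lemma IsCoord.isDiagOn_tensorOf (hφ : IsCoord φ) (hJs : univ.pi J ⊆ φ.target)
    (lam : Fin n → ℝ → ℝ) :
    IsDiagOn g (tensorOf φ fun x => Matrix.diagonal fun i => lam i (x i) * comp g φ x i i) φ J
      lam := by
  intro x hx i j
  rw [hφ.comp_tensorOf (hJs hx), Matrix.diagonal_apply]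

namespace AdaptedChart

variable (H : AdaptedChart κ g K φ) (hJ : IsBox J) (hJs : univ.pi J ⊆ φ.target)
include H hJ hJs

lemma exists_isSol (hL : ∀ q ∈ chartBox φ J, AdmissibleAt g K L q) :
    ∃ lam, IsSol (diagOf (comp g φ)) J lam ∧ IsDiagOn g L φ J lam := by
  have hG := H.orth.mono hJ.isOpen hJs
  have hc := isConcircularOn_of_admissibleAt hL
  have hi := leavesEigenspacesInvariantOn_of_admissibleAt hL
  have hmem (x) (hx : x ∈ univ.pi J) : φ.symm x ∈ chartBox φ J := symm_mem_chartBox hJs hx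
  let m (i : Fin n) (x : Fin n → ℝ) : ℝ := comp L φ x i i / comp g φ x i i
  have hmsmooth (i : Fin n) : ContDiffOn ℝ ∞ (m i) (univ.pi J) :=
    .div ((hc.1.2 φ H.coord i i).mono fun x hx => ⟨hJs hx, hmem x hx⟩) (hG.smooth i)
      (hG.ne_zero i)
  have hmdiag (x) (hx : x ∈ univ.pi J) :
      IsDiagAt (comp g φ) (comp L φ) (fun i => m i x) x := by
    obtain ⟨l, hl⟩ := (H.leavesInvariant_iff (hJs hx)).1
      fun q hq => hi q (mem_singleton_iff.1 hq ▸ hmem x hx)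
    have hml : (fun i => m i x) = l := by
      ext i
      simp only [m]
      rw [hl, if_pos rfl, mul_div_cancel_right₀ _ (hG.ne_zero i x hx)]
    rwa [hml]
  obtain ⟨lam, hlam, hlam_eq⟩ := hG.exists_isSol_of_concircularAt hJ hmsmooth hmdiag
    fun x hx => hc.2 φ H.coord x (hJs hx) (hmem x hx)
  refine ⟨lam, hlam, fun x hx => ?_⟩
  simpa only [hlam_eq x hx] using hmdiag x hx

lemma admissibleAt_of_isSol (hg : IsPseudoRiemannian g) (hn : 1 < n)
    (hlam : IsSol (diagOf (comp g φ)) J lam) (hL : IsDiagOn g L φ J lam)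
    (hp : p ∈ chartBox φ J) : AdmissibleAt g K L p := by
  have hG := H.orth.mono hJ.isOpen hJs
  have hsep := H.sep.mono hJ.isOpen hJs
  refine ⟨chartBox φ J, hJ.isOpen_chartBox, hp, ?_, fun q hq => ?_⟩
  · exact isConcircularOn_of_chart hg H.coord hJ.isOpen hJs
      (hL.contDiffOn_comp hG (hlam.contDiffOn_eval hJ hsep hn)) (fun x hx => hL.isSymm_comp hx)
      fun x hx => hG.concircularAt_of_isSol hJ hsep hn hlam hL hx
  · have hinv := (H.leavesInvariant_iff (hJs hq.2)).2 ⟨_, hL _ hq.2⟩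
    rw [φ.left_inv hq.1] at hinv
    exact hinv q rfl

lemma exists_extension (hg : IsPseudoRiemannian g) (hn : 1 < n) (hp : p ∈ chartBox φ J)
    (hL : AdmissibleAt g K L p) :
    ∃ L', (∀ q ∈ chartBox φ J, AdmissibleAt g K L' q) ∧
      ∃ W, IsOpen W ∧ p ∈ W ∧ ∀ q ∈ W, L' q = L q := by
  have hopen : IsOpen (univ.pi J ∩ (φ.target ∩ φ.symm ⁻¹' {q | AdmissibleAt g K L q})) :=
    hJ.isOpen.inter (φ.symm.isOpen_inter_preimage isOpen_admissibleAt)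
  obtain ⟨J', hJ', hpJ', hs⟩ := exists_box_subset hopen (x := φ p)
    ⟨hp.2, φ.map_source hp.1, by rwa [mem_preimage, φ.left_inv hp.1]⟩
  have hJs' : univ.pi J' ⊆ φ.target := fun x hx => (hs hx).2.1
  obtain ⟨lam, hlam, hdiag⟩ := H.exists_isSol hJ' hJs' fun q hq => by
    have hadm : AdmissibleAt g K L (φ.symm (φ q)) := (hs hq.2).2.2
    rwa [φ.left_inv hq.1] at hadm
  obtain ⟨mu, hmu, he⟩ := hlam.extend hJ (H.sep.mono hJ.isOpen hJs) hn hJ'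
    (hJ'.subset_of_pi_subset fun x hx => (hs hx).1)
  exact ⟨_, fun q hq =>
      H.admissibleAt_of_isSol hJ hJs hg hn hmu (H.coord.isDiagOn_tensorOf hJs mu) hq,
    chartBox φ J', hJ'.isOpen_chartBox, ⟨hp.1, hpJ'⟩,
    fun q hq => (H.coord.isDiagOn_tensorOf hJs' mu).eq hdiag H.coord he hq⟩

lemma eqOn_of_eq (hn : 1 < n) (hL : ∀ q ∈ chartBox φ J, AdmissibleAt g K L q)
    (hL' : ∀ q ∈ chartBox φ J, AdmissibleAt g K L' q) (hp : p ∈ chartBox φ J)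
    (he : L p = L' p) (hq : q ∈ chartBox φ J) : L q = L' q := by
  obtain ⟨lam, hlam, hd⟩ := H.exists_isSol hJ hJs hL
  obtain ⟨mu, hmu, hd'⟩ := H.exists_isSol hJ hJs hL'
  have heq (i : Fin n) : lam i (φ p i) - mu i (φ p i) = 0 := by
    have hcomp : comp L φ (φ p) = comp L' φ (φ p) := comp_congr (by rw [φ.left_inv hp.1, he])
    have hii := congrFun₂ hcomp i i
    rw [hd _ hp.2, hd' _ hp.2, if_pos rfl, if_pos rfl] at hii
    exact sub_eq_zero.2 (mul_right_cancel₀ (H.orth.ne_zero i _ (hJs hp.2)) hii)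
  exact hd.eq hd' H.coord (fun i t ht => sub_eq_zero.1
    ((hlam.sub hmu).eq_zero hJ (H.sep.mono hJ.isOpen hJs) hn hp.2 heq i ht)) hq

lemma finerAt_of_finerAt (hL : ∀ q ∈ chartBox φ J, AdmissibleAt g K L q)
    (hL' : ∀ q ∈ chartBox φ J, AdmissibleAt g K L' q) (hp : p ∈ chartBox φ J)
    (hf : FinerAt g L L' p) (hq : q ∈ chartBox φ J) : FinerAt g L L' q := by
  obtain ⟨lam, hlam, hd⟩ := H.exists_isSol hJ hJs hL
  obtain ⟨mu, hmu, hd'⟩ := H.exists_isSol hJ hJs hL'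
  have hsep := H.sep.mono hJ.isOpen hJs
  rw [← φ.left_inv hp.1, H.finerAt_iff (hJs hp.2) (hd _ hp.2) (hd' _ hp.2)] at hf
  rw [← φ.left_inv hq.1, H.finerAt_iff (hJs hq.2) (hd _ hq.2) (hd' _ hq.2)]
  intro i j hij
  exact hmu.eq_of_eq hJ hsep hp.2 (hf i j (hlam.eq_of_eq hJ hsep hq.2 hij hp.2)) hq.2

end AdaptedChart

lemma IsCharacteristicKilling.exists_adapted_chartBox (hg : IsPseudoRiemannian g)
    (hκ : HasConstantCurvature g κ) (hK : IsCharacteristicKilling g K) (hU : IsOpen U)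
    (hp : p ∈ U) :
    ∃ φ J, AdaptedChart κ g K φ ∧ IsBox J ∧ univ.pi J ⊆ φ.target ∧ p ∈ chartBox φ J ∧
      chartBox φ J ⊆ U := by
  obtain ⟨φ, H, hpφ⟩ := hK.exists_adaptedChart hg hκ p
  obtain ⟨J, hJ, hpJ, hs⟩ := exists_box_subset (φ.symm.isOpen_inter_preimage hU) (x := φ p)
    ⟨φ.map_source hpφ, by rwa [mem_preimage, φ.left_inv hpφ]⟩
  refine ⟨φ, J, H, hJ, fun x hx => (hs hx).1, ⟨hpφ, hpJ⟩, fun q hq => ?_⟩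
  simpa only [mem_preimage, φ.left_inv hq.1] using (hs hq.2).2

lemma finerAt_of_isPreconnected (hg : IsPseudoRiemannian g) (hκ : HasConstantCurvature g κ)
    (hK : IsCharacteristicKilling g K) (hU : IsOpen U) (hUc : IsPreconnected U)
    (hL : ∀ q ∈ U, AdmissibleAt g K L q) (hL' : ∀ q ∈ U, AdmissibleAt g K L' q) (hp : p ∈ U)
    (hf : FinerAt g L L' p) (hq : q ∈ U) : FinerAt g L L' q := by
  refine hUc.induction₂' (fun a b => FinerAt g L L' a → FinerAt g L L' b) (fun a ha => ?_)
    (fun a b c _ _ _ hab hbc h => hbc (hab h)) hp hq hf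
  obtain ⟨φ, J, H, hJ, hJs, haJ, hs⟩ := hK.exists_adapted_chartBox hg hκ hU ha
  have hbox {a b} (ha : a ∈ chartBox φ J) (hb : b ∈ chartBox φ J) :
      FinerAt g L L' a → FinerAt g L L' b := fun h =>
    H.finerAt_of_finerAt hJ hJs (fun q hq => hL q (hs hq)) (fun q hq => hL' q (hs hq)) ha h hb
  filter_upwards [mem_nhdsWithin_of_mem_nhds (hJ.isOpen_chartBox.mem_nhds haJ)] with b hb
  exact ⟨hbox haJ hb, hbox hb haJ⟩

end Admissible

/-! ### Continuation of germs over simply connected sets -/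

section Continuation

open Topology Filter

/-- The space of values of germs of sections satisfying the local condition `A`. A germ is recorded
by its value only, since below the value at a point determines the germ. -/
@[ext]
structure GermSpace {X B : Type*} (A : (X → B) → X → Prop) where
  base : X
  val : B
  exists_germ : ∃ s, A s base ∧ s base = val

variable {X B : Type*} {A : (X → B) → X → Prop} {s s' : X → B}
  {D W : Set X} {p q : X}

namespace GermSpace

/-- The point of the germ space defined by a section. -/
def ofSection (h : A s q) : GermSpace A := ⟨q, s q, s, h, rfl⟩

/-- The graph of `s` over `D` as a subset of the germ space. -/
def sheet (A : (X → B) → X → Prop) (s : X → B) (D : Set X) : Set (GermSpace A) :=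
  {e | e.base ∈ D ∧ e.val = s e.base}

lemma injOn_base_sheet : InjOn base (sheet A s D) := fun _ he _ he' hb =>
  GermSpace.ext hb (by rw [he.2, he'.2, hb])

lemma surjOn_base_sheet (hs : ∀ q ∈ D, A s q) : SurjOn base (sheet A s D) D := fun q hq =>
  ⟨ofSection (hs q hq), ⟨hq, rfl⟩, rfl⟩

lemma preimage_base_inter_sheet (hW : W ⊆ D) : base ⁻¹' W ∩ sheet A s D = sheet A s W :=
  Set.ext fun _ => ⟨fun h => ⟨h.1, h.2.2⟩, fun h => ⟨h.1, hW h.1, h.2⟩⟩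

variable [TopologicalSpace X]

/-- A set of germ values is open if it contains, with every value, the values at the nearby points
of all sections through it. -/
instance : TopologicalSpace (GermSpace A) where
  IsOpen S := ∀ e ∈ S, ∀ s, A s e.base → s e.base = e.val →
    ∀ᶠ q in 𝓝 e.base, ∀ h : A s q, ofSection h ∈ S
  isOpen_univ := by simp
  isOpen_inter S T hS hT e he s hs hv := by
    filter_upwards [hS e he.1 s hs hv, hT e he.2 s hs hv] with q h1 h2 h
    exact ⟨h1 h, h2 h⟩
  isOpen_sUnion 𝓢 h𝓢 e he s hs hv := by
    obtain ⟨S, hS, heS⟩ := he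
    filter_upwards [h𝓢 S hS e heS s hs hv] with q h1 h
    exact ⟨S, hS, h1 h⟩

lemma isOpen_iff {S : Set (GermSpace A)} : IsOpen S ↔ ∀ e ∈ S, ∀ s, A s e.base →
    s e.base = e.val → ∀ᶠ q in 𝓝 e.base, ∀ h : A s q, ofSection h ∈ S := Iff.rfl

lemma isOpen_of_isOpen_sheet (hD : IsOpen D) (hs : ∀ q ∈ D, A s q) (hW : W ⊆ D)
    (h : IsOpen (sheet A s W)) : IsOpen W := by
  refine isOpen_iff_mem_nhds.2 fun q hq => ?_
  filter_upwards [isOpen_iff.1 h (ofSection (hs q (hW hq))) ⟨hq, rfl⟩ s (hs q (hW hq)) rfl,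
    hD.mem_nhds (hW hq)] with r hr hrD
  exact (hr (hs r hrD)).1

end GermSpace

open GermSpace

variable [TopologicalSpace X]

/-- An open set over which the germs of sections satisfying `A` extend uniquely. -/
structure IsExtensionDomain (A : (X → B) → X → Prop) (D : Set X) : Prop where
  isOpen : IsOpen D
  exists_extension : ∀ s, ∀ q ∈ D, A s q → ∃ s', (∀ r ∈ D, A s' r) ∧ s' =ᶠ[𝓝 q] s
  eqOn : ∀ s s', (∀ r ∈ D, A s r) → (∀ r ∈ D, A s' r) → ∀ q ∈ D, s q = s' q → EqOn s s' D

namespace IsExtensionDomain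

lemma exists_section_eq (hD : IsExtensionDomain A D) (hp : p ∈ D)
    (b : {b : B // ∃ s, A s p ∧ s p = b}) : ∃ s, (∀ q ∈ D, A s q) ∧ s p = b := by
  obtain ⟨b, s, hs, rfl⟩ := b
  obtain ⟨s', hs', he⟩ := hD.exists_extension s p hp hs
  exact ⟨s', hs', he.eq_of_nhds⟩

lemma disjoint_sheet (hD : IsExtensionDomain A D) (hs : ∀ q ∈ D, A s q) (hs' : ∀ q ∈ D, A s' q)
    (hp : p ∈ D) (hne : s p ≠ s' p) : Disjoint (sheet A s D) (sheet A s' D) :=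
  Set.disjoint_left.2 fun e he he' =>
    hne (hD.eqOn s s' hs hs' e.base he.1 (he.2.symm.trans he'.2) hp)

lemma exists_mem_sheet (hD : IsExtensionDomain A D) {e : GermSpace A} (he : e.base ∈ D) :
    ∃ s, (∀ q ∈ D, A s q) ∧ e ∈ sheet A s D := by
  obtain ⟨s, hs, hv⟩ := e.exists_germ
  obtain ⟨t, ht, hts⟩ := hD.exists_extension s e.base he hs
  exact ⟨t, ht, he, by rw [hts.eq_of_nhds, hv]⟩

end IsExtensionDomain

/-- The local condition `A` is open, and every point has a neighbourhood over which germs extend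
uniquely. -/
structure HasUniqueExtension (A : (X → B) → X → Prop) : Prop where
  eventually : ∀ s q, A s q → ∀ᶠ r in 𝓝 q, A s r
  exists_domain : ∀ p, ∃ D, IsExtensionDomain A D ∧ p ∈ D

namespace HasUniqueExtension

lemma eventuallyEq (hA : HasUniqueExtension A) (hs : A s q) (hs' : A s' q) (h : s q = s' q) :
    s =ᶠ[𝓝 q] s' := by
  obtain ⟨D, hD, hq⟩ := hA.exists_domain q
  obtain ⟨t, ht, hts⟩ := hD.exists_extension s q hq hs
  obtain ⟨t', ht', hts'⟩ := hD.exists_extension s' q hq hs'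
  have htt' : EqOn t t' D := hD.eqOn t t' ht ht' q hq (by rw [hts.eq_of_nhds, hts'.eq_of_nhds, h])
  filter_upwards [hts, hts', hD.isOpen.mem_nhds hq] with r hr hr' hrD
  rw [← hr, ← hr', htt' hrD]

lemma isOpen_sheet (hA : HasUniqueExtension A) (hW : IsOpen W) (hs : ∀ q ∈ W, A s q) :
    IsOpen (sheet A s W) := by
  rw [GermSpace.isOpen_iff]
  rintro e ⟨heW, hev⟩ t ht htv
  filter_upwards [hA.eventuallyEq ht (hs _ heW) (by rw [htv, hev]), hW.mem_nhds heW]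
    with q hq hqW h
  exact ⟨hqW, hq⟩

lemma isCoveringMap (hA : HasUniqueExtension A) (hne : ∃ s, ∀ q, A s q) :
    IsCoveringMap (GermSpace.base : GermSpace A → X) := by
  obtain ⟨s₀, hs₀⟩ := hne
  choose D hD hpD using hA.exists_domain
  let F (p : X) : Type _ := {b : B // ∃ s, A s p ∧ s p = b}
  let (p : X) : TopologicalSpace (F p) := ⊥
  have (p : X) : DiscreteTopology (F p) := ⟨rfl⟩
  have : Nonempty (X → GermSpace A) := ⟨fun q => ofSection (hs₀ q)⟩
  have (p : X) : Nonempty (F p) := ⟨⟨s₀ p, s₀, hs₀ p, rfl⟩⟩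
  choose sec hsec hsecp using fun p => (hD p).exists_section_eq (hpD p)
  refine IsCoveringMap.mk GermSpace.base F (fun p => (hD p).isOpen.trivializationDiscrete
    (fun b : F p => sheet A (sec p b) (D p)) (D p) (fun b W hW => ?_)
    (fun _ => injOn_base_sheet) (fun b => surjOn_base_sheet (hsec p b)) (fun b b' hbb' => ?_)
    fun e he => ?_) hpD
  · rw [preimage_base_inter_sheet hW]
    exact ⟨fun ho => hA.isOpen_sheet ho fun q hq => hsec p b q (hW hq),
      isOpen_of_isOpen_sheet (hD p).isOpen (hsec p b) hW⟩
  · refine (hD p).disjoint_sheet (hsec p b) (hsec p b') (hpD p) ?_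
    rw [hsecp, hsecp]
    exact Subtype.coe_injective.ne hbb'
  · obtain ⟨t, ht, het⟩ := (hD p).exists_mem_sheet he
    let b : F p := ⟨t p, t, ht p (hpD p), rfl⟩
    exact mem_iUnion.2 ⟨b, he, het.2.trans
      ((hD p).eqOn t (sec p b) ht (hsec p b) p (hpD p) (hsecp p b).symm he)⟩

theorem exists_continuation [LocallyPathConnectedSpace X] (hA : HasUniqueExtension A)
    (hcongr : ∀ s s' q, A s q → s' =ᶠ[𝓝 q] s → A s' q)
    (hne : ∃ s, ∀ q, A s q) {U : Set X} (hU : IsOpen U) [SimplyConnectedSpace U]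
    (hp : p ∈ U) (hs : A s p) : ∃ s', (∀ q ∈ U, A s' q) ∧ s' p = s p := by
  classical
  have : LocallyPathConnectedSpace U := hU.locallyPathConnectedSpace
  obtain ⟨F, ⟨hF0, hF⟩, -⟩ := (hA.isCoveringMap hne).existsUnique_continuousMap_lifts
    (⟨Subtype.val, continuous_subtype_val⟩ : C(U, X)) ⟨p, hp⟩ (ofSection hs) rfl
  have hbase (q : U) : (F q).base = q := congrFun hF q
  let s' (q : X) : B := if h : q ∈ U then (F ⟨q, h⟩).val else s q
  have hs' (q) (h : q ∈ U) : s' q = (F ⟨q, h⟩).val := dif_pos h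
  refine ⟨s', fun q hq => ?_, by rw [hs' p hp, hF0]; rfl⟩
  obtain ⟨t, ht, htv⟩ := (F ⟨q, hq⟩).exists_germ
  rw [hbase] at ht htv
  refine hcongr t s' q ht ?_
  obtain ⟨W, hWA, hW, hqW⟩ := eventually_nhds_iff.1 (hA.eventually t q ht)
  have hsheet : ∀ᶠ r : U in 𝓝 ⟨q, hq⟩, F r ∈ sheet A t W :=
    ((hA.isOpen_sheet hW hWA).preimage F.continuous).mem_nhds
      ⟨by rwa [hbase], by rw [hbase]; exact htv.symm⟩
  rw [hU.isOpenEmbedding_subtypeVal.nhds_eq_comap, eventually_comap] at hsheet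
  filter_upwards [hsheet, hU.mem_nhds hq] with r hr hrU
  rw [hs' r hrU, (hr ⟨r, hrU⟩ rfl).2, hbase]

end HasUniqueExtension

end Continuation

/-! ### The tensor form of the separation theorem -/

lemma exists_mem_forall_apply_eq_of_apply_eq {𝕜 ι : Type*} [Field 𝕜] [Infinite 𝕜] [Finite ι]
    (V : Submodule 𝕜 (ι → 𝕜)) : ∃ l ∈ V, ∀ i j, l i = l j → ∀ l' ∈ V, l' i = l' j := by
  by_contra! hcon
  let separated := {ij : ι × ι // ∃ l ∈ V, l ij.1 ≠ l ij.2}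
  let P (ij : separated) : Subspace 𝕜 V := LinearMap.ker
    ((LinearMap.proj (R := 𝕜) (φ := fun _ : ι => 𝕜) ij.1.1 -
      LinearMap.proj (R := 𝕜) (φ := fun _ : ι => 𝕜) ij.1.2).comp V.subtype)
  have mem_P (ij : separated) (v : V) : v ∈ P ij ↔ v.1 ij.1.1 = v.1 ij.1.2 := by
    simp [P, sub_eq_zero]
  have hcover : ⋃ ij, (P ij : Set V) = univ := by
    refine eq_univ_of_forall fun v => ?_
    obtain ⟨i, j, hij, l', hl', hne⟩ := hcon v.1 v.2
    exact mem_iUnion.2 ⟨⟨(i, j), l', hl', hne⟩, (mem_P _ v).2 hij⟩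
  obtain ⟨ij, htop⟩ := Subspace.exists_eq_top_of_iUnion_eq_univ hcover
  obtain ⟨l, hl, hne⟩ := ij.2
  exact hne ((mem_P ij ⟨l, hl⟩).1 (htop ▸ Submodule.mem_top))

/-- The space of values at `x` of the solutions on a box, so that each `l` in it is the tuple of
eigenvalues at `x` of a concircular tensor. -/
def solValues {n : ℕ} (h : Fin n → (Fin n → ℝ) → ℝ) (J : Fin n → Set ℝ) (x : Fin n → ℝ) :
    Submodule ℝ (Fin n → ℝ) where
  carrier := {l | ∃ lam, IsSol h J lam ∧ ∀ i, l i = lam i (x i)}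
  add_mem' := by
    rintro l l' ⟨lam, hlam, hl⟩ ⟨mu, hmu, hl'⟩
    exact ⟨_, hlam.add hmu, fun i => by rw [Pi.add_apply, hl, hl']⟩
  zero_mem' := ⟨_, IsSol.const 0, fun _ => rfl⟩
  smul_mem' := by
    rintro c l ⟨lam, hlam, hl⟩
    exact ⟨_, hlam.smul c, fun i => by rw [Pi.smul_apply, hl, smul_eq_mul]⟩

section Global

variable {n : ℕ} {M : Type*} [TopologicalSpace M] [ChartedSpace (Fin n → ℝ) M]
  {g K L : Tensor2 n M} {p : M} {κ : ℝ}

lemma eigSpace_eq_top {c : ℝ} (h : L p = c • g p) : eigSpace g L p c = ⊤ :=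
  LinearMap.ker_eq_top.2 (sub_eq_zero.2 h)

lemma admissibleAt_metric (hg : IsPseudoRiemannian g) (hκ : HasConstantCurvature g κ)
    (hK : IsCharacteristicKilling g K) (hn : 1 < n) (p : M) : AdmissibleAt g K g p := by
  obtain ⟨φ, J, H, hJ, hJs, hp, -⟩ := hK.exists_adapted_chartBox hg hκ isOpen_univ (mem_univ p)
  exact H.admissibleAt_of_isSol hJ hJs hg hn (IsSol.const 1)
    (fun _ hx => H.orth.isDiagAt_self (hJs hx)) hp

lemma hasUniqueExtension_admissibleAt (hg : IsPseudoRiemannian g)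
    (hκ : HasConstantCurvature g κ) (hK : IsCharacteristicKilling g K) (hn : 1 < n) :
    HasUniqueExtension fun (L : M → LinearMap.BilinForm ℝ (Fin n → ℝ)) (q : M) =>
      AdmissibleAt g K L q where
  eventually _ _ h := isOpen_admissibleAt.mem_nhds h
  exists_domain p := by
    obtain ⟨φ, J, H, hJ, hJs, hp, -⟩ := hK.exists_adapted_chartBox hg hκ isOpen_univ (mem_univ p)
    refine ⟨chartBox φ J, ⟨hJ.isOpen_chartBox, fun L q hq hL => ?_,
      fun L L' hL hL' q hq he r hr => H.eqOn_of_eq hJ hJs hn hL hL' hq he hr⟩, hp⟩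
    obtain ⟨L', hL', W, hW, hqW, he⟩ := H.exists_extension hJ hJs hg hn hq hL
    exact ⟨L', hL', Filter.eventually_of_mem (hW.mem_nhds hqW) he⟩

lemma AdmissibleAt.exists_continuation (hg : IsPseudoRiemannian g)
    (hκ : HasConstantCurvature g κ) (hK : IsCharacteristicKilling g K) (hn : 1 < n) {U : Set M}
    (hU : IsOpen U) (hUs : SimplyConnectedSpace U) (hp : p ∈ U) (hL : AdmissibleAt g K L p) :
    ∃ L' : Tensor2 n M, (∀ q ∈ U, AdmissibleAt g K L' q) ∧ L' p = L p := by
  have : LocallyPathConnectedSpace M := ChartedSpace.locallyPathConnectedSpace (Fin n → ℝ) M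
  refine (hasUniqueExtension_admissibleAt hg hκ hK hn).exists_continuation
    (fun L L' q hL he => ?_) ⟨_, admissibleAt_metric hg hκ hK hn⟩ hU hp (s := L) hL
  obtain ⟨W, hWe, hW, hqW⟩ := eventually_nhds_iff.1 he
  exact hL.congr hW hqW hWe

lemma IsSol.exists_continuation {φ : OpenPartialHomeomorph M (Fin n → ℝ)} {J : Fin n → Set ℝ}
    {lam : Fin n → ℝ → ℝ} (hlam : IsSol (diagOf (comp g φ)) J lam) (hg : IsPseudoRiemannian g)
    (hκ : HasConstantCurvature g κ) (hK : IsCharacteristicKilling g K) (hn : 1 < n)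
    (H : AdaptedChart κ g K φ) (hJ : IsBox J) (hJs : univ.pi J ⊆ φ.target)
    (hpJ : p ∈ chartBox φ J) {U : Set M} (hU : IsOpen U) (hUs : SimplyConnectedSpace U)
    (hp : p ∈ U) :
    ∃ L : Tensor2 n M, (∀ q ∈ U, AdmissibleAt g K L q) ∧
      IsDiagAt (comp g φ) (comp L φ) (fun i => lam i (φ p i)) (φ p) := by
  have hdiag := H.coord.isDiagOn_tensorOf (g := g) hJs lam
  obtain ⟨L, hL, hLp⟩ := (H.admissibleAt_of_isSol hJ hJs hg hn hlam hdiag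
    hpJ).exists_continuation hg hκ hK hn hU hUs hp
  refine ⟨L, hL, fun i j => ?_⟩
  rw [comp_congr ((φ.left_inv hpJ.1).symm ▸ hLp), hdiag _ hpJ.2]

lemma exists_admissibleAt_forall_finerAt (hg : IsPseudoRiemannian g)
    (hκ : HasConstantCurvature g κ) (hK : IsCharacteristicKilling g K) (hn : 1 < n) {U : Set M}
    (hU : IsOpen U) (hUs : SimplyConnectedSpace U) :
    ∃ L : Tensor2 n M, (∀ q ∈ U, AdmissibleAt g K L q) ∧
      ∀ L' : Tensor2 n M, (∀ q ∈ U, AdmissibleAt g K L' q) → ∀ q ∈ U, FinerAt g L L' q := by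
  have hUc : IsPreconnected U := isPreconnected_iff_preconnectedSpace.2 inferInstance
  obtain ⟨p, hp⟩ : U.Nonempty := nonempty_coe_sort.1 inferInstance
  obtain ⟨φ, J, H, hJ, hJs, hpJ, hJU⟩ := hK.exists_adapted_chartBox hg hκ hU hp
  obtain ⟨l, ⟨lam, hlam, hl⟩, hgen⟩ :=
    exists_mem_forall_apply_eq_of_apply_eq (solValues (diagOf (comp g φ)) J (φ p))
  obtain ⟨L, hL, hLdiag⟩ := hlam.exists_continuation hg hκ hK hn H hJ hJs hpJ hU hUs hp
  refine ⟨L, hL, fun L' hL' q hq => finerAt_of_isPreconnected hg hκ hK hU hUc hL hL' hp ?_ hq⟩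
  obtain ⟨mu, hmu, hL'diag⟩ := H.exists_isSol hJ hJs fun q hq => hL' q (hJU hq)
  rw [← φ.left_inv hpJ.1, H.finerAt_iff (hJs hpJ.2) hLdiag (hL'diag _ hpJ.2)]
  exact fun i j hij => hgen i j (by rw [hl, hl, hij]) _ ⟨mu, hmu, fun _ => rfl⟩

lemma exists_admissibleAt_not_finerAt_metric (hg : IsPseudoRiemannian g)
    (hκ : HasConstantCurvature g κ) (hK : IsCharacteristicKilling g K) (hn : 1 < n) {U : Set M}
    (hU : IsOpen U) (hUs : SimplyConnectedSpace U) (hp : p ∈ U) :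
    ∃ L : Tensor2 n M, (∀ q ∈ U, AdmissibleAt g K L q) ∧ ¬ FinerAt g g L p := by
  obtain ⟨φ, J, H, hJ, hJs, hpJ, -⟩ := hK.exists_adapted_chartBox hg hκ hU hp
  obtain ⟨lam, hlam, hne⟩ := (H.sep.mono hJ.isOpen hJs).exists_sol hJ hn
  obtain ⟨i, j, hij⟩ := hne _ hpJ.2
  obtain ⟨L, hL, hLdiag⟩ := hlam.exists_continuation hg hκ hK hn H hJ hJs hpJ hU hUs hp
  refine ⟨L, hL, fun hf => hij ?_⟩
  rw [← φ.left_inv hpJ.1,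
    H.finerAt_iff (hJs hpJ.2) (H.orth.isDiagAt_self (hJs hpJ.2)) hLdiag] at hf
  exact hf i j rfl

theorem exists_finest_concircular (hg : IsPseudoRiemannian g) (hκ : HasConstantCurvature g κ)
    (hK : IsCharacteristicKilling g K) (hn : 1 < n) {U : Set M} (hU : IsOpen U)
    (hUs : SimplyConnectedSpace U) :
    ∃ L : Tensor2 n M, IsConcircularOn g L U ∧ IsNontrivialOn g L U ∧
      LeavesEigenspacesInvariantOn g K L U ∧
      ∀ (V : Set M) (L' : Tensor2 n M), IsOpen V → V ⊆ U → IsConcircularOn g L' V →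
        LeavesEigenspacesInvariantOn g K L' V → ∀ p ∈ V, FinerAt g L L' p := by
  obtain ⟨L, hL, hfiner⟩ := exists_admissibleAt_forall_finerAt hg hκ hK hn hU hUs
  refine ⟨L, isConcircularOn_of_admissibleAt hL, fun _ p hp c hc => ?_,
    leavesEigenspacesInvariantOn_of_admissibleAt hL, fun V L' hV hVU hc hi p hp μ => ?_⟩
  · obtain ⟨L', hL', hnot⟩ := exists_admissibleAt_not_finerAt_metric hg hκ hK hn hU hUs hp
    obtain ⟨ν, hν⟩ := hfiner L' hL' p hp c
    rw [eigSpace_eq_top hc] at hν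
    exact hnot fun _ => ⟨ν, le_top.trans hν⟩
  · have hadm : AdmissibleAt g K L' p := ⟨V, hV, hp, hc, hi⟩
    obtain ⟨L'', hL'', he⟩ := hadm.exists_continuation hg hκ hK hn hU hUs (hVU hp)
    obtain ⟨ν, hν⟩ := hfiner L'' hL'' p (hVU hp) μ
    exact ⟨ν, hν.trans_eq (by rw [eigSpace, eigSpace, he])⟩

lemma isConcircularOn_metric_of_subsingleton [Subsingleton (Fin n)] (hg : IsPseudoRiemannian g)
    (U : Set M) : IsConcircularOn g g U := by
  refine ⟨hg.1.mono (subset_univ U), fun φ hφ x hx _ => ?_⟩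
  have ho : IsOrthogonal g φ := fun x _ i j hij => (hij (Subsingleton.elim i j)).elim
  exact (ho.orthMetric hg hφ).concircularAt_self hx

lemma exists_eq_smul_metric_of_subsingleton [IsManifold 𝓘(ℝ, Fin n → ℝ) ∞ M]
    [Subsingleton (Fin n)] (hg : IsPseudoRiemannian g) (L : Tensor2 n M) (p : M) :
    ∃ c : ℝ, L p = c • g p := by
  let φ := chartAt (Fin n → ℝ) p
  have hφ : IsCoord φ := IsManifold.chart_mem_maximalAtlas p
  have hp : p ∈ φ.source := mem_chart_source _ p
  have ho : IsOrthogonal g φ := fun x _ i j hij => (hij (Subsingleton.elim i j)).elim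
  rcases isEmpty_or_nonempty (Fin n) with hempty | ⟨⟨a⟩⟩
  · exact ⟨0, hφ.eq_of_comp_eq (T := L) (T' := fun q => (0 : ℝ) • g q) hp (Subsingleton.elim _ _)⟩
  · let c := comp L φ (φ p) a a / comp g φ (φ p) a a
    refine ⟨c, hφ.eq_of_comp_eq (T := L) (T' := fun q => c • g q) hp ?_⟩
    ext i j
    change _ = c * comp g φ (φ p) i j
    rw [Subsingleton.elim i a, Subsingleton.elim j a,
      div_mul_cancel₀ _ ((ho.orthMetric hg hφ).ne_zero a _ (φ.map_source hp))]

end Global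

end KEM

end

theorem mainTheorem1_general {n : ℕ} {M : Type*} [TopologicalSpace M]
    [ChartedSpace (Fin n → ℝ) M] [IsManifold 𝓘(ℝ, Fin n → ℝ) ∞ M]
    (g : KEM.Tensor2 n M) (hg : KEM.IsPseudoRiemannian g)
    (κ : ℝ) (hκ : KEM.HasConstantCurvature g κ) :
    (∀ φ : OpenPartialHomeomorph M (Fin n → ℝ), KEM.IsCoord φ →
      KEM.IsOrthogonal g φ → KEM.IsSeparable g φ →
      ∀ J : Fin n → Set ℝ, (∀ i, IsOpen (J i) ∧ (J i).OrdConnected ∧ (J i).Nonempty) →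
        univ.pi J ⊆ φ.target → KEM.HasConcircularForm (KEM.comp g φ) J) ∧
    (∀ K : KEM.Tensor2 n M, KEM.IsCharacteristicKilling g K →
      ∀ U : Set M, IsOpen U → SimplyConnectedSpace U →
        ∃ L : KEM.Tensor2 n M,
          KEM.IsConcircularOn g L U ∧ KEM.IsNontrivialOn g L U ∧
          KEM.LeavesEigenspacesInvariantOn g K L U ∧
          ∀ (V : Set M) (L' : KEM.Tensor2 n M), IsOpen V → V ⊆ U →
            KEM.IsConcircularOn g L' V → KEM.LeavesEigenspacesInvariantOn g K L' V →
            ∀ p ∈ V, ∀ μ : ℝ, ∃ ν : ℝ, KEM.eigSpace g L p μ ≤ KEM.eigSpace g L' p ν) := by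
  refine ⟨fun φ hφ ho hs J hJ hJs => hs.hasConcircularForm hg hκ hφ ho hJ hJs,
    fun K hK U hU hUs => ?_⟩
  by_cases hn : 1 < n
  · exact KEM.exists_finest_concircular hg hκ hK hn hU hUs
  · have : Subsingleton (Fin n) := Fin.subsingleton_iff_le_one.2 (not_lt.1 hn)
    refine ⟨g, KEM.isConcircularOn_metric_of_subsingleton hg U, fun h => (hn h).elim,
      fun p _ μ v hv => ⟨v, hv, fun _ => rfl⟩, fun V L' _ _ _ _ p _ μ => ?_⟩
    obtain ⟨c, hc⟩ := KEM.exists_eq_smul_metric_of_subsingleton hg L' p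
    exact ⟨c, le_top.trans_eq (KEM.eigSpace_eq_top hc).symm⟩

theorem mainTheorem1 {n : ℕ} {M : Type*} [TopologicalSpace M] [T2Space M]
    [ChartedSpace (Fin n → ℝ) M] [IsManifold 𝓘(ℝ, Fin n → ℝ) ∞ M]
    (g : KEM.Tensor2 n M) (hg : KEM.IsPseudoRiemannian g)
    (κ : ℝ) (hκ : KEM.HasConstantCurvature g κ) :
    (∀ φ : OpenPartialHomeomorph M (Fin n → ℝ), KEM.IsCoord φ →
      KEM.IsOrthogonal g φ → KEM.IsSeparable g φ →
      ∀ J : Fin n → Set ℝ, (∀ i, IsOpen (J i) ∧ (J i).OrdConnected ∧ (J i).Nonempty) →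
        univ.pi J ⊆ φ.target → KEM.HasConcircularForm (KEM.comp g φ) J) ∧
    (∀ K : KEM.Tensor2 n M, KEM.IsCharacteristicKilling g K →
      ∀ U : Set M, IsOpen U → SimplyConnectedSpace U →
        ∃ L : KEM.Tensor2 n M,
          KEM.IsConcircularOn g L U ∧ KEM.IsNontrivialOn g L U ∧
          KEM.LeavesEigenspacesInvariantOn g K L U ∧
          ∀ (V : Set M) (L' : KEM.Tensor2 n M), IsOpen V → V ⊆ U →
            KEM.IsConcircularOn g L' V → KEM.LeavesEigenspacesInvariantOn g K L' V →
            ∀ p ∈ V, ∀ μ : ℝ, ∃ ν : ℝ, KEM.eigSpace g L p μ ≤ KEM.eigSpace g L' p ν) :=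
  mainTheorem1_general g hg κ hκ
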